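/- There are an absolute constant $C>0$, a polynomial $T$, and a single deterministic algorithm with the following property. Let $G=(V,E,w)$ be a finite simple undirected graph on $n=|V|$ vertices with edge weights $w:E\to[0,\infty)$, and let $0\le\varepsilon\le 1$. On input $(G,\varepsilon)$ the algorithm halts after at most $T(n)$ steps and outputs a subgraph $H=(V,E',w)$, $E'\subseteq E$, with \[ |E'|\le C\,n^{1+\varepsilon} \] such that for all $u,v\in V$ and every shortest $u$–$v$ path $P$ of $G$, \[ d_H(u,v)\le d_G(u,v)+C\,n^{\frac{1-\varepsilon}{2}}\log n\cdot W(P), \] where $d_G,d_H$ are the weighted shortest-path distances and $W(P)$ is the weight of the heaviest edge of $P$ (and $W(P)=0$ if $P$ has no edge). In other words, $H$ is a $+O(n^{(1-\varepsilon)/2}\log n)W$ spanner of size $O(n^{1+\varepsilon})$. In particular, for $\varepsilon=0$ one obtains a spanner with $O(n)$ edges and additive stretch $O(\sqrt n\log n)\cdot W$. Here steps are counted on a random access machine whose memory holds natural numbers and real numbers (the weights and $\varepsilon$ are given as real numbers, the graph by its adjacency matrix), and in which additions, subtractions and comparisons, as well as memory accesses, cost one step each. -/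

import Mathlib

open scoped NNReal ENNReal

/-! ### Weighted graphs, distances and additive spanners -/

/-- A finite undirected graph on the vertex set `Fin n` with nonnegative real edge weights.
Only the values of `w` on edges of `graph` are ever used. -/
structure WeightedGraph (n : ℕ) where
  graph : SimpleGraph (Fin n)
  w : Sym2 (Fin n) → ℝ≥0

namespace WeightedGraph

/-- The length of a walk: the sum of the weights of its edges. -/
def length {V : Type*} (w : Sym2 V → ℝ≥0) {H : SimpleGraph V} {u v : V} (p : H.Walk u v) : ℝ≥0 :=
  (p.edges.map w).sum

/-- The weight of the heaviest edge of a walk (`0` for a walk without edges). -/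
def heaviest {V : Type*} (w : Sym2 V → ℝ≥0) {H : SimpleGraph V} {u v : V} (p : H.Walk u v) : ℝ≥0 :=
  (p.edges.map w).foldr max 0

/-- The weighted distance of `u` and `v` in `H`: the infimum of the lengths of the walks from `u`
to `v`; it is `∞` if there is none. -/
noncomputable def dist {V : Type*} (w : Sym2 V → ℝ≥0) (H : SimpleGraph V) (u v : V) : ℝ≥0∞ :=
  ⨅ p : H.Walk u v, (length w p : ℝ≥0∞)

/-- `p` is a shortest path between its end points. -/
def IsShortestPath {V : Type*} (w : Sym2 V → ℝ≥0) {H : SimpleGraph V} {u v : V}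
    (p : H.Walk u v) : Prop :=
  p.IsPath ∧ (length w p : ℝ≥0∞) = dist w H u v

/-- `H` is a `+c·W` spanner of `G`: a subgraph on the same vertices, with the same weights, such
that `d_H(u,v) ≤ d_G(u,v) + c · W(P)` for all `u`, `v` and *every* shortest `u`-`v` path `P` of
`G`, where `W(P)` is the weight of the heaviest edge of `P`. Hence the bound holds however ties
between shortest paths are broken. -/
def IsAdditiveSpanner {n : ℕ} (G : WeightedGraph n) (H : SimpleGraph (Fin n)) (c : ℝ) : Prop :=
  H ≤ G.graph ∧
    ∀ (u v : Fin n) (P : G.graph.Walk u v), IsShortestPath G.w P →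
      dist G.w H u v ≤ dist G.w G.graph u v + ENNReal.ofReal c * (heaviest G.w P : ℝ≥0∞)

end WeightedGraph

/-! ### The machine model

A deterministic random access machine with natural number registers and arrays (for counters,
addresses and flags) and real number registers and arrays. The only operations on natural numbers
are addition, truncated subtraction and comparison, the only operations on real numbers are
addition, subtraction and comparison; each operation and each memory access costs one step. In
particular there is no multiplication and no rounding, so unit cost is a realistic measure up to a
polynomial. A program is a finite text that does not depend on the input. -/

namespace RealRAM

/-- The memory: scalar registers and two-dimensional arrays, named by natural numbers. -/
@[ext]
structure State where
  nreg : ℕ → ℕ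
  narr : ℕ → ℕ → ℕ → ℕ
  rreg : ℕ → ℝ
  rarr : ℕ → ℕ → ℕ → ℝ

/-- Expressions with natural number values; `cell a i j` reads entry `(i, j)` of array `a`. -/
inductive NExp where
  | lit (k : ℕ)
  | reg (x : ℕ)
  | cell (a : ℕ) (i j : NExp)
  | add (e f : NExp)
  | sub (e f : NExp)

def NExp.eval (s : State) : NExp → ℕ
  | lit k => k
  | reg x => s.nreg x
  | cell a i j => s.narr a (i.eval s) (j.eval s)
  | add e f => e.eval s + f.eval s
  | sub e f => e.eval s - f.eval s

def NExp.cost : NExp → ℕ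
  | lit _ => 1
  | reg _ => 1
  | cell _ i j => i.cost + j.cost + 1
  | add e f => e.cost + f.cost + 1
  | sub e f => e.cost + f.cost + 1

/-- Expressions with real values. -/
inductive RExp where
  | lit (k : ℕ)
  | reg (x : ℕ)
  | cell (a : ℕ) (i j : NExp)
  | add (e f : RExp)
  | sub (e f : RExp)

noncomputable def RExp.eval (s : State) : RExp → ℝ
  | lit k => k
  | reg x => s.rreg x
  | cell a i j => s.rarr a (i.eval s) (j.eval s)
  | add e f => e.eval s + f.eval s
  | sub e f => e.eval s - f.eval s

def RExp.cost : RExp → ℕ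
  | lit _ => 1
  | reg _ => 1
  | cell _ i j => i.cost + j.cost + 1
  | add e f => e.cost + f.cost + 1
  | sub e f => e.cost + f.cost + 1

/-- Tests. -/
inductive Test where
  | nle (e f : NExp)
  | rle (e f : RExp)
  | not (b : Test)
  | and (b c : Test)

def Test.Holds (s : State) : Test → Prop
  | nle e f => e.eval s ≤ f.eval s
  | rle e f => e.eval s ≤ f.eval s
  | not b => ¬ b.Holds s
  | and b c => b.Holds s ∧ c.Holds s

def Test.cost : Test → ℕ
  | nle e f => e.cost + f.cost + 1
  | rle e f => e.cost + f.cost + 1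
  | not b => b.cost + 1
  | and b c => b.cost + c.cost + 1

/-- Programs: assignments to registers and array entries, composition, branching and
while-loops. -/
inductive Program where
  | skip
  | nset (x : ℕ) (e : NExp)
  | rset (x : ℕ) (e : RExp)
  | nput (a : ℕ) (i j : NExp) (e : NExp)
  | rput (a : ℕ) (i j : NExp) (e : RExp)
  | seq (c d : Program)
  | ite (b : Test) (c d : Program)
  | loop (b : Test) (c : Program)

/-- Overwriting one entry of one array. -/
def setCell {R : Type} (m : ℕ → ℕ → ℕ → R) (a i j : ℕ) (r : R) : ℕ → ℕ → ℕ → R :=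
  fun a' i' j' => if a' = a ∧ i' = i ∧ j' = j then r else m a' i' j'

/-- `Exec c s k t`: started in `s`, the program `c` halts in the state `t` after `k` steps. -/
inductive Exec : Program → State → ℕ → State → Prop
  | skip (s : State) : Exec .skip s 1 s
  | nset (s : State) (x : ℕ) (e : NExp) :
      Exec (.nset x e) s (e.cost + 1) { s with nreg := Function.update s.nreg x (e.eval s) }
  | rset (s : State) (x : ℕ) (e : RExp) :
      Exec (.rset x e) s (e.cost + 1) { s with rreg := Function.update s.rreg x (e.eval s) }
  | nput (s : State) (a : ℕ) (i j : NExp) (e : NExp) :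
      Exec (.nput a i j e) s (i.cost + j.cost + e.cost + 1)
        { s with narr := setCell s.narr a (i.eval s) (j.eval s) (e.eval s) }
  | rput (s : State) (a : ℕ) (i j : NExp) (e : RExp) :
      Exec (.rput a i j e) s (i.cost + j.cost + e.cost + 1)
        { s with rarr := setCell s.rarr a (i.eval s) (j.eval s) (e.eval s) }
  | seq {c d : Program} {s t r : State} {k l : ℕ} :
      Exec c s k t → Exec d t l r → Exec (.seq c d) s (k + l) r
  | ite_true {b : Test} {c d : Program} {s t : State} {k : ℕ} :
      b.Holds s → Exec c s k t → Exec (.ite b c d) s (b.cost + k + 1) t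
  | ite_false {b : Test} {c d : Program} {s t : State} {k : ℕ} :
      ¬ b.Holds s → Exec d s k t → Exec (.ite b c d) s (b.cost + k + 1) t
  | loop_done {b : Test} {c : Program} {s : State} :
      ¬ b.Holds s → Exec (.loop b c) s (b.cost + 1) s
  | loop_step {b : Test} {c : Program} {s t r : State} {k l : ℕ} :
      b.Holds s → Exec c s k t → Exec (.loop b c) t l r →
        Exec (.loop b c) s (b.cost + k + l + 1) r

/-- The machine is deterministic: final state and number of steps are determined by the program
and the initial state. -/
theorem Exec.deterministic {c : Program} {s t : State} {k : ℕ} (h : Exec c s k t) :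
    ∀ {l : ℕ} {r : State}, Exec c s l r → k = l ∧ t = r := by
  induction h with
  | skip => intro l r h'; cases h'; exact ⟨rfl, rfl⟩
  | nset => intro l r h'; cases h'; exact ⟨rfl, rfl⟩
  | rset => intro l r h'; cases h'; exact ⟨rfl, rfl⟩
  | nput => intro l r h'; cases h'; exact ⟨rfl, rfl⟩
  | rput => intro l r h'; cases h'; exact ⟨rfl, rfl⟩
  | seq _ _ ih₁ ih₂ =>
    intro l r h'
    cases h' with
    | seq h₁ h₂ =>
      obtain ⟨rfl, rfl⟩ := ih₁ h₁
      obtain ⟨rfl, rfl⟩ := ih₂ h₂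
      exact ⟨rfl, rfl⟩
  | ite_true hb _ ih =>
    intro l r h'
    cases h' with
    | ite_true _ h₁ => obtain ⟨rfl, rfl⟩ := ih h₁; exact ⟨rfl, rfl⟩
    | ite_false hb' _ => exact absurd hb hb'
  | ite_false hb _ ih =>
    intro l r h'
    cases h' with
    | ite_true hb' _ => exact absurd hb' hb
    | ite_false _ h₁ => obtain ⟨rfl, rfl⟩ := ih h₁; exact ⟨rfl, rfl⟩
  | loop_done hb =>
    intro l r h'
    cases h' with
    | loop_done _ => exact ⟨rfl, rfl⟩
    | loop_step hb' _ _ => exact absurd hb' hb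
  | loop_step hb _ _ ih₁ ih₂ =>
    intro l r h'
    cases h' with
    | loop_done hb' => exact absurd hb hb'
    | loop_step _ h₁ h₂ =>
      obtain ⟨rfl, rfl⟩ := ih₁ h₁
      obtain ⟨rfl, rfl⟩ := ih₂ h₂
      exact ⟨rfl, rfl⟩

open Classical in
/-- The initial memory for a weighted graph `G` and a real parameter `ε`: natural register `0`
holds the number of vertices, natural array `0` the adjacency matrix, real register `0` the
parameter, real array `0` the weights of the edges; everything else is `0`. -/
noncomputable def input {n : ℕ} (G : WeightedGraph n) (ε : ℝ) : State where
  nreg x := if x = 0 then n else 0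
  narr a i j := if a = 0 ∧ ∃ (hi : i < n) (hj : j < n), G.graph.Adj ⟨i, hi⟩ ⟨j, hj⟩ then 1 else 0
  rreg x := if x = 0 then ε else 0
  rarr a i j :=
    if h : a = 0 ∧ ∃ (hi : i < n) (hj : j < n), G.graph.Adj ⟨i, hi⟩ ⟨j, hj⟩ then
      (G.w s(⟨i, h.2.1⟩, ⟨j, h.2.2.1⟩) : ℝ)
    else 0

/-- The graph `H` is the output stored in `s`: natural array `1` is its adjacency matrix. -/
def Outputs {n : ℕ} (s : State) (H : SimpleGraph (Fin n)) : Prop :=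
  ∀ i j : Fin n, (H.Adj i j → s.narr 1 i j = 1) ∧ (¬ H.Adj i j → s.narr 1 i j = 0)

end RealRAM

/-!
The edges are processed in the order of their weights; `M` consists of those processed so far and
`H` of those kept. An edge is kept if one of its ends has degree less than `d ≈ n ^ ε` in `H`, which
happens at most `n * d` times, or if its ends are at distance more than `κ ≈ 2 * log₂ n` times its
weight in `H`. The edges kept for the second reason form a graph of girth more than `κ + 1`, so
there are only `O(n)` of them.

Let `ω` be the largest weight processed so far and `R ≈ 3 * √(n / d)`. As long as the distance in
`H` between the ends of some walk in `M`, which is a shortest one in `G`, exceeds its length by more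
than `R * (8 + κ) * ω`, such a walk with as few edges missing in `H` as possible is bought, that is,
added to `H`. A missing edge has ends of degree at least `d` and detours of at most `κ * ω` in `H`.
Hence the walk has `R` missing edges between which the detour of `H` grows by more than `8 * ω`, so
that their neighbourhoods in `H` are disjoint and each earlier purchase has charged vertices of at
most one of them. The neighbourhoods that no earlier purchase has charged are charged for the new
one, and since there are only `n` vertices, fewer than `R / 2` walks are bought. As `H` is optimal
along the walks bought before, each of them meets a missing edge of a new one essentially once, so
that all purchases together add at most `n + R ^ 2` edges.
-/

namespace WeightedGraph

variable {V : Type*} {w : Sym2 V → ℝ≥0} {H K : SimpleGraph V} {u v x : V}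

/-! ### Lengths, distances and segments -/

theorem length_nil : length w (SimpleGraph.Walk.nil : H.Walk u u) = 0 := by
  simp [length]

theorem length_cons (h : H.Adj u v) (p : H.Walk v x) :
    length w (SimpleGraph.Walk.cons h p) = w s(u, v) + length w p := by
  simp [length]

theorem length_append (p : H.Walk u v) (q : H.Walk v x) :
    length w (p.append q) = length w p + length w q := by
  simp [length]

theorem length_reverse (p : H.Walk u v) : length w p.reverse = length w p := by
  simp [length, List.sum_reverse]

theorem length_mapLe (h : H ≤ K) (p : H.Walk u v) : length w (p.mapLe h) = length w p := by
  simp [length]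

theorem length_bypass_le [DecidableEq V] (p : H.Walk u v) : length w p.bypass ≤ length w p := by
  obtain ⟨l, hl, hs⟩ := p.bypass_isPath.edges_nodup.subperm p.edges_bypass_subset_edges
  rw [length, ← (hl.map w).sum_eq]
  exact (hs.map w).sum_le_sum fun _ _ => bot_le

theorem length_le_mul {ω : ℝ≥0} (hω : ∀ e ∈ H.edgeSet, w e ≤ ω) (p : H.Walk u v) :
    length w p ≤ p.length * ω := by
  have hle : ∀ c ∈ p.edges.map w, c ≤ ω :=
    List.forall_mem_map.2 fun e he => hω e (p.edges_subset_edgeSet he)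
  simpa [length] using List.sum_le_card_nsmul _ ω hle

theorem le_heaviest (p : H.Walk u v) {e : Sym2 V} (he : e ∈ p.edges) : w e ≤ heaviest w p :=
  List.le_max_of_le (List.mem_map_of_mem he) le_rfl

theorem dist_le_length (p : H.Walk u v) : dist w H u v ≤ length w p := iInf_le _ p

theorem dist_self (u : V) : dist w H u u = 0 :=
  le_antisymm (by simpa [length_nil] using dist_le_length (w := w) (.nil : H.Walk u u)) bot_le

theorem dist_triangle (u v x : V) : dist w H u x ≤ dist w H u v + dist w H v x := by
  refine ENNReal.le_iInf_add_iInf fun p q => ?_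
  rw [← ENNReal.coe_add, ← length_append]
  exact dist_le_length _

theorem dist_le_symm (u v : V) : dist w H u v ≤ dist w H v u := le_iInf fun p => by
  rw [← length_reverse]
  exact dist_le_length _

theorem dist_comm (u v : V) : dist w H u v = dist w H v u :=
  le_antisymm (dist_le_symm u v) (dist_le_symm v u)

theorem dist_anti (h : H ≤ K) (u v : V) : dist w K u v ≤ dist w H u v := le_iInf fun p => by
  rw [← length_mapLe h]
  exact dist_le_length _

theorem dist_le_of_adj (h : H.Adj u v) : dist w H u v ≤ w s(u, v) := by
  simpa [length_cons, length_nil] using dist_le_length (w := w) (.cons h .nil : H.Walk u v)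

theorem exists_length_eq_dist [Finite V] (h : dist w H u v ≠ ⊤) :
    ∃ p : H.Walk u v, (length w p : ℝ≥0∞) = dist w H u v := by
  classical
  have := Fintype.ofFinite V
  have : Nonempty (H.Path u v) := by
    by_contra hempty
    refine h (iInf_eq_top.2 fun p => (hempty ⟨p.toPath⟩).elim)
  obtain ⟨p, hp⟩ := Finite.exists_min fun p : H.Path u v => length w p.1
  refine ⟨p.1, le_antisymm (le_iInf fun q => ?_) (dist_le_length _)⟩
  exact_mod_cast (hp q.toPath).trans (length_bypass_le q)

/-- The sum of `f` over the pairs of consecutive vertices of the sequence `a` between the indices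
`i` and `j`. For `f = w` it is the length of that segment. -/
def segSum {A : Type*} [AddCommMonoid A] (f : Sym2 V → A) (a : ℕ → V) (i j : ℕ) : A :=
  ∑ k ∈ Finset.Ico i j, f s(a k, a (k + 1))

section Segments

variable {A : Type*} [AddCommMonoid A] {a : ℕ → V} {i j k : ℕ}

theorem segSum_add (f : Sym2 V → A) (a : ℕ → V) (hij : i ≤ j) (hjk : j ≤ k) :
    segSum f a i j + segSum f a j k = segSum f a i k :=
  Finset.sum_Ico_consecutive _ hij hjk

theorem segSum_succ (f : Sym2 V → A) (a : ℕ → V) (i : ℕ) :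
    segSum f a i (i + 1) = f s(a i, a (i + 1)) := by
  simp [segSum]

theorem sum_map_edges (f : Sym2 V → A) (p : H.Walk u v) :
    (p.edges.map f).sum = segSum f p.getVert 0 p.length := by
  induction p with
  | nil => simp [segSum]
  | cons h p ih =>
    rw [segSum, ← Finset.range_eq_Ico] at *
    rw [SimpleGraph.Walk.length_cons, Finset.sum_range_succ', add_comm]
    simp [ih]

theorem length_eq_segSum (p : H.Walk u v) : length w p = segSum w p.getVert 0 p.length :=
  sum_map_edges w p

theorem exists_walk_segment (hij : i ≤ j) (h : ∀ k, i ≤ k → k < j → K.Adj (a k) (a (k + 1))) :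
    ∃ q : K.Walk (a i) (a j), ∀ {A : Type} [AddCommMonoid A] (f : Sym2 V → A),
      (q.edges.map f).sum = segSum f a i j := by
  induction j, hij using Nat.le_induction with
  | base => exact ⟨.nil, fun f => by simp [segSum]⟩
  | succ j hij ih =>
    obtain ⟨q, hq⟩ := ih fun k hk hkj => h k hk (hkj.trans j.lt_succ_self)
    refine ⟨q.concat (h j hij j.lt_succ_self), fun f => ?_⟩
    rw [← segSum_add f a hij j.le_succ, segSum_succ, ← hq f]
    simp [SimpleGraph.Walk.edges_concat]

theorem dist_le_segSum (hij : i ≤ j) (h : ∀ k, i ≤ k → k < j → K.Adj (a k) (a (k + 1))) :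
    dist w K (a i) (a j) ≤ segSum w a i j := by
  obtain ⟨q, hq⟩ := exists_walk_segment hij h
  rw [← hq w]
  exact dist_le_length q

end Segments

end WeightedGraph

/-! ### Girth -/

section Girth

open SimpleGraph

variable {V : Type*} {F : SimpleGraph V} {r u v x y : V} {i k : ℕ}

theorem egirth_le_length_add_two {p : F.Walk x y} (hp : p.IsPath) (hv : v ∉ p.support)
    (hxy : x ≠ y) (hvx : F.Adj v x) (hvy : F.Adj v y) : F.egirth ≤ p.length + 2 := by
  have hcycle : (Walk.cons hvx (p.concat hvy.symm)).IsCycle := by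
    refine (Walk.cons_isCycle_iff _ _).2 ⟨hp.concat hv hvy.symm, fun he => ?_⟩
    simp only [Walk.edges_concat, List.concat_eq_append, List.mem_append, List.mem_singleton,
      Sym2.eq_iff] at he
    rcases he with he | ⟨rfl, rfl⟩ | ⟨-, rfl⟩
    · exact hv (p.fst_mem_support_of_mem_edges he)
    · exact hxy rfl
    · exact hxy rfl
  simpa [add_assoc, one_add_one_eq_two] using egirth_le_length hcycle

theorem exists_walk_notMem_edges_of_isCycle {a : V} {c : F.Walk a a} (hc : c.IsCycle)
    (hxy : s(x, y) ∈ c.edges) :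
    ∃ p : F.Walk x y, s(x, y) ∉ p.edges ∧ p.length + 1 ≤ c.length := by
  classical
  have hx := c.fst_mem_support_of_mem_edges hxy
  have hy := (c.mem_support_rotate_iff _ hx).2 (c.snd_mem_support_of_mem_edges hxy)
  set c' := c.rotate x hx
  have hsplit : c'.edges = (c'.takeUntil y hy).edges ++ (c'.dropUntil y hy).edges := by
    rw [← Walk.edges_append, Walk.take_spec]
  have hlen : c.length = (c'.takeUntil y hy).length + (c'.dropUntil y hy).length := by
    rw [← Walk.length_append, Walk.take_spec, Walk.length_rotate]
  have hnodup := (hc.rotate hx).edges_nodup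
  have hmem : s(x, y) ∈ c'.edges := (c.rotate_edges x hx).mem_iff.2 hxy
  rw [hsplit] at hnodup hmem
  have hdisj := List.disjoint_of_nodup_append hnodup
  rcases List.mem_append.1 hmem with h | h
  · refine ⟨(c'.dropUntil y hy).reverse, by simpa using hdisj h, ?_⟩
    have := List.length_pos_of_mem h
    simp only [Walk.length_edges, Walk.length_reverse] at this ⊢
    omega
  · refine ⟨c'.takeUntil y hy, fun h' => hdisj h' h, ?_⟩
    have := List.length_pos_of_mem h
    rw [Walk.length_edges] at this
    omega

theorem min_egirth_le_egirth_sup_edge (F : SimpleGraph V) (x y : V) :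
    min F.egirth (F.edist x y + 1) ≤ (F ⊔ edge x y).egirth := by
  have mem_edgeSet {a b : V} {p : (F ⊔ edge x y).Walk a b} (hp : s(x, y) ∉ p.edges) :
      ∀ e ∈ p.edges, e ∈ F.edgeSet := fun e he => by
    induction e with
    | _ a b =>
      have hab := p.edges_subset_edgeSet he
      simp only [mem_edgeSet, sup_adj, edge_adj] at hab
      exact hab.resolve_right fun h => hp (Sym2.eq_iff.2 h.1 ▸ he)
  refine le_egirth.2 fun a c hc => ?_
  by_cases hxy : s(x, y) ∈ c.edges
  · obtain ⟨p, hp, hlen⟩ := exists_walk_notMem_edges_of_isCycle hc hxy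
    have hdist := edist_le (p.transfer F (mem_edgeSet hp))
    rw [Walk.length_transfer] at hdist
    calc min F.egirth (F.edist x y + 1) ≤ p.length + 1 :=
          (min_le_right _ _).trans (by gcongr)
      _ ≤ c.length := by exact_mod_cast hlen
  · refine min_le_of_left_le ?_
    simpa only [Walk.length_transfer] using egirth_le_length (hc.transfer (mem_edgeSet hxy))

theorem exists_walk_notMem_support (hx : F.edist r x ≤ i) (hv : i ≤ F.edist r v) (hvx : v ≠ x) :
    ∃ p : F.Walk r x, p.length ≤ i ∧ v ∉ p.support := by
  classical
  obtain ⟨p, hp⟩ := exists_walk_of_edist_ne_top (ne_top_of_le_ne_top (ENat.natCast_ne_top i) hx)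
  have hpi : p.length ≤ i := by exact_mod_cast hp.trans_le hx
  refine ⟨p, hpi, fun hmem => ?_⟩
  have hlt := Walk.length_takeUntil_lt_length hmem hvx
  have hle : i ≤ (p.takeUntil v hmem).length := by exact_mod_cast hv.trans (edist_le _)
  omega

theorem eq_of_adj_of_edist_le (hF : 2 * i + 2 < F.egirth) (hv : i ≤ F.edist r v)
    (hvx : F.Adj v x) (hvy : F.Adj v y) (hx : F.edist r x ≤ i) (hy : F.edist r y ≤ i) :
    x = y := by
  classical
  by_contra hxy
  obtain ⟨p, hp, hvp⟩ := exists_walk_notMem_support hx hv hvx.ne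
  obtain ⟨q, hq, hvq⟩ := exists_walk_notMem_support hy hv hvy.ne
  have hmem : v ∉ (p.reverse.append q).bypass.support := fun h => by
    rcases (Walk.mem_support_append_iff _ _).1 (Walk.support_bypass_subset_support _ h) with h | h
    · exact hvp (by simpa using h)
    · exact hvq h
  have hlen : (p.reverse.append q).bypass.length ≤ 2 * i :=
    (Walk.length_bypass_le_length _).trans (by
      rw [Walk.length_append, Walk.length_reverse]
      omega)
  have hgirth := egirth_le_length_add_two (Walk.bypass_isPath _) hmem hxy hvx hvy
  exact absurd (hgirth.trans (by gcongr; exact_mod_cast hlen)) hF.not_ge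

theorem edist_eq_add_one (hv : F.edist r v = i) (hvx : F.Adj v x) (hx : i < F.edist r x) :
    F.edist r x = i + 1 := by
  refine le_antisymm ?_ (Order.add_one_le_of_lt hx)
  obtain ⟨p, hp⟩ := exists_walk_of_edist_ne_top (hv.trans_ne (ENat.natCast_ne_top i))
  rw [← hv, ← hp]
  simpa using edist_le (p.concat hvx)

theorem two_mul_ncard_sphere_le [Finite V] (hF : 2 * (i + 1 : ℕ) + 2 < F.egirth)
    (hdeg : ∀ v, 3 ≤ (F.neighborSet v).ncard) (r : V) :
    2 * {v | F.edist r v = i}.ncard ≤ {v | F.edist r v = (i + 1 : ℕ)}.ncard := by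
  classical
  have := Fintype.ofFinite V
  have hFi : 2 * (i : ℕ∞) + 2 < F.egirth := lt_of_le_of_lt (by gcongr; exact i.le_succ) hF
  suffices h : {v | F.edist r v = i}.toFinset.card * 2 ≤
      {v | F.edist r v = (i + 1 : ℕ)}.toFinset.card * 1 by
    rw [Set.ncard_eq_toFinset_card', Set.ncard_eq_toFinset_card']
    omega
  refine Finset.card_mul_le_card_mul F.Adj (fun v hv => ?_) fun v hv => ?_
  · have hv : F.edist r v = i := by simpa using hv
    have hsplit : (F.neighborSet v).toFinset ⊆
        (F.neighborSet v).toFinset.filter (F.edist r · ≤ i) ∪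
          Finset.bipartiteAbove F.Adj {v | F.edist r v = (i + 1 : ℕ)}.toFinset v := by
      intro z hz
      have hvz : F.Adj v z := by simpa using hz
      rw [Finset.mem_union, Finset.mem_filter, Finset.mem_bipartiteAbove]
      refine (le_or_gt (F.edist r z) i).imp (⟨hz, ·⟩) fun hlt => ⟨?_, hvz⟩
      simpa using edist_eq_add_one hv hvz hlt
    have hback : ((F.neighborSet v).toFinset.filter (F.edist r · ≤ i)).card ≤ 1 := by
      refine Finset.card_le_one.2 fun x hx y hy => ?_
      simp only [Finset.mem_filter, Set.mem_toFinset, mem_neighborSet] at hx hy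
      exact eq_of_adj_of_edist_le hFi hv.ge hx.1 hy.1 hx.2 hy.2
    have hcard := (Finset.card_le_card hsplit).trans (Finset.card_union_le _ _)
    have := hdeg v
    rw [Set.ncard_eq_toFinset_card'] at this
    omega
  · refine Finset.card_le_one.2 fun x hx y hy => ?_
    simp only [Finset.mem_bipartiteBelow, Set.mem_toFinset, Set.mem_ofPred_eq] at hx hy hv
    have hle : (i : ℕ∞) ≤ F.edist r v := hv ▸ Nat.cast_le.2 i.le_succ
    exact eq_of_adj_of_edist_le hFi hle hx.2.symm hy.2.symm hx.1.le hy.1.le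

theorem two_pow_le_ncard_sphere [Finite V] (hdeg : ∀ v, 3 ≤ (F.neighborSet v).ncard) (r : V)
    (hF : 2 * i + 2 < F.egirth) : 2 ^ i ≤ {v | F.edist r v = i}.ncard := by
  induction i with
  | zero => exact (Set.ncard_pos (Set.toFinite _)).2 ⟨r, by simp⟩
  | succ i ih =>
    rw [pow_succ']
    refine (Nat.mul_le_mul_left 2 (ih ?_)).trans (two_mul_ncard_sphere_le hF hdeg r)
    exact lt_of_le_of_lt (by gcongr; exact i.le_succ) hF

/-- By the doubling of the spheres some vertex has at most two neighbours; remove it and induct. -/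
theorem ncard_edgeSet_le_of_lt_egirth [Finite V] (hk : Nat.card V < 2 ^ k)
    (hF : 2 * k + 2 < F.egirth) : F.edgeSet.ncard ≤ 2 * Nat.card V := by
  classical
  induction hm : Nat.card V generalizing V with
  | zero =>
    have := Finite.card_eq_zero_iff.1 hm
    simp [Set.eq_empty_of_isEmpty]
  | succ m ih =>
    have := Fintype.ofFinite V
    have : Nonempty V := Finite.card_pos_iff.1 (hm ▸ m.succ_pos)
    obtain ⟨v, hv⟩ : ∃ v, (F.neighborSet v).ncard ≤ 2 := by
      by_contra! hdeg
      have hsphere := two_pow_le_ncard_sphere hdeg (Classical.arbitrary V) hF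
      exact absurd (hsphere.trans (Set.ncard_le_card _)) hk.not_ge
    have hcompl : Nat.card ({v}ᶜ : Set V) = m := by
      rw [Nat.card_coe_set_eq, Set.ncard_compl, Set.ncard_singleton, hm, Nat.add_sub_cancel]
    have hsub : (F.induce ({v}ᶜ : Set V)).edgeSet.ncard ≤ 2 * m :=
      ih (F := F.induce {v}ᶜ) (by omega)
        (hF.trans_le (SimpleGraph.Embedding.induce _).isContained.egirth_le) hcompl
    have hdel := card_edgeFinset_deleteIncidenceSet F v
    rw [← card_edgeFinset_induce_compl_singleton] at hdel
    rw [← coe_edgeFinset, Set.ncard_coe_finset] at hsub ⊢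
    have hdegree : F.degree v ≤ 2 := by
      rwa [← card_neighborSet_eq_degree, ← Nat.card_eq_fintype_card, Nat.card_coe_set_eq]
    omega

end Girth

namespace WeightedGraph

/-! ### Buying a shortest path -/

section Tight

variable {V : Type*} {w : Sym2 V → ℝ≥0} {G M H K : SimpleGraph V} {u v : V}
  {a : ℕ → V} {i j l : ℕ}

open Classical in
/-- The indicator function of the pairs that are not edges of `H`; as a weight it counts the edges
that have to be added to `H` in order to contain a walk. -/
noncomputable def missing (H : SimpleGraph V) (e : Sym2 V) : ℕ := if e ∉ H.edgeSet then 1 else 0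

/-- The number of edges of a walk that are missing in `H`, with multiplicity. -/
noncomputable def missCount (H : SimpleGraph V) {K : SimpleGraph V} (q : K.Walk u v) : ℕ :=
  (q.edges.map (missing H)).sum

theorem missCount_mapLe (h : H ≤ M) (q : H.Walk u v) : missCount H (q.mapLe h) = 0 := by
  simp only [missCount, SimpleGraph.Walk.edges_mapLe_eq_edges, List.sum_eq_zero_iff, List.mem_map]
  rintro _ ⟨e, he, rfl⟩
  simp [missing, q.edges_subset_edgeSet he]

open Classical in
theorem ncard_edgeSet_le_add_missCount [Finite V] (r : K.Walk u v)
    (hM : M.edgeSet ⊆ H.edgeSet ∪ {e | e ∈ r.edges}) :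
    M.edgeSet.ncard ≤ H.edgeSet.ncard + missCount H r := by
  set new := r.edges.filter (· ∉ H.edgeSet)
  have hnew : new.length = missCount H r := by
    rw [missCount, ← List.countP_eq_length_filter]
    induction r.edges with
    | nil => rfl
    | cons e p ih =>
      rw [List.countP_cons, ih, List.map_cons, List.sum_cons, add_comm]
      simp [missing]
  have hsub : M.edgeSet ⊆ H.edgeSet ∪ (new.toFinset : Set (Sym2 V)) := fun e he => by
    by_cases h : e ∈ H.edgeSet
    · exact .inl h
    · exact .inr (by simpa [new, h] using (hM he).resolve_left h)
  calc M.edgeSet.ncard ≤ H.edgeSet.ncard + (new.toFinset : Set (Sym2 V)).ncard :=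
        (Set.ncard_le_ncard hsub (Set.toFinite _)).trans (Set.ncard_union_le _ _)
    _ ≤ H.edgeSet.ncard + missCount H r := by
        rw [Set.ncard_coe_finset, ← hnew]
        gcongr
        exact List.toFinset_card_le _

theorem exists_walk_replace_segment (hMG : M ≤ G) (r : M.Walk u v) (hij : i ≤ j)
    (hj : j ≤ r.length) (q : G.Walk (r.getVert i) (r.getVert j)) :
    ∃ q' : G.Walk u v, ∀ {A : Type} [AddCommMonoid A] (f : Sym2 V → A),
      (q'.edges.map f).sum + segSum f r.getVert i j =
        (r.edges.map f).sum + (q.edges.map f).sum := by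
  have hadj k (hk : k < r.length) := hMG (r.adj_getVert_succ hk)
  obtain ⟨p, hp⟩ := exists_walk_segment i.zero_le fun k _ hk => hadj k (by omega)
  obtain ⟨s, hs⟩ := exists_walk_segment hj fun k _ hk => hadj k hk
  refine ⟨(p.append (q.append s)).copy (by simp) (by simp), fun f => ?_⟩
  simp only [SimpleGraph.Walk.edges_copy, SimpleGraph.Walk.edges_append, List.map_append,
    List.sum_append, hp, hs]
  rw [sum_map_edges f r, ← segSum_add f _ (i.zero_le.trans hij) hj, ← segSum_add f _ i.zero_le hij]
  abel

/-- `a 0, …, a l` is a walk in `M` each segment of which is shortest in `G` and, among the walks in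
`M` that are at most as long, has the least number of edges missing in `H`. -/
structure Tight (w : Sym2 V → ℝ≥0) (G M H : SimpleGraph V) (a : ℕ → V) (l : ℕ) : Prop where
  adj : ∀ i < l, M.Adj (a i) (a (i + 1))
  short : ∀ i j, i ≤ j → j ≤ l → segSum w a i j ≤ dist w G (a i) (a j)
  missing_le : ∀ i j, i ≤ j → j ≤ l → ∀ q : M.Walk (a i) (a j), length w q ≤ segSum w a i j →
    segSum (missing H) a i j ≤ missCount H q

theorem Tight.of_walk (hMG : M ≤ G) (r : M.Walk u v) (hlen : length w r ≤ dist w G u v)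
    (hmin : ∀ q : M.Walk u v, length w q ≤ length w r → missCount H r ≤ missCount H q) :
    Tight w G M H r.getVert r.length where
  adj i hi := r.adj_getVert_succ hi
  short i j hij hj := le_iInf fun q => by
    obtain ⟨q', hq'⟩ := exists_walk_replace_segment hMG r hij hj q
    have hle : length w r ≤ length w q' := by exact_mod_cast hlen.trans (dist_le_length q')
    have heq : length w q' + segSum w r.getVert i j = length w r + length w q := hq' w
    exact_mod_cast le_of_add_le_add_left ((add_le_add_left hle _).trans heq.le)
  missing_le i j hij hj q hq := by
    obtain ⟨q', hq'⟩ := exists_walk_replace_segment le_rfl r hij hj q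
    have hle : length w q' ≤ length w r := by
      refine le_of_add_le_add_right (a := segSum w r.getVert i j) ?_
      exact (hq' w).le.trans (add_le_add_right hq _)
    have heq : missCount H q' + segSum (missing H) r.getVert i j = missCount H r + missCount H q :=
      hq' _
    have := hmin q' hle
    omega

theorem Tight.dist_le_segSum (ht : Tight w G M H a l) (hMG : M ≤ G) (hij : i ≤ j) (hj : j ≤ l) :
    dist w G (a i) (a j) ≤ segSum w a i j :=
  WeightedGraph.dist_le_segSum hij fun k _ hk => hMG (ht.adj k (by omega))

theorem Tight.mem_edgeSet_of_dist_le [Finite V] (ht : Tight w G M H a l) (hHM : H ≤ M) (hMG : M ≤ G)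
    (hij : i < j) (hj : j ≤ l) (hd : dist w H (a i) (a j) ≤ dist w G (a i) (a j)) :
    s(a i, a (i + 1)) ∈ H.edgeSet := by
  have hle := hd.trans (ht.dist_le_segSum hMG hij.le hj)
  obtain ⟨q, hq⟩ := exists_length_eq_dist (ne_top_of_le_ne_top ENNReal.coe_ne_top hle)
  have hzero := ht.missing_le i j hij.le hj (q.mapLe hHM) (by
    rw [length_mapLe]
    exact_mod_cast hq.le.trans hle)
  rw [missCount_mapLe, Nat.le_zero, segSum, Finset.sum_eq_zero_iff] at hzero
  simpa [missing] using hzero i (by simp [hij])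

end Tight

section Purchases

variable {V : Type*} {w : Sym2 V → ℝ≥0} {G M H : SimpleGraph V} {a : ℕ → V} {l d : ℕ} {ω : ℝ≥0}

/-- The record of a path that was bought: its vertices, and neighbours of them that are charged for
it. -/
structure Purchase (V : Type*) where
  path : Finset V
  charge : Finset V

/-- After the purchase `H` contains shortest paths between the vertices of the bought path. -/
structure Purchase.Valid (w : Sym2 V → ℝ≥0) (G H : SimpleGraph V) (c : Purchase V) : Prop where
  dist_le : ∀ x ∈ c.path, ∀ y ∈ c.path, dist w H x y ≤ dist w G x y
  exists_adj : ∀ z ∈ c.charge, ∃ x ∈ c.path, H.Adj x z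

theorem Purchase.Valid.mono {c : Purchase V} (hc : c.Valid w G H) (hHM : H ≤ M) :
    c.Valid w G M where
  dist_le x hx y hy := (dist_anti hHM x y).trans (hc.dist_le x hx y hy)
  exists_adj z hz := (hc.exists_adj z hz).imp fun _ hx => ⟨hx.1, hHM hx.2⟩

theorem dist_le_two_mul_of_adj (hω : ∀ e ∈ H.edgeSet, w e ≤ ω) {x y z : V} (hxz : H.Adj x z)
    (hyz : H.Adj y z) : dist w H x y ≤ 2 * ω := by
  have hle {x y : V} (h : H.Adj x y) : dist w H x y ≤ ω :=
    (dist_le_of_adj h).trans (by exact_mod_cast hω _ h)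
  calc dist w H x y ≤ dist w H x z + dist w H z y := dist_triangle _ _ _
    _ ≤ ω + ω := add_le_add (hle hxz) (hle hyz.symm)
    _ = 2 * ω := (two_mul _).symm

theorem Purchase.Valid.dist_le_add {c : Purchase V} (hc : c.Valid w G H) (hHG : H ≤ G)
    (hω : ∀ e ∈ H.edgeSet, w e ≤ ω) {x y z z' : V} (hz : z ∈ c.charge) (hz' : z' ∈ c.charge)
    (hxz : H.Adj x z) (hyz' : H.Adj y z') : dist w H x y ≤ dist w G x y + 8 * ω := by
  obtain ⟨p, hp, hpz⟩ := hc.exists_adj z hz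
  obtain ⟨q, hq, hqz'⟩ := hc.exists_adj z' hz'
  have hpx := dist_le_two_mul_of_adj hω hpz hxz
  have hqy := dist_le_two_mul_of_adj hω hqz' hyz'
  have hpq : dist w H p q ≤ 2 * ω + dist w G x y + 2 * ω :=
    calc dist w H p q ≤ dist w G p q := hc.dist_le p hp q hq
      _ ≤ dist w G p x + dist w G x q := dist_triangle _ _ _
      _ ≤ dist w G p x + (dist w G x y + dist w G y q) := by gcongr; exact dist_triangle _ _ _
      _ ≤ 2 * ω + (dist w G x y + 2 * ω) := by
        gcongr
        · exact (dist_anti hHG _ _).trans hpx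
        · rw [dist_comm]
          exact (dist_anti hHG _ _).trans hqy
      _ = 2 * ω + dist w G x y + 2 * ω := by ring
  calc dist w H x y ≤ dist w H x p + dist w H p y := dist_triangle _ _ _
    _ ≤ dist w H x p + (dist w H p q + dist w H q y) := by gcongr; exact dist_triangle _ _ _
    _ ≤ 2 * ω + (2 * ω + dist w G x y + 2 * ω + 2 * ω) := by
      rw [dist_comm x p]
      gcongr
    _ = dist w G x y + 8 * ω := by ring

theorem card_le_length_of_forall_subsingleton {α β : Type*} (s : Finset α) (L : List β)
    (r : α → β → Prop) (hs : ∀ x ∈ s, ∃ c ∈ L, r x c)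
    (hL : ∀ c ∈ L, {x | x ∈ s ∧ r x c}.Subsingleton) : s.card ≤ L.length := by
  classical
  refine (Finset.card_le_card_of_forall_subsingleton r (t := L.toFinset) ?_ ?_).trans
    L.toFinset_card_le
  · simpa only [List.mem_toFinset] using hs
  · simpa only [List.mem_toFinset] using hL

theorem subsingleton_of_forall_lt {s : Set ℕ} (h : ∀ i ∈ s, ∀ j ∈ s, ¬ i < j) : s.Subsingleton :=
  fun i hi j hj => le_antisymm (not_lt.1 (h j hj i hi)) (not_lt.1 (h i hi j hj))

variable [Fintype V] {L : List (Purchase V)}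

/-- The vertices of the paths that have been bought. -/
noncomputable def touched (L : List (Purchase V)) : Finset V :=
  open Classical in {x | ∃ c ∈ L, x ∈ c.path}

/-- The vertices that have been charged for a path. -/
noncomputable def charged (L : List (Purchase V)) : Finset V :=
  open Classical in {x | ∃ c ∈ L, x ∈ c.charge}

theorem mem_touched {x : V} : x ∈ touched L ↔ ∃ c ∈ L, x ∈ c.path := by
  simp [touched]

theorem mem_charged {x : V} : x ∈ charged L ↔ ∃ c ∈ L, x ∈ c.charge := by
  simp [charged]

theorem touched_cons [DecidableEq V] (c : Purchase V) (L : List (Purchase V)) :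
    touched (c :: L) = c.path ∪ touched L := by
  ext x
  simp [mem_touched]

theorem charged_cons [DecidableEq V] (c : Purchase V) (L : List (Purchase V)) :
    charged (c :: L) = c.charge ∪ charged L := by
  ext x
  simp [mem_charged]

/-- A missing edge is counted at its first vertex; an old path takes the blame for at most one of
them, since `H` is already optimal between any two of its vertices. -/
theorem Tight.segSum_missing_le [DecidableEq V] (ht : Tight w G M H a l) (hHM : H ≤ M)
    (hMG : M ≤ G) (hL : ∀ c ∈ L, c.Valid w G H) :
    segSum (missing H) a 0 l ≤ (((Finset.range (l + 1)).image a) \ touched L).card + L.length := by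
  classical
  set P := {i ∈ Finset.range l | s(a i, a (i + 1)) ∉ H.edgeSet} with hP
  have hPmem {i} (hi : i ∈ P) : i < l ∧ s(a i, a (i + 1)) ∉ H.edgeSet := by simpa [hP] using hi
  have hfar {i j} (hi : i ∈ P) (hj : j ∈ P) (hij : i < j) :
      ¬ dist w H (a i) (a j) ≤ dist w G (a i) (a j) := fun hd =>
    (hPmem hi).2 (ht.mem_edgeSet_of_dist_le hHM hMG hij (hPmem hj).1.le hd)
  have hcard : segSum (missing H) a 0 l = P.card := by
    rw [hP, Finset.card_filter, segSum, ← Finset.range_eq_Ico]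
    rfl
  rw [hcard, ← Finset.card_filter_add_card_filter_not (s := P) (fun i => a i ∉ touched L)]
  gcongr
  · refine Finset.card_le_card_of_forall_subsingleton (fun i x => a i = x) (fun i hi => ?_)
      fun _ _ => subsingleton_of_forall_lt fun i hi j hj hij => ?_
    · obtain ⟨hiP, hi⟩ := Finset.mem_filter.1 hi
      refine ⟨a i, Finset.mem_sdiff.2 ⟨Finset.mem_image_of_mem a ?_, hi⟩, rfl⟩
      exact Finset.mem_range.2 ((hPmem hiP).1.trans l.lt_succ_self)
    · refine hfar (Finset.mem_of_mem_filter i hi.1) (Finset.mem_of_mem_filter j hj.1) hij ?_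
      rw [show a i = a j from hi.2.trans hj.2.symm, dist_self]
      exact bot_le
  · refine card_le_length_of_forall_subsingleton _ L (fun i c => a i ∈ c.path) (fun i hi => ?_)
      fun c hc => subsingleton_of_forall_lt fun i hi j hj hij => ?_
    · simpa [mem_touched] using (Finset.mem_filter.1 hi).2
    · exact hfar (Finset.mem_of_mem_filter i hi.1) (Finset.mem_of_mem_filter j hj.1) hij
        ((hL c hc).dist_le _ hi.2 _ hj.2)

open Classical in
theorem exists_subset_biUnion_disjoint_charged {R : ℕ} (N : ℕ → Finset V)
    (hN : ∀ t < R, d ≤ (N t).card) (hdisj : ∀ t t', t < t' → t' < R → Disjoint (N t) (N t'))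
    (hL : ∀ c ∈ L, ∀ t t', t < t' → t' < R → Disjoint (N t) c.charge ∨ Disjoint (N t') c.charge) :
    ∃ T ⊆ (Finset.range R).biUnion N, (R - L.length) * d ≤ T.card ∧ Disjoint T (charged L) := by
  classical
  set B := {t ∈ Finset.range R | ¬ Disjoint (N t) (charged L)}
  have hBcard : B.card ≤ L.length := by
    refine card_le_length_of_forall_subsingleton B L (fun t c => ¬ Disjoint (N t) c.charge)
      (fun t ht => ?_) fun c hc => subsingleton_of_forall_lt fun t ht t' ht' htt => ?_
    · obtain ⟨z, hz, hzL⟩ := Finset.not_disjoint_iff.1 (Finset.mem_filter.1 ht).2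
      obtain ⟨c, hc, hzc⟩ := mem_charged.1 hzL
      exact ⟨c, hc, Finset.not_disjoint_iff.2 ⟨z, hz, hzc⟩⟩
    · have htR := Finset.mem_range.1 (Finset.mem_of_mem_filter t' ht'.1)
      exact (hL c hc t t' htt htR).elim ht.2 ht'.2
  refine ⟨(Finset.range R \ B).biUnion N, Finset.biUnion_subset_biUnion_of_subset_left _
    Finset.sdiff_subset, ?_, (Finset.disjoint_biUnion_left _ _ _).2 fun t ht => ?_⟩
  · rw [Finset.card_biUnion fun t ht t' ht' hne => ?_]
    · have hRB := Finset.le_card_sdiff B (Finset.range R)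
      rw [Finset.card_range] at hRB
      calc (R - L.length) * d ≤ (Finset.range R \ B).card * d := by gcongr; omega
        _ ≤ _ := Finset.card_nsmul_le_sum _ _ _ fun t ht =>
          hN t (Finset.mem_range.1 (Finset.sdiff_subset ht))
    · have htR := Finset.mem_range.1 (Finset.sdiff_subset ht)
      have htR' := Finset.mem_range.1 (Finset.sdiff_subset ht')
      exact hne.lt_or_gt.elim (hdisj t t' · htR') fun h => (hdisj t' t h htR).symm
  · by_contra hnd
    exact (Finset.mem_sdiff.1 ht).2 (Finset.mem_filter.2 ⟨Finset.sdiff_subset ht, hnd⟩)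

end Purchases

section Markers

variable {V : Type*} {w : Sym2 V → ℝ≥0} {G M H : SimpleGraph V} {a : ℕ → V} {l R t t' : ℕ}
  {c : ℝ≥0}

/-- The last index up to `l` at which the detour of `H` along the sequence `a` is at most `t * c`.
-/
noncomputable def marker (w : Sym2 V → ℝ≥0) (H : SimpleGraph V) (a : ℕ → V) (l : ℕ) (c : ℝ≥0)
    (t : ℕ) : ℕ :=
  open Classical in
  Nat.findGreatest (fun i => dist w H (a 0) (a i) ≤ segSum w a 0 i + t * c) l

theorem marker_le (t : ℕ) : marker w H a l c t ≤ l := Nat.findGreatest_le l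

theorem dist_marker_le (t : ℕ) : dist w H (a 0) (a (marker w H a l c t)) ≤
    segSum w a 0 (marker w H a l c t) + t * c := by
  classical
  exact Nat.findGreatest_spec (P := fun i => dist w H (a 0) (a i) ≤ segSum w a 0 i + t * c)
    l.zero_le (by simp [dist_self])

theorem marker_mono : Monotone (marker w H a l c) := fun t t' htt => by
  refine Nat.findGreatest_mono_left (fun i hi => hi.trans ?_) l
  gcongr

theorem marker_lt (hbad : segSum w a 0 l + R * c < dist w H (a 0) (a l)) (ht : t < R) :
    marker w H a l c t < l := by
  refine (marker_le t).lt_of_ne fun heq => hbad.not_ge ?_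
  have hle := dist_marker_le (w := w) (H := H) (a := a) (l := l) (c := c) t
  rw [heq] at hle
  exact hle.trans (by gcongr)

theorem lt_dist_marker_succ (h : marker w H a l c t < l) :
    segSum w a 0 (marker w H a l c t + 1) + t * c < dist w H (a 0) (a (marker w H a l c t + 1)) :=
  not_le.1 (Nat.findGreatest_is_greatest (Nat.lt_succ_self _) h)

theorem not_adj_marker (h : marker w H a l c t < l) :
    ¬ H.Adj (a (marker w H a l c t)) (a (marker w H a l c t + 1)) := fun hadj => by
  refine (lt_dist_marker_succ h).not_ge ?_
  set m := marker w H a l c t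
  calc dist w H (a 0) (a (m + 1)) ≤ dist w H (a 0) (a m) + dist w H (a m) (a (m + 1)) :=
        dist_triangle _ _ _
    _ ≤ (segSum w a 0 m + t * c) + w s(a m, a (m + 1)) :=
        add_le_add (dist_marker_le t) (dist_le_of_adj hadj)
    _ = segSum w a 0 (m + 1) + t * c := by
        rw [← segSum_add w a m.zero_le m.le_succ, segSum_succ, ENNReal.coe_add]
        ring

theorem lt_dist_marker_marker {b δ : ℝ≥0∞} (hδ : δ + b ≤ c) (htt : t < t')
    (hm : marker w H a l c t' < l)
    (hb : dist w H (a (marker w H a l c t')) (a (marker w H a l c t' + 1)) ≤ b) :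
    segSum w a (marker w H a l c t) (marker w H a l c t') + δ <
      dist w H (a (marker w H a l c t)) (a (marker w H a l c t')) := by
  by_contra! hle
  refine (lt_dist_marker_succ hm).not_ge ?_
  have hmono : marker w H a l c t ≤ marker w H a l c t' := marker_mono htt.le
  have hmarker : dist w H (a 0) (a (marker w H a l c t)) ≤ _ := dist_marker_le t
  set m := marker w H a l c t
  set m' := marker w H a l c t'
  calc dist w H (a 0) (a (m' + 1))
      ≤ dist w H (a 0) (a m') + dist w H (a m') (a (m' + 1)) := dist_triangle _ _ _
    _ ≤ (dist w H (a 0) (a m) + dist w H (a m) (a m')) + b :=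
        add_le_add (dist_triangle _ _ _) hb
    _ ≤ ((segSum w a 0 m + t * c) + (segSum w a m m' + δ)) + b := by gcongr
    _ = (segSum w a 0 m + segSum w a m m') + (t * c + (δ + b)) := by ring
    _ ≤ segSum w a 0 m' + (t * c + c) := by
        rw [← segSum_add w a m.zero_le hmono, ENNReal.coe_add]
        gcongr
    _ = segSum w a 0 m' + (t + 1 : ℕ) * c := by push_cast; ring
    _ ≤ segSum w a 0 (m' + 1) + t' * c := by
        rw [← segSum_add w a m'.zero_le m'.le_succ, ENNReal.coe_add]
        gcongr
        · exact le_self_add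
        · exact htt

end Markers

section Charging

variable {V : Type*} {w : Sym2 V → ℝ≥0} {G M H : SimpleGraph V} {a : ℕ → V} {l d κ R : ℕ}
  {ω : ℝ≥0} {L : List (Purchase V)}

theorem Tight.dist_marker_add_lt (ht : Tight w G M H a l) (hMG : M ≤ G)
    (hω : ∀ e ∈ M.edgeSet, w e ≤ ω)
    (hstretch : ∀ x y, M.Adj x y → dist w H x y ≤ κ * w s(x, y)) {t t' : ℕ} (htt : t < t')
    (hm : marker w H a l ((8 + κ) * ω) t' < l) :
    dist w G (a (marker w H a l ((8 + κ) * ω) t)) (a (marker w H a l ((8 + κ) * ω) t')) + 8 * ω <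
      dist w H (a (marker w H a l ((8 + κ) * ω) t)) (a (marker w H a l ((8 + κ) * ω) t')) := by
  refine (add_le_add_left (ht.dist_le_segSum hMG (marker_mono htt.le) hm.le) _).trans_lt ?_
  refine lt_dist_marker_marker (b := κ * ω) ?_ htt hm ?_
  · push_cast
    rw [add_mul]
  · refine (hstretch _ _ (ht.adj _ hm)).trans ?_
    gcongr
    exact hω _ (ht.adj _ hm)

/-- The first vertices of `R` missing edges along the walk, at which the detour of `H` exceeds
successive multiples of `(8 + κ) * ω`, are so far apart in `H` that their neighbourhoods are
disjoint and that an old purchase has charged neighbours of at most one of them. -/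
theorem Tight.exists_charge [Fintype V] (ht : Tight w G M H a l) (hHM : H ≤ M) (hMG : M ≤ G)
    (hω : ∀ e ∈ M.edgeSet, w e ≤ ω)
    (hstretch : ∀ x y, M.Adj x y → dist w H x y ≤ κ * w s(x, y))
    (hlight : ∀ x y, M.Adj x y → ¬ H.Adj x y → d ≤ (H.neighborSet x).ncard)
    (hL : ∀ c ∈ L, c.Valid w G H)
    (hbad : segSum w a 0 l + (R * (8 + κ) : ℕ) * ω < dist w H (a 0) (a l)) :
    ∃ T : Finset V, (R - L.length) * d ≤ T.card ∧ Disjoint T (charged L) ∧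
      ∀ z ∈ T, ∃ i ≤ l, H.Adj (a i) z := by
  classical
  have hωH e (he : e ∈ H.edgeSet) : w e ≤ ω := hω e (SimpleGraph.edgeSet_mono hHM he)
  set m := marker w H a l ((8 + κ) * ω)
  have hm {t} (htR : t < R) : m t < l :=
    marker_lt (R := R) (by simpa [mul_assoc] using hbad) htR
  have hfar {t t'} (htt : t < t') (htR : t' < R) :
      dist w G (a (m t)) (a (m t')) + 8 * ω < dist w H (a (m t)) (a (m t')) :=
    ht.dist_marker_add_lt hMG hω hstretch htt (hm htR)
  set N : ℕ → Finset V := fun t => (H.neighborSet (a (m t))).toFinset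
  have mem_N {t z} : z ∈ N t ↔ H.Adj (a (m t)) z := by simp [N]
  have hcard t (htR : t < R) : d ≤ (N t).card := by
    rw [← Set.ncard_eq_toFinset_card']
    exact hlight _ _ (ht.adj _ (hm htR)) (not_adj_marker (hm htR))
  have hdisj t t' (htt : t < t') (htR : t' < R) : Disjoint (N t) (N t') := by
    refine Finset.disjoint_left.2 fun z hz hz' => (hfar htt htR).not_ge ?_
    refine (dist_le_two_mul_of_adj hωH (mem_N.1 hz) (mem_N.1 hz')).trans (le_add_left ?_)
    gcongr
    norm_num
  have hcharge c (hc : c ∈ L) t t' (htt : t < t') (htR : t' < R) :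
      Disjoint (N t) c.charge ∨ Disjoint (N t') c.charge := by
    by_contra! hcon
    obtain ⟨z, hz, hzc⟩ := Finset.not_disjoint_iff.1 hcon.1
    obtain ⟨z', hz', hzc'⟩ := Finset.not_disjoint_iff.1 hcon.2
    exact (hfar htt htR).not_ge
      ((hL c hc).dist_le_add (hHM.trans hMG) hωH hzc hzc' (mem_N.1 hz) (mem_N.1 hz'))
  obtain ⟨T, hTN, hTcard, hTdisj⟩ := exists_subset_biUnion_disjoint_charged N hcard hdisj hcharge
  refine ⟨T, hTcard, hTdisj, fun z hz => ?_⟩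
  obtain ⟨t, -, hzt⟩ := Finset.mem_biUnion.1 (hTN hz)
  exact ⟨m t, marker_le t, mem_N.1 hzt⟩

end Charging

/-! ### The invariant of the greedy construction -/

section SupEdge

variable {V : Type*} {H K : SimpleGraph V} {a b x y : V}

theorem mem_edgeSet_sup_edge (hab : a ≠ b) {e : Sym2 V} :
    e ∈ (H ⊔ SimpleGraph.edge a b).edgeSet ↔ e ∈ H.edgeSet ∨ e = s(a, b) := by
  simp [SimpleGraph.edgeSet_edge_of_ne hab, or_comm]

theorem adj_sup_edge (hab : a ≠ b) :
    (H ⊔ SimpleGraph.edge a b).Adj x y ↔ H.Adj x y ∨ s(x, y) = s(a, b) := by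
  rw [← SimpleGraph.mem_edgeSet, mem_edgeSet_sup_edge hab, SimpleGraph.mem_edgeSet]

theorem ncard_edgeSet_sup_edge_le (hab : a ≠ b) :
    (H ⊔ SimpleGraph.edge a b).edgeSet.ncard ≤ H.edgeSet.ncard + 1 := by
  rw [SimpleGraph.edgeSet_sup, SimpleGraph.edgeSet_edge_of_ne hab]
  exact (Set.ncard_union_le _ _).trans (by simp)

theorem ncard_edgeSet_sup_edge [Finite V] (hab : a ≠ b) (h : ¬ H.Adj a b) :
    (H ⊔ SimpleGraph.edge a b).edgeSet.ncard = H.edgeSet.ncard + 1 := by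
  rw [SimpleGraph.edgeSet_sup, SimpleGraph.edgeSet_edge_of_ne hab, Set.union_singleton,
    Set.ncard_insert_of_notMem (by simpa using h) (Set.toFinite _)]

theorem ncard_neighborSet_mono [Finite V] (h : H ≤ K) (v : V) :
    (H.neighborSet v).ncard ≤ (K.neighborSet v).ncard :=
  Set.ncard_le_ncard (fun _ hx => h hx) (Set.toFinite _)

theorem ncard_neighborSet_lt [Finite V] (h : H ≤ K) (hK : K.Adj x y) (hH : ¬ H.Adj x y) :
    (H.neighborSet x).ncard < (K.neighborSet x).ncard :=
  Set.ncard_lt_ncard ⟨fun _ hz => h hz, fun hsub => hH (hsub hK)⟩ (Set.toFinite _)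

end SupEdge

section Invariant

variable {V : Type*} {w : Sym2 V → ℝ≥0} {G M H H' F : SimpleGraph V} {d κ R k : ℕ} {a b u v : V}
  {L : List (Purchase V)}

theorem Tight.valid_purchase [DecidableEq V] {l : ℕ} {a : ℕ → V} (ht : Tight w G M H a l)
    (hle : H ≤ H') (hadj : ∀ i < l, H'.Adj (a i) (a (i + 1))) {T : Finset V}
    (hT : ∀ z ∈ T, ∃ i ≤ l, H.Adj (a i) z) :
    Purchase.Valid w G H' ⟨(Finset.range (l + 1)).image a, T⟩ where
  dist_le := by
    have hdist i j (hij : i ≤ j) (hj : j ≤ l) : dist w H' (a i) (a j) ≤ dist w G (a i) (a j) :=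
      (WeightedGraph.dist_le_segSum hij fun k _ hk => hadj k (by omega)).trans
        (ht.short i j hij hj)
    simp only [Finset.forall_mem_image, Finset.mem_range, Nat.lt_succ_iff]
    intro i hi j hj
    rcases le_total i j with hij | hij
    · exact hdist i j hij hj
    · rw [dist_comm, dist_comm (H := G)]
      exact hdist j i hij hi
  exists_adj z hz := by
    obtain ⟨i, hi, hiz⟩ := hT z hz
    exact ⟨a i, Finset.mem_image_of_mem a (Finset.mem_range_succ_iff.2 hi), hle hiz⟩

variable [Fintype V]

theorem sum_min_ncard_mono (h : H ≤ H') (d : ℕ) :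
    ∑ v, min (H.neighborSet v).ncard d ≤ ∑ v, min (H'.neighborSet v).ncard d :=
  Finset.sum_le_sum fun v _ => min_le_min_right _ (ncard_neighborSet_mono h v)

theorem sum_min_ncard_lt_sup_edge (hab : a ≠ b) (hH : ¬ H.Adj a b)
    (hdeg : (H.neighborSet a).ncard < d ∨ (H.neighborSet b).ncard < d) :
    ∑ v, min (H.neighborSet v).ncard d <
      ∑ v, min ((H ⊔ SimpleGraph.edge a b).neighborSet v).ncard d := by
  have hle : H ≤ H ⊔ SimpleGraph.edge a b := le_sup_left
  have hadj : (H ⊔ SimpleGraph.edge a b).Adj a b := (adj_sup_edge hab).2 (.inr rfl)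
  have lt_of_lt {x y : V} (hxy : (H ⊔ SimpleGraph.edge a b).Adj x y) (hH : ¬ H.Adj x y)
      (hx : (H.neighborSet x).ncard < d) : ∑ v, min (H.neighborSet v).ncard d <
        ∑ v, min ((H ⊔ SimpleGraph.edge a b).neighborSet v).ncard d := by
    refine Finset.sum_lt_sum (fun v _ => min_le_min_right _ (ncard_neighborSet_mono hle v))
      ⟨x, Finset.mem_univ x, ?_⟩
    have := ncard_neighborSet_lt hle hxy hH
    omega
  exact hdeg.elim (lt_of_lt hadj hH) (lt_of_lt hadj.symm fun h => hH h.symm)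

/-- The account of the edges of `H`: those added while an end point had degree less than `d`, those
of a subgraph `F` of large girth, and those of the paths bought so far, which are listed in `L`.
Half of the charges of each purchase, `R * d` many, are on vertices that were not charged before. -/
structure Ledger (w : Sym2 V → ℝ≥0) (G : SimpleGraph V) (d κ R : ℕ) (H F : SimpleGraph V)
    (L : List (Purchase V)) : Prop where
  le : F ≤ H
  lt_egirth : κ + 1 < F.egirth
  ncard_le : H.edgeSet.ncard ≤ ∑ v, min (H.neighborSet v).ncard d + F.edgeSet.ncard +
    (touched L).card + L.length ^ 2
  valid : ∀ c ∈ L, c.Valid w G H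
  charge_le : L.length * (R * d) ≤ 2 * (charged L).card

theorem Ledger.nil : Ledger w G d κ R ⊥ ⊥ [] where
  le := le_rfl
  lt_egirth := by
    rw [SimpleGraph.isAcyclic_bot.egirth_eq_top]
    exact ENat.natCast_lt_top (κ + 1)
  ncard_le := by simp
  valid := by simp
  charge_le := by simp

theorem Ledger.sup_edge_of_ncard_lt (hl : Ledger w G d κ R H F L) (hab : a ≠ b) (hH : ¬ H.Adj a b)
    (hdeg : (H.neighborSet a).ncard < d ∨ (H.neighborSet b).ncard < d) :
    Ledger w G d κ R (H ⊔ SimpleGraph.edge a b) F L where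
  le := hl.le.trans le_sup_left
  lt_egirth := hl.lt_egirth
  ncard_le := by
    have hedge := ncard_edgeSet_sup_edge_le (H := H) hab
    have hsum := sum_min_ncard_lt_sup_edge hab hH hdeg
    have := hl.ncard_le
    omega
  valid c hc := (hl.valid c hc).mono le_sup_left
  charge_le := hl.charge_le

theorem Ledger.sup_edge_of_lt_edist (hl : Ledger w G d κ R H F L) (hab : a ≠ b) (hH : ¬ H.Adj a b)
    (hF : κ < F.edist a b) :
    Ledger w G d κ R (H ⊔ SimpleGraph.edge a b) (F ⊔ SimpleGraph.edge a b) L where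
  le := sup_le_sup_right hl.le _
  lt_egirth := by
    refine lt_of_lt_of_le (lt_min hl.lt_egirth ?_) (min_egirth_le_egirth_sup_edge F a b)
    exact (ENat.add_lt_add_iff_right ENat.one_ne_top).2 hF
  ncard_le := by
    have hedge := ncard_edgeSet_sup_edge_le (H := H) hab
    have hedgeF := ncard_edgeSet_sup_edge hab fun h => hH (hl.le h)
    have hsum := sum_min_ncard_mono (H := H) (H' := H ⊔ SimpleGraph.edge a b) le_sup_left d
    have := hl.ncard_le
    omega
  valid c hc := (hl.valid c hc).mono le_sup_left
  charge_le := hl.charge_le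

theorem Ledger.cons [DecidableEq V] (hl : Ledger w G d κ R H F L) (hle : H ≤ H') {c : Purchase V}
    (hc : c.Valid w G H')
    (hcard : H'.edgeSet.ncard ≤ H.edgeSet.ncard + ((c.path \ touched L).card + L.length))
    (hdisj : Disjoint c.charge (charged L)) (hcharge : R * d ≤ 2 * c.charge.card) :
    Ledger w G d κ R H' F (c :: L) where
  le := hl.le.trans hle
  lt_egirth := hl.lt_egirth
  ncard_le := by
    have hsum := sum_min_ncard_mono hle d
    have htouched : (touched (c :: L)).card = (c.path \ touched L).card + (touched L).card := by
      rw [touched_cons, ← Finset.sdiff_union_self_eq_union,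
        Finset.card_union_of_disjoint Finset.sdiff_disjoint]
    have hsq : L.length ^ 2 + L.length ≤ (L.length + 1) ^ 2 := by nlinarith
    have := hl.ncard_le
    rw [htouched, List.length_cons]
    omega
  valid c' hc' := by
    rcases List.mem_cons.1 hc' with rfl | hc'
    · exact hc
    · exact (hl.valid c' hc').mono hle
  charge_le := by
    have := hl.charge_le
    rw [charged_cons, Finset.card_union_of_disjoint hdisj, List.length_cons, add_mul, one_mul]
    omega

theorem Ledger.two_mul_length_lt (hl : Ledger w G d κ R H F L)
    (hR : 4 * Fintype.card V < R * R * d) : 2 * L.length < R := by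
  have hcharge := hl.charge_le
  have hcard : (charged L).card ≤ Fintype.card V := Finset.card_le_univ _
  by_contra! hlen
  have : R * (R * d) ≤ 2 * L.length * (R * d) := Nat.mul_le_mul_right _ hlen
  nlinarith

/-- The edges in `M` are those processed so far, in the order of their weights, and `H` is the part
of the spanner that has been built. -/
structure SpannerInv (w : Sym2 V → ℝ≥0) (G : SimpleGraph V) (d κ R : ℕ) (M H : SimpleGraph V) :
    Prop where
  le : H ≤ M
  le_graph : M ≤ G
  sorted : ∀ e ∈ M.edgeSet, ∀ e' ∈ G.edgeSet, e' ∉ M.edgeSet → w e ≤ w e'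
  stretch : ∀ a b, M.Adj a b → dist w H a b ≤ κ * w s(a, b)
  le_ncard : ∀ a b, M.Adj a b → ¬ H.Adj a b → d ≤ (H.neighborSet a).ncard
  ledger : ∃ F L, Ledger w G d κ R H F L

theorem SpannerInv.bot : SpannerInv w G d κ R ⊥ ⊥ where
  le := le_rfl
  le_graph := bot_le
  sorted := by simp
  stretch := by simp
  le_ncard := by simp
  ledger := ⟨⊥, [], .nil⟩

/-- `s(a, b)` is a lightest edge of `G` among those that are not in `M`. -/
structure IsLightestNew (w : Sym2 V → ℝ≥0) (G M : SimpleGraph V) (a b : V) : Prop where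
  adj : G.Adj a b
  not_adj : ¬ M.Adj a b
  le : ∀ e ∈ G.edgeSet, e ∉ M.edgeSet → w s(a, b) ≤ w e

theorem SpannerInv.le_weight (hI : SpannerInv w G d κ R M H) (hab : IsLightestNew w G M a b) :
    ∀ e ∈ (M ⊔ SimpleGraph.edge a b).edgeSet, w e ≤ w s(a, b) := fun e he => by
  rcases (mem_edgeSet_sup_edge hab.adj.ne).1 he with he | rfl
  · exact hI.sorted e he _ hab.adj hab.not_adj
  · exact le_rfl

theorem SpannerInv.sup_edge (hI : SpannerInv w G d κ R M H) (hab : IsLightestNew w G M a b)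
    (hle : H ≤ H') (hle' : H' ≤ M ⊔ SimpleGraph.edge a b)
    (hstretch : dist w H' a b ≤ κ * w s(a, b))
    (hdeg : ¬ H'.Adj a b → d ≤ (H.neighborSet a).ncard ∧ d ≤ (H.neighborSet b).ncard)
    (hl : ∃ F L, Ledger w G d κ R H' F L) :
    SpannerInv w G d κ R (M ⊔ SimpleGraph.edge a b) H' where
  le := hle'
  le_graph := sup_le hI.le_graph ((SimpleGraph.edge_le_iff _).2 (.inr hab.adj))
  sorted e he e' he' hn := by
    rw [mem_edgeSet_sup_edge hab.adj.ne, not_or] at hn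
    exact (hI.le_weight hab e he).trans (hab.le e' he' hn.1)
  stretch x y hxy := by
    rcases (adj_sup_edge hab.adj.ne).1 hxy with h | h
    · exact (dist_anti hle _ _).trans (hI.stretch x y h)
    · rw [h]
      rcases Sym2.eq_iff.1 h with ⟨rfl, rfl⟩ | ⟨rfl, rfl⟩
      · exact hstretch
      · rwa [dist_comm]
  le_ncard x y hxy hn := by
    refine le_trans ?_ (ncard_neighborSet_mono hle x)
    rcases (adj_sup_edge hab.adj.ne).1 hxy with h | h
    · exact hI.le_ncard x y h fun h' => hn (hle h')
    · rcases Sym2.eq_iff.1 h with ⟨rfl, rfl⟩ | ⟨rfl, rfl⟩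
      · exact (hdeg hn).1
      · exact (hdeg fun h' => hn h'.symm).2
  ledger := hl

theorem SpannerInv.mark (hI : SpannerInv w G d κ R M H) (hab : IsLightestNew w G M a b)
    (ha : d ≤ (H.neighborSet a).ncard) (hb : d ≤ (H.neighborSet b).ncard)
    (hd : dist w H a b ≤ κ * w s(a, b)) :
    SpannerInv w G d κ R (M ⊔ SimpleGraph.edge a b) H :=
  hI.sup_edge hab le_rfl (hI.le.trans le_sup_left) hd (fun _ => ⟨ha, hb⟩) hI.ledger

theorem SpannerInv.add_of_ledger (hI : SpannerInv w G d κ R M H) (hab : IsLightestNew w G M a b)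
    (hκ : 1 ≤ κ) (hl : ∃ F L, Ledger w G d κ R (H ⊔ SimpleGraph.edge a b) F L) :
    SpannerInv w G d κ R (M ⊔ SimpleGraph.edge a b) (H ⊔ SimpleGraph.edge a b) := by
  have hadj : (H ⊔ SimpleGraph.edge a b).Adj a b := (adj_sup_edge hab.adj.ne).2 (.inr rfl)
  refine hI.sup_edge hab le_sup_left (sup_le_sup_right hI.le _) ?_ (absurd hadj) hl
  exact (dist_le_of_adj hadj).trans (le_mul_of_one_le_left bot_le (by exact_mod_cast hκ))

theorem SpannerInv.add_of_ncard_lt (hI : SpannerInv w G d κ R M H) (hab : IsLightestNew w G M a b)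
    (hκ : 1 ≤ κ) (hdeg : (H.neighborSet a).ncard < d ∨ (H.neighborSet b).ncard < d) :
    SpannerInv w G d κ R (M ⊔ SimpleGraph.edge a b) (H ⊔ SimpleGraph.edge a b) := by
  obtain ⟨F, L, hl⟩ := hI.ledger
  exact hI.add_of_ledger hab hκ
    ⟨F, L, hl.sup_edge_of_ncard_lt hab.adj.ne (fun h => hab.not_adj (hI.le h)) hdeg⟩

/-- All edges of `F` are at most as heavy as the new one, so a walk in `F` with at most `κ` edges
would contradict `hd`. -/
theorem SpannerInv.add_of_lt_dist (hI : SpannerInv w G d κ R M H) (hab : IsLightestNew w G M a b)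
    (hκ : 1 ≤ κ) (hd : κ * w s(a, b) < dist w H a b) :
    SpannerInv w G d κ R (M ⊔ SimpleGraph.edge a b) (H ⊔ SimpleGraph.edge a b) := by
  obtain ⟨F, L, hl⟩ := hI.ledger
  refine hI.add_of_ledger hab hκ ⟨F ⊔ SimpleGraph.edge a b, L,
    hl.sup_edge_of_lt_edist hab.adj.ne (fun h => hab.not_adj (hI.le h)) ?_⟩
  by_contra! hF
  obtain ⟨q, hq⟩ := SimpleGraph.exists_walk_of_edist_ne_top
    (ne_top_of_le_ne_top (ENat.natCast_ne_top κ) hF)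
  have hqκ : q.length ≤ κ := by exact_mod_cast hq.trans_le hF
  have hFM : F ≤ M ⊔ SimpleGraph.edge a b := (hl.le.trans hI.le).trans le_sup_left
  refine hd.not_ge ?_
  calc dist w H a b ≤ length w (q.mapLe hl.le) := dist_le_length _
    _ ≤ (q.length * w s(a, b) : ℝ≥0) := by
      rw [length_mapLe]
      exact_mod_cast length_le_mul
        (fun e he => hI.le_weight hab e (SimpleGraph.edgeSet_mono hFM he)) q
    _ ≤ κ * w s(a, b) := by
      push_cast
      gcongr

theorem SpannerInv.buy (hI : SpannerInv w G d κ R M H) (hR : 4 * Fintype.card V < R * R * d)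
    (r : M.Walk u v) (hlen : length w r ≤ dist w G u v)
    (hmiss : ∀ q : M.Walk u v, length w q ≤ length w r → missCount H r ≤ missCount H q)
    {ω : ℝ≥0} (hω : ∀ e ∈ M.edgeSet, w e ≤ ω)
    (hbad : length w r + (R * (8 + κ) : ℕ) * ω < dist w H u v)
    (hH' : ∀ x y, H'.Adj x y ↔ H.Adj x y ∨ s(x, y) ∈ r.edges) :
    SpannerInv w G d κ R M H' := by
  classical
  obtain ⟨F, L, hl⟩ := hI.ledger
  have hle : H ≤ H' := fun x y h => (hH' x y).2 (.inl h)
  have hHM : H' ≤ M := fun x y h => ((hH' x y).1 h).elim (hI.le ·) (r.edges_subset_edgeSet ·)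
  have ht := Tight.of_walk (H := H) hI.le_graph r hlen hmiss
  obtain ⟨T, hT, hTdisj, hTadj⟩ := ht.exists_charge hI.le hI.le_graph hω hI.stretch hI.le_ncard
    hl.valid (R := R) (by simpa [← length_eq_segSum] using hbad)
  refine ⟨hHM, hI.le_graph, hI.sorted, fun a b h => (dist_anti hle _ _).trans (hI.stretch a b h),
    fun a b h hn => (hI.le_ncard a b h fun h' => hn (hle h')).trans (ncard_neighborSet_mono hle a),
    F, ⟨(Finset.range (r.length + 1)).image r.getVert, T⟩ :: L, hl.cons hle ?_ ?_ hTdisj ?_⟩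
  · refine ht.valid_purchase hle (fun i hi => (hH' _ _).2 (.inr ?_)) hTadj
    exact (r.mk_mem_edges_iff_exists).2 ⟨i, hi, rfl⟩
  · have hsub : H'.edgeSet ⊆ H.edgeSet ∪ {e | e ∈ r.edges} := fun e he => by
      induction e with
      | _ x y => exact (hH' x y).1 he
    refine (ncard_edgeSet_le_add_missCount r hsub).trans (Nat.add_le_add_left ?_ _)
    rw [missCount, sum_map_edges]
    exact ht.segSum_missing_le hI.le hI.le_graph hl.valid
  · have hlen := hl.two_mul_length_lt hR
    calc R * d ≤ 2 * (R - L.length) * d := Nat.mul_le_mul_right d (by omega)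
      _ = 2 * ((R - L.length) * d) := mul_assoc _ _ _
      _ ≤ 2 * T.card := Nat.mul_le_mul_left 2 hT

theorem SpannerInv.ncard_edgeSet_le (hI : SpannerInv w G d κ R M H)
    (hR : 4 * Fintype.card V < R * R * d) (hk : Fintype.card V < 2 ^ k) (hκ : 2 * k + 1 ≤ κ) :
    H.edgeSet.ncard ≤ Fintype.card V * (d + 3) + R ^ 2 := by
  obtain ⟨F, L, hl⟩ := hI.ledger
  have hgirth : F.edgeSet.ncard ≤ 2 * Fintype.card V := by
    rw [← Nat.card_eq_fintype_card] at hk ⊢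
    refine ncard_edgeSet_le_of_lt_egirth hk (lt_of_le_of_lt ?_ hl.lt_egirth)
    exact_mod_cast Nat.succ_le_succ hκ
  have htouched : (touched L).card ≤ Fintype.card V := Finset.card_le_univ _
  have hdeg : ∑ v, min (H.neighborSet v).ncard d ≤ Fintype.card V * d :=
    (Finset.sum_le_sum fun v _ => min_le_right _ d).trans (by simp)
  have hlen : L.length ^ 2 ≤ R ^ 2 :=
    Nat.pow_le_pow_left (by have := hl.two_mul_length_lt hR; omega) 2
  have := hl.ncard_le
  nlinarith

end Invariant

end WeightedGraph

namespace RealRAM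

/-! ### Structured programs -/

/-- A structured program. Its loops run a counter from `0` to the content of register `0`, which is
the number of vertices, so that it always halts. -/
inductive Cmd where
  | skip
  | nset (x : ℕ) (e : NExp)
  | rset (x : ℕ) (e : RExp)
  | nput (a : ℕ) (i j : NExp) (e : NExp)
  | rput (a : ℕ) (i j : NExp) (e : RExp)
  | seq (c d : Cmd)
  | ite (b : Test) (c d : Cmd)
  | forN (i : ℕ) (c : Cmd)

/-- A register or an array: the unit in which the effect of a program on the memory is bounded. -/
inductive Loc where
  | nreg (x : ℕ)
  | rreg (x : ℕ)
  | narr (a : ℕ)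
  | rarr (a : ℕ)
  deriving DecidableEq

/-- The states `s` and `t` have the same content at a location. -/
def State.AgreeAt (s t : State) : Loc → Prop
  | .nreg x => s.nreg x = t.nreg x
  | .rreg x => s.rreg x = t.rreg x
  | .narr a => s.narr a = t.narr a
  | .rarr a => s.rarr a = t.rarr a

theorem State.AgreeAt.refl (s : State) (l : Loc) : s.AgreeAt s l := by
  cases l <;> rfl

theorem State.AgreeAt.trans {s t r : State} {l : Loc} (h : s.AgreeAt t l) (h' : t.AgreeAt r l) :
    s.AgreeAt r l := by
  cases l <;> exact Eq.trans h h'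

/-- Overwriting a natural number register. -/
def State.setN (s : State) (x k : ℕ) : State := { s with nreg := Function.update s.nreg x k }

theorem State.agreeAt_setN (s : State) {x : ℕ} (k : ℕ) {l : Loc} (hl : l ≠ .nreg x) :
    (s.setN x k).AgreeAt s l := by
  cases l with
  | nreg y => exact Function.update_of_ne (by simpa using hl) _ _
  | _ => rfl

/-- The state after `k` rounds of a loop with counter `i` and body `f`. -/
def State.iter (f : State → State) (i : ℕ) (s : State) : ℕ → State
  | 0 => s.setN i 0
  | k + 1 => (f (State.iter f i s k)).setN i (k + 1)

theorem State.iter_counter (f : State → State) (i : ℕ) (s : State) (k : ℕ) :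
    (s.iter f i k).nreg i = k := by
  cases k <;> exact Function.update_self _ _ _

theorem State.agreeAt_iter {f : State → State} {l : Loc} (hf : ∀ t, (f t).AgreeAt t l) {i : ℕ}
    (hl : l ≠ .nreg i) (s : State) (k : ℕ) : (s.iter f i k).AgreeAt s l := by
  induction k with
  | zero => exact s.agreeAt_setN _ hl
  | succ k ih => exact (State.agreeAt_setN _ _ hl).trans ((hf _).trans ih)

theorem setCell_of_ne {R : Type} (m : ℕ → ℕ → ℕ → R) {a i j a' : ℕ} (r : R) (h : a' ≠ a) :
    setCell m a i j r a' = m a' := by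
  funext i' j'
  simp [setCell, h]

namespace Cmd

/-- The program text of a structured program. -/
def compile : Cmd → Program
  | skip => .skip
  | nset x e => .nset x e
  | rset x e => .rset x e
  | nput a i j e => .nput a i j e
  | rput a i j e => .rput a i j e
  | seq c d => .seq c.compile d.compile
  | ite b c d => .ite b c.compile d.compile
  | forN i c => .seq (.nset i (.lit 0)) (.loop (.not (.nle (.reg 0) (.reg i)))
      (.seq c.compile (.nset i (.add (.reg i) (.lit 1)))))

open Classical in
/-- The effect of a structured program on the memory. -/
noncomputable def run : Cmd → State → State
  | skip, s => s
  | nset x e, s => s.setN x (e.eval s)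
  | rset x e, s => { s with rreg := Function.update s.rreg x (e.eval s) }
  | nput a i j e, s => { s with narr := setCell s.narr a (i.eval s) (j.eval s) (e.eval s) }
  | rput a i j e, s => { s with rarr := setCell s.rarr a (i.eval s) (j.eval s) (e.eval s) }
  | seq c d, s => d.run (c.run s)
  | ite b c d, s => if b.Holds s then c.run s else d.run s
  | forN i c, s => s.iter c.run i (s.nreg 0)

/-- The locations that a program may change. -/
def writes : Cmd → List Loc
  | skip => []
  | nset x _ => [.nreg x]
  | rset x _ => [.rreg x]
  | nput a _ _ _ => [.narr a]
  | rput a _ _ _ => [.rarr a]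
  | seq c d => c.writes ++ d.writes
  | ite _ c d => c.writes ++ d.writes
  | forN i c => .nreg i :: c.writes

/-- No loop body changes its own counter. -/
def WellFormed : Cmd → Prop
  | seq c d => c.WellFormed ∧ d.WellFormed
  | ite _ c d => c.WellFormed ∧ d.WellFormed
  | forN i c => .nreg i ∉ c.writes ∧ c.WellFormed
  | _ => True

instance decidableWellFormed : (c : Cmd) → Decidable c.WellFormed
  | seq c d =>
    have := decidableWellFormed c
    have := decidableWellFormed d
    inferInstanceAs (Decidable (_ ∧ _))
  | ite _ c d =>
    have := decidableWellFormed c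
    have := decidableWellFormed d
    inferInstanceAs (Decidable (_ ∧ _))
  | forN _ c =>
    have := decidableWellFormed c
    inferInstanceAs (Decidable (_ ∧ _))
  | skip | nset _ _ | rset _ _ | nput _ _ _ _ | rput _ _ _ _ => isTrue trivial

/-- A bound for the running time, as a polynomial in the content of register `0`. -/
noncomputable def costPoly : Cmd → Polynomial ℕ
  | skip => 1
  | nset _ e => Polynomial.C (e.cost + 1)
  | rset _ e => Polynomial.C (e.cost + 1)
  | nput _ i j e => Polynomial.C (i.cost + j.cost + e.cost + 1)
  | rput _ i j e => Polynomial.C (i.cost + j.cost + e.cost + 1)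
  | seq c d => c.costPoly + d.costPoly
  | ite b c d => Polynomial.C (b.cost + 1) + c.costPoly + d.costPoly
  | forN _ c => Polynomial.X * (c.costPoly + 9) + 7

/-- Several programs one after the other. -/
def block : List Cmd → Cmd
  | [] => skip
  | [c] => c
  | c :: cs => seq c (block cs)

variable {c d : Cmd} {b : Test} {s : State} {i n : ℕ}

theorem run_seq : (seq c d).run s = d.run (c.run s) := rfl

theorem run_ite_of_holds (hb : b.Holds s) : (ite b c d).run s = c.run s := if_pos hb

theorem run_ite_of_not_holds (hb : ¬ b.Holds s) : (ite b c d).run s = d.run s := if_neg hb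

theorem run_agreeAt (c : Cmd) {l : Loc} (hl : l ∉ c.writes) (s : State) :
    (c.run s).AgreeAt s l := by
  induction c generalizing s with
  | skip => exact .refl s l
  | nset x e => exact s.agreeAt_setN _ (by simpa only [writes, List.mem_singleton] using hl)
  | rset x e =>
    cases l with
    | rreg y => exact Function.update_of_ne (by simpa [writes] using hl) _ _
    | _ => rfl
  | nput a i j e =>
    cases l with
    | narr a' => exact setCell_of_ne _ _ (by simpa [writes] using hl)
    | _ => rfl
  | rput a i j e =>
    cases l with
    | rarr a' => exact setCell_of_ne _ _ (by simpa [writes] using hl)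
    | _ => rfl
  | seq c d ihc ihd =>
    rw [writes, List.mem_append, not_or] at hl
    exact (ihd hl.2 _).trans (ihc hl.1 s)
  | ite b c d ihc ihd =>
    rw [writes, List.mem_append, not_or] at hl
    rw [run]
    split
    · exact ihc hl.1 s
    · exact ihd hl.2 s
  | forN i c ih =>
    rw [writes, List.mem_cons, not_or] at hl
    exact State.agreeAt_iter (ih hl.2) hl.1 s _

theorem run_nreg {x : ℕ} (h : .nreg x ∉ c.writes) (s : State) : (c.run s).nreg x = s.nreg x :=
  c.run_agreeAt h s

theorem run_rreg {x : ℕ} (h : .rreg x ∉ c.writes) (s : State) : (c.run s).rreg x = s.rreg x :=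
  c.run_agreeAt h s

theorem run_narr {a : ℕ} (h : .narr a ∉ c.writes) (s : State) : (c.run s).narr a = s.narr a :=
  c.run_agreeAt h s

theorem run_rarr {a : ℕ} (h : .rarr a ∉ c.writes) (s : State) : (c.run s).rarr a = s.rarr a :=
  c.run_agreeAt h s

theorem iter_nreg_zero (hi : i ≠ 0) (h0 : .nreg 0 ∉ c.writes) (s : State) (k : ℕ) :
    (s.iter c.run i k).nreg 0 = s.nreg 0 :=
  State.agreeAt_iter (l := .nreg 0) (c.run_agreeAt h0) (by simpa using hi.symm) s k

theorem exec_loop {K : ℕ} (hi : .nreg i ∉ c.writes) (h0 : .nreg 0 ∉ c.writes) (hi0 : i ≠ 0)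
    (hs : s.nreg 0 = n) (hc : ∀ t : State, t.nreg 0 = n → ∃ k ≤ K, Exec c.compile t k (c.run t))
    (m j : ℕ) (hm : j + m = n) :
    ∃ k ≤ m * (K + 9) + 5, Exec (.loop (.not (.nle (.reg 0) (.reg i)))
      (.seq c.compile (.nset i (.add (.reg i) (.lit 1))))) (s.iter c.run i j) k
        (s.iter c.run i n) := by
  have hsize j : (s.iter c.run i j).nreg 0 = n := (iter_nreg_zero hi0 h0 s j).trans hs
  induction m generalizing j with
  | zero =>
    obtain rfl : j = n := by omega
    refine ⟨_, ?_, Exec.loop_done ?_⟩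
    · simp [Test.cost, NExp.cost]
    · simp [Test.Holds, NExp.eval, hsize, State.iter_counter]
  | succ m ih =>
    obtain ⟨k, hk, hbody⟩ := hc (s.iter c.run i j) (hsize j)
    obtain ⟨k', hk', hrest⟩ := ih (j + 1) (by omega)
    have hstep : s.iter c.run i (j + 1) = { c.run (s.iter c.run i j) with
        nreg := Function.update (c.run (s.iter c.run i j)).nreg i
          ((NExp.add (.reg i) (.lit 1)).eval (c.run (s.iter c.run i j))) } := by
      simp [State.iter, State.setN, NExp.eval, run_nreg hi, State.iter_counter]
    rw [hstep] at hrest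
    refine ⟨_, ?_, Exec.loop_step ?_ (Exec.seq hbody (Exec.nset _ _ _)) hrest⟩
    · simp only [Test.cost, NExp.cost]
      rw [Nat.succ_mul]
      omega
    · simp only [Test.Holds, NExp.eval, hsize, State.iter_counter]
      omega

theorem exec_compile (c : Cmd) (hc : c.WellFormed) (h0 : .nreg 0 ∉ c.writes) (s : State) :
    ∃ k ≤ c.costPoly.eval (s.nreg 0), Exec c.compile s k (c.run s) := by
  induction c generalizing s with
  | skip => exact ⟨1, by simp [costPoly], Exec.skip s⟩
  | nset x e => exact ⟨_, by simp [costPoly], Exec.nset s x e⟩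
  | rset x e => exact ⟨_, by simp [costPoly], Exec.rset s x e⟩
  | nput a i j e => exact ⟨_, by simp [costPoly], Exec.nput s a i j e⟩
  | rput a i j e => exact ⟨_, by simp [costPoly], Exec.rput s a i j e⟩
  | seq c d ihc ihd =>
    rw [writes, List.mem_append, not_or] at h0
    obtain ⟨k, hk, hexec⟩ := ihc hc.1 h0.1 s
    obtain ⟨l, hl, hexec'⟩ := ihd hc.2 h0.2 (c.run s)
    rw [run_nreg h0.1] at hl
    exact ⟨k + l, by rw [costPoly, Polynomial.eval_add]; omega, hexec.seq hexec'⟩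
  | ite b c d ihc ihd =>
    rw [writes, List.mem_append, not_or] at h0
    by_cases hb : b.Holds s
    · obtain ⟨k, hk, hexec⟩ := ihc hc.1 h0.1 s
      refine ⟨_, ?_, run_ite_of_holds hb ▸ Exec.ite_true hb hexec⟩
      simp only [costPoly, Polynomial.eval_add, Polynomial.eval_C]
      omega
    · obtain ⟨k, hk, hexec⟩ := ihd hc.2 h0.2 s
      refine ⟨_, ?_, run_ite_of_not_holds hb ▸ Exec.ite_false hb hexec⟩
      simp only [costPoly, Polynomial.eval_add, Polynomial.eval_C]
      omega
  | forN i c ih =>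
    rw [writes, List.mem_cons, not_or] at h0
    obtain ⟨k, hk, hexec⟩ := exec_loop hc.1 h0.2 (by simpa [eq_comm] using h0.1) (s := s) rfl
      (fun t ht => by simpa only [ht] using ih hc.2 h0.2 t) (s.nreg 0) 0 (Nat.zero_add _)
    refine ⟨_, ?_, Exec.seq (Exec.nset _ _ _) hexec⟩
    simp only [costPoly, NExp.cost, Polynomial.eval_add, Polynomial.eval_mul, Polynomial.eval_X,
      Polynomial.eval_ofNat]
    omega

theorem run_forN_induction (Inv : ℕ → State → Prop) (hn : s.nreg 0 = n) (hi0 : i ≠ 0)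
    (h0 : .nreg 0 ∉ c.writes) (hinit : Inv 0 (s.setN i 0))
    (hstep : ∀ j < n, ∀ t : State, t.nreg 0 = n → t.nreg i = j → Inv j t →
      Inv (j + 1) ((c.run t).setN i (j + 1))) :
    Inv n ((forN i c).run s) := by
  have hInv : ∀ j ≤ n, Inv j (s.iter c.run i j) := fun j => by
    induction j with
    | zero => exact fun _ => hinit
    | succ j ih =>
      exact fun hj => hstep j hj _ ((iter_nreg_zero hi0 h0 s j).trans hn) (s.iter_counter _ _ _)
        (ih (by omega))
  rw [run, hn]
  exact hInv n le_rfl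

theorem run_forN_forN_induction {j : ℕ} (Inv : (Fin n → Fin n → Prop) → State → Prop)
    (hn : s.nreg 0 = n) (hi0 : i ≠ 0) (hj0 : j ≠ 0) (hij : i ≠ j) (h0 : .nreg 0 ∉ c.writes)
    (hi : .nreg i ∉ c.writes)
    (hmono : ∀ P Q t, (∀ x y, Q x y → P x y) → Inv P t → Inv Q t)
    (hset : ∀ P t x k, x ∈ [i, j] → Inv P t → Inv P (t.setN x k))
    (hinit : Inv (fun _ _ => False) s)
    (hstep : ∀ P (t : State) (a b : Fin n), t.nreg i = a → t.nreg j = b → Inv P t →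
      Inv (fun x y => P x y ∨ (x = a ∧ y = b)) (c.run t)) :
    Inv (fun _ _ => True) ((forN i (forN j c)).run s) := by
  have h0' : .nreg 0 ∉ (forN j c).writes := by simpa [writes, hj0.symm] using h0
  refine hmono _ _ _ (fun x _ _ => x.2) <|
    run_forN_induction (fun a => Inv fun x _ => (x : ℕ) < a) hn hi0 h0'
      (hset _ _ _ _ (by simp) (hmono _ _ _ (by simp) hinit)) fun a ha t ht hta hInv => ?_
  suffices h : ((forN j c).run t).nreg i = a ∧
      Inv (fun x y => (x : ℕ) < a ∨ ((x : ℕ) = a ∧ (y : ℕ) < n)) ((forN j c).run t) from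
    hset _ _ _ _ (by simp) (hmono _ _ _ (fun x y hx => by grind) h.2)
  refine run_forN_induction (fun b t => t.nreg i = a ∧
    Inv (fun x y => (x : ℕ) < a ∨ ((x : ℕ) = a ∧ (y : ℕ) < b)) t) ht hj0 h0
    ⟨by simpa [State.setN, hij] using hta,
      hset _ _ _ _ (by simp) (hmono _ _ _ (by simp) hInv)⟩ fun b hb t _ htb ⟨hta, hInv⟩ => ?_
  refine ⟨by simpa [State.setN, hij, run_nreg hi] using hta, hset _ _ _ _ (by simp) ?_⟩
  refine hmono _ _ _ (fun x y hxy => ?_) (hstep _ t ⟨a, ha⟩ ⟨b, hb⟩ hta htb hInv)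
  simp only [Fin.ext_iff]
  omega

end Cmd

namespace Test

/-- Disjunction. -/
def or (b c : Test) : Test := .not (.and (.not b) (.not c))

/-- Strict comparison of natural numbers. -/
def nlt (e f : NExp) : Test := .not (.nle f e)

/-- Strict comparison of real numbers. -/
def rlt (e f : RExp) : Test := .not (.rle f e)

/-- Strict lexicographic comparison of pairs of a real number and a natural number. -/
def lexLt (e : RExp) (k : NExp) (e' : RExp) (k' : NExp) : Test :=
  .or (.rlt e e') (.and (.rle e e') (.nlt k k'))

variable {s : State}

theorem or_holds {b c : Test} : (b.or c).Holds s ↔ b.Holds s ∨ c.Holds s := by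
  simp only [or, Holds]
  tauto

theorem nlt_holds {e f : NExp} : (nlt e f).Holds s ↔ e.eval s < f.eval s := not_le

theorem rlt_holds {e f : RExp} : (rlt e f).Holds s ↔ e.eval s < f.eval s := not_le

theorem lexLt_holds {e e' : RExp} {k k' : NExp} :
    (lexLt e k e' k').Holds s ↔ toLex (e.eval s, k.eval s) < toLex (e'.eval s, k'.eval s) := by
  simp only [lexLt, or_holds, rlt_holds, Holds, nlt_holds, Prod.Lex.toLex_lt_toLex]
  grind

end Test

end RealRAM

/-! ### The registers of the algorithm -/

local notation "regPower" => 1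
local notation "regLog" => 2
local notation "regIndex" => 3
local notation "regDeg" => 4
local notation "regRadius" => 5
local notation "regSquare" => 6
local notation "regGap" => 7
local notation "regOuter" => 8
local notation "regInner" => 9
local notation "regFound" => 10
local notation "regRow" => 11
local notation "regCol" => 12
local notation "regLeft" => 13
local notation "regRight" => 14
local notation "regDegLeft" => 15
local notation "regDegRight" => 16
local notation "regCount" => 17
local notation "regSource" => 18
local notation "regTarget" => 19
local notation "regOrigin" => 20
local notation "regLayer" => 21
local notation "regVertex" => 22
local notation "regVia" => 23
local notation "regHere" => 24
local notation "regPred" => 25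
local notation "rregParam" => 0
local notation "rregExponent" => 1
local notation "rregNext" => 2
local notation "rregWeight" => 3
local notation "rregEdgeBound" => 4
local notation "rregPathBound" => 5
local notation "rregTerm" => 6

namespace RealRAM

/-! ### Lightest walks by dynamic programming -/

section Relaxed

variable {α : Type*} [Add α] [LinearOrder α] {v e : ℕ → α} {adj : ℕ → Prop} {x Y p' : ℕ} {v' : α}

/-- One step of the Bellman-Ford recursion: `v'` is the least of `v x` and of all `v y + e y` for
the neighbours `y < Y` of `x`, and `p'` is `x` or the neighbour for which it is attained. -/
structure Relaxed (v : ℕ → α) (adj : ℕ → Prop) (e : ℕ → α) (x Y : ℕ) (v' : α) (p' : ℕ) : Prop where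
  attained : (p' = x ∧ v' = v x) ∨ (p' < Y ∧ adj p' ∧ v' = v p' + e p')
  le_stay : v' ≤ v x
  le_move : ∀ y < Y, adj y → v' ≤ v y + e y

theorem Relaxed.zero : Relaxed v adj e x 0 (v x) x :=
  ⟨.inl ⟨rfl, rfl⟩, le_rfl, by simp⟩

theorem Relaxed.update (h : Relaxed v adj e x Y v' p') (hY : adj Y) (hlt : v Y + e Y < v') :
    Relaxed v adj e x (Y + 1) (v Y + e Y) Y where
  attained := .inr ⟨Y.lt_succ_self, hY, rfl⟩
  le_stay := hlt.le.trans h.le_stay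
  le_move y hy hadj := by
    rcases Nat.lt_succ_iff_lt_or_eq.1 hy with hy | rfl
    · exact hlt.le.trans (h.le_move y hy hadj)
    · exact le_rfl

theorem Relaxed.keep (h : Relaxed v adj e x Y v' p') (hY : ¬ (adj Y ∧ v Y + e Y < v')) :
    Relaxed v adj e x (Y + 1) v' p' where
  attained := h.attained.imp_right fun ⟨hp, h'⟩ => ⟨hp.trans Y.lt_succ_self, h'⟩
  le_stay := h.le_stay
  le_move y hy hadj := by
    rcases Nat.lt_succ_iff_lt_or_eq.1 hy with hy | rfl
    · exact h.le_move y hy hadj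
    · exact not_lt.1 fun hlt => hY ⟨hadj, hlt⟩

end Relaxed

/-- The entry of the vertex `x` in layer `k` of the table at `o`: natural array `o` tells whether
`x` has been reached, and if so, real array `o` and natural array `o + 1` hold the length of a walk
and the number of its edges that are missing in the graph of array `1`. Array `o + 2` holds the
predecessors of the vertices. -/
noncomputable def State.value (s : State) (o k x : ℕ) : WithTop (ℝ ×ₗ ℕ) :=
  if 1 ≤ s.narr o k x then (toLex (s.rarr o k x, s.narr (o + 1) k x) : ℝ ×ₗ ℕ) else ⊤

/-- The contribution of the edge from `y` to `x` to the value of a walk. -/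
noncomputable def State.edgeValue (s : State) (y x : ℕ) : WithTop (ℝ ×ₗ ℕ) :=
  (toLex (s.rarr 0 y x, 1 - s.narr 1 y x) : ℝ ×ₗ ℕ)

/-- The entry of `x` in layer `k + 1` takes account of the neighbours of `x` below `Y` in the graph
of array `A`. -/
def State.RelaxedAt (s : State) (A o k x Y : ℕ) : Prop :=
  Relaxed (s.value o k) (fun y => 1 ≤ s.narr A y x) (fun y => s.edgeValue y x) x Y
    (s.value o (k + 1) x) (s.narr (o + 2) (k + 1) x)

theorem State.value_add_edgeValue {s : State} {o k y : ℕ} (hy : 1 ≤ s.narr o k y) (x : ℕ) :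
    s.value o k y + s.edgeValue y x = (toLex (s.rarr o k y + s.rarr 0 y x,
      s.narr (o + 1) k y + (1 - s.narr 1 y x)) : ℝ ×ₗ ℕ) := by
  rw [value, if_pos hy]
  rfl

/-- The states `s` and `t` agree on the arrays, except for the entry `(i, j)` of the arrays from `o`
onwards. -/
structure AgreeOff (o i j : ℕ) (s t : State) : Prop where
  narr : ∀ a i' j', ¬ (i' = i ∧ j' = j) → t.narr a i' j' = s.narr a i' j'
  rarr : ∀ a i' j', ¬ (i' = i ∧ j' = j) → t.rarr a i' j' = s.rarr a i' j'
  narr_lt : ∀ a < o, t.narr a = s.narr a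
  rarr_lt : ∀ a < o, t.rarr a = s.rarr a

namespace AgreeOff

variable {A o i j k k' x x' Y : ℕ} {s t r : State}

theorem refl (o i j : ℕ) (s : State) : AgreeOff o i j s s :=
  ⟨fun _ _ _ _ => rfl, fun _ _ _ _ => rfl, fun _ _ => rfl, fun _ _ => rfl⟩

theorem trans (h : AgreeOff o i j s t) (h' : AgreeOff o i j t r) : AgreeOff o i j s r :=
  ⟨fun a i' j' hn => (h'.narr a i' j' hn).trans (h.narr a i' j' hn),
    fun a i' j' hn => (h'.rarr a i' j' hn).trans (h.rarr a i' j' hn),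
    fun a ha => (h'.narr_lt a ha).trans (h.narr_lt a ha),
    fun a ha => (h'.rarr_lt a ha).trans (h.rarr_lt a ha)⟩

theorem setN (h : AgreeOff o i j s t) (x k : ℕ) : AgreeOff o i j s (t.setN x k) :=
  ⟨h.narr, h.rarr, h.narr_lt, h.rarr_lt⟩

theorem value_eq (h : AgreeOff o i j s t) (hne : ¬ (k = i ∧ x = j)) :
    t.value o k x = s.value o k x := by
  simp only [State.value, h.narr _ _ _ hne, h.rarr _ _ _ hne]

theorem relaxedAt_iff (h : AgreeOff o (k + 1) x s t) (hA : A < o) (ho : 1 < o) (hk : k' ≤ k) :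
    t.RelaxedAt A o k' x' Y ↔ Relaxed (s.value o k') (fun y => 1 ≤ s.narr A y x')
      (fun y => s.edgeValue y x') x' Y (t.value o (k' + 1) x') (t.narr (o + 2) (k' + 1) x') := by
  have hrow : t.value o k' = s.value o k' := funext fun y => h.value_eq (by omega)
  simp only [State.RelaxedAt, State.edgeValue, hrow, h.narr_lt A hA, h.narr_lt 1 ho,
    h.rarr_lt 0 (by omega)]

theorem relaxedAt (h : AgreeOff o (k + 1) x s t) (hA : A < o) (ho : 1 < o)
    (hk : k' < k ∨ k' = k ∧ x' ≠ x) (hr : s.RelaxedAt A o k' x' Y) : t.RelaxedAt A o k' x' Y := by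
  rw [h.relaxedAt_iff hA ho (by omega), h.value_eq (by omega), h.narr _ _ _ (by omega)]
  exact hr

end AgreeOff

namespace Cmd

open NExp

/-- Overwriting the entry of the vertex in register `regVertex` in the layer after that in register
`regLayer`. -/
def putEntry (o : ℕ) (flag : NExp) (len : RExp) (miss pred : NExp) : Cmd :=
  block [
    nput o (add (reg regLayer) (lit 1)) (reg regVertex) flag,
    rput o (add (reg regLayer) (lit 1)) (reg regVertex) len,
    nput (o + 1) (add (reg regLayer) (lit 1)) (reg regVertex) miss,
    nput (o + 2) (add (reg regLayer) (lit 1)) (reg regVertex) pred]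

/-- The length of the walk that reaches the vertex in register `regVertex` from that in register
`regVia`. -/
def moveLen (o : ℕ) : RExp :=
  .add (.cell o (reg regLayer) (reg regVia)) (.cell 0 (reg regVia) (reg regVertex))

/-- The number of missing edges of that walk. -/
def moveMiss (o : ℕ) : NExp :=
  add (cell (o + 1) (reg regLayer) (reg regVia)) (sub (lit 1) (cell 1 (reg regVia) (reg regVertex)))

/-- Testing whether moving from the vertex in register `regVia` improves the entry of the vertex in
register `regVertex`. -/
def improves (A o : ℕ) : Test :=
  .and (.nle (lit 1) (cell A (reg regVia) (reg regVertex)))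
    (.and (.nle (lit 1) (cell o (reg regLayer) (reg regVia)))
      (.or (.nle (cell o (add (reg regLayer) (lit 1)) (reg regVertex)) (lit 0))
        (.lexLt (moveLen o) (moveMiss o) (.cell o (add (reg regLayer) (lit 1)) (reg regVertex))
          (cell (o + 1) (add (reg regLayer) (lit 1)) (reg regVertex)))))

/-- Trying to improve the entry of the vertex in register `regVertex` by moving there from the
vertex in register `regVia`. -/
def relax (A o : ℕ) : Cmd :=
  ite (improves A o) (putEntry o (lit 1) (moveLen o) (moveMiss o) (reg regVia)) skip

/-- Computing the entry of the vertex in register `regVertex` in the layer after that in register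
`regLayer`. -/
def entry (A o : ℕ) : Cmd :=
  seq (putEntry o (cell o (reg regLayer) (reg regVertex)) (.cell o (reg regLayer) (reg regVertex))
      (cell (o + 1) (reg regLayer) (reg regVertex)) (reg regVertex))
    (forN regVia (relax A o))

/-- The first layer of the table: only the vertex in register `regOrigin` is reached. -/
def firstLayer (o : ℕ) : Cmd :=
  block [
    forN regVertex (nput o (lit 0) (reg regVertex) (lit 0)),
    nput o (lit 0) (reg regOrigin) (lit 1),
    rput o (lit 0) (reg regOrigin) (.lit 0),
    nput (o + 1) (lit 0) (reg regOrigin) (lit 0)]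

/-- Computing the lightest walks in the graph of array `A` from the vertex in register `regOrigin`,
for each number of edges up to that of the vertices. Among walks of the same length those with few
edges missing in the graph of array `1` are preferred. -/
def shortest (A o : ℕ) : Cmd :=
  seq (firstLayer o) (forN regLayer (forN regVertex (entry A o)))

variable {A o k x y n u : ℕ} {s : State}

theorem putEntry_agreeOff (flag : NExp) (len : RExp) (miss pred : NExp) (hk : s.nreg regLayer = k)
    (hx : s.nreg regVertex = x) :
    AgreeOff o (k + 1) x s ((putEntry o flag len miss pred).run s) := by
  have hne {a b i j : ℕ} (hij : ¬ (i = k + 1 ∧ j = x)) : ¬ (a = b ∧ i = k + 1 ∧ j = x) :=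
    fun h => hij h.2
  constructor
  · intro a i j hij
    simp [putEntry, block, run, setCell, NExp.eval, hk, hx, hne hij]
  · intro a i j hij
    simp [putEntry, block, run, setCell, NExp.eval, hk, hx, hne hij]
  · intro a ha
    funext i j
    have ha₁ : a ≠ o + 1 := by omega
    have ha₂ : a ≠ o + 2 := by omega
    simp [putEntry, block, run, setCell, ha.ne, ha₁, ha₂]
  · intro a ha
    funext i j
    simp [putEntry, block, run, setCell, ha.ne]

theorem improves_holds (hk : s.nreg regLayer = k) (hx : s.nreg regVertex = x)
    (hy : s.nreg regVia = y) : (improves A o).Holds s ↔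
      1 ≤ s.narr A y x ∧ s.value o k y + s.edgeValue y x < s.value o (k + 1) x := by
  simp only [improves, Test.Holds, Test.or_holds, Test.lexLt_holds, moveLen, moveMiss, NExp.eval,
    RExp.eval, hk, hx, hy, Nat.le_zero]
  refine and_congr_right fun _ => ?_
  by_cases hflag : 1 ≤ s.narr o k y
  · rw [State.value_add_edgeValue hflag, State.value]
    by_cases hflag' : 1 ≤ s.narr o (k + 1) x
    · simp [hflag, hflag', Nat.one_le_iff_ne_zero.1 hflag', WithTop.coe_lt_coe]
    · simp [hflag, Nat.lt_one_iff.1 (not_le.1 hflag')]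
  · simp [State.value, hflag]

theorem relax_spec (hA : A < o) (ho : 1 < o) (hk : s.nreg regLayer = k)
    (hx : s.nreg regVertex = x) (hy : s.nreg regVia = y) (hr : s.RelaxedAt A o k x y) :
    ((relax A o).run s).RelaxedAt A o k x (y + 1) ∧
      AgreeOff o (k + 1) x s ((relax A o).run s) := by
  by_cases hb : (improves A o).Holds s
  · have hoff : AgreeOff o (k + 1) x s ((relax A o).run s) := by
      rw [relax, run_ite_of_holds hb]
      exact putEntry_agreeOff _ _ _ _ hk hx
    refine ⟨(hoff.relaxedAt_iff hA ho le_rfl).2 ?_, hoff⟩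
    have hflag : 1 ≤ s.narr o k y := by
      simpa only [Test.Holds, NExp.eval, hk, hy] using hb.2.1
    obtain ⟨hadj, hlt⟩ := (improves_holds hk hx hy).1 hb
    convert hr.update hadj hlt using 1
    · rw [State.value_add_edgeValue hflag, relax, run_ite_of_holds hb]
      simp [State.value, putEntry, moveLen, moveMiss, block, run, setCell, NExp.eval, RExp.eval,
        hk, hx, hy, ho.ne]
    · rw [relax, run_ite_of_holds hb]
      simp [putEntry, block, run, setCell, NExp.eval, hk, hx, hy]
  · rw [relax, run_ite_of_not_holds hb]
    rw [improves_holds hk hx hy] at hb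
    exact ⟨hr.keep hb, .refl _ _ _ _⟩

theorem entry_spec (hA : A < o) (ho : 1 < o) (hn : s.nreg 0 = n) (hk : s.nreg regLayer = k)
    (hx : s.nreg regVertex = x) :
    ((entry A o).run s).RelaxedAt A o k x n ∧ AgreeOff o (k + 1) x s ((entry A o).run s) := by
  rw [entry, run_seq]
  set s₁ := (putEntry o _ _ _ _).run s with hs₁
  have hoff : AgreeOff o (k + 1) x s s₁ := putEntry_agreeOff _ _ _ _ hk hx
  have hinit : s₁.RelaxedAt A o k x 0 := by
    refine (hoff.relaxedAt_iff hA ho le_rfl).2 ?_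
    convert Relaxed.zero using 1
    · simp [hs₁, State.value, putEntry, block, run, setCell, NExp.eval, RExp.eval, hk, hx]
    · simp [hs₁, putEntry, block, run, setCell, NExp.eval, hk, hx]
  have hreg {z : ℕ} : s₁.nreg z = s.nreg z := run_nreg (by simp [putEntry, block, writes]) s
  have hrelax {z : ℕ} : Loc.nreg z ∉ (relax A o).writes := by
    simp [relax, putEntry, writes, block]
  have hloop := run_forN_induction (c := relax A o) (i := regVia) (s := s₁)
    (fun j t => (t.RelaxedAt A o k x j ∧ AgreeOff o (k + 1) x s t) ∧ t.nreg regLayer = k ∧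
      t.nreg regVertex = x)
    (hreg.trans hn) (by decide) hrelax
    ⟨⟨hinit, hoff.setN _ _⟩, by simp [State.setN, hreg, hk], by simp [State.setN, hreg, hx]⟩ ?_
  · exact hloop.1
  · rintro j - t - htj ⟨⟨hr, hst⟩, htk, htx⟩
    obtain ⟨hr', htr⟩ := relax_spec hA ho htk htx htj hr
    exact ⟨⟨hr', hst.trans (htr.setN _ _)⟩, by simp [State.setN, run_nreg hrelax, htk],
      by simp [State.setN, run_nreg hrelax, htx]⟩

end Cmd

/-- The first layer of the table at `o` for the source `u`. -/
structure State.FirstLayer (s : State) (o n u : ℕ) : Prop where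
  source : s.value o 0 u = 0
  other : ∀ x < n, x ≠ u → s.value o 0 x = ⊤

/-- The table at `o` contains the lightest walks to `u` in the graph of array `A`. -/
structure State.Table (s : State) (A o n u : ℕ) : Prop extends s.FirstLayer o n u where
  step : ∀ k < n, ∀ x < n, s.RelaxedAt A o k x n

theorem State.FirstLayer.of_agreeOff {o n u k x : ℕ} {s t : State} (hs : s.FirstLayer o n u)
    (h : AgreeOff o (k + 1) x s t) : t.FirstLayer o n u where
  source := (h.value_eq (by omega)).trans hs.source
  other y hy hyu := (h.value_eq (by omega)).trans (hs.other y hy hyu)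

theorem State.FirstLayer.setN {o n u : ℕ} {s : State} (h : s.FirstLayer o n u) (x k : ℕ) :
    (s.setN x k).FirstLayer o n u :=
  ⟨h.source, h.other⟩

namespace Cmd

variable {A o n u : ℕ} {s : State}

theorem firstLayer_spec (hn : s.nreg 0 = n) (hu : s.nreg regOrigin = u) :
    ((firstLayer o).run s).FirstLayer o n u := by
  simp only [firstLayer, block, run_seq]
  set s₁ := (forN regVertex _).run s
  have hzero : ∀ x < n, s₁.narr o 0 x = 0 := by
    refine run_forN_induction (fun j t => ∀ x < j, t.narr o 0 x = 0) hn (by decide)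
      (by simp [writes]) (by simp) ?_
    rintro j - t - htj ih x hx
    by_cases hxj : x = j
    · simp [State.setN, run, setCell, NExp.eval, htj, hxj]
    · simpa [State.setN, run, setCell, NExp.eval, htj, hxj] using ih x (by omega)
  have hu₁ : s₁.nreg regOrigin = u := (run_nreg (by simp [writes]) s).trans hu
  refine ⟨?_, fun x hx hxu => ?_⟩
  · simp only [State.value, run, setCell, NExp.eval, RExp.eval, hu₁, and_self, if_true, le_refl,
      Nat.cast_zero, Nat.left_eq_add, one_ne_zero, false_and, if_false]
    rfl
  · simp [State.value, run, setCell, NExp.eval, hu₁, hxu, hzero x hx]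

theorem shortest_spec (hA : A < o) (ho : 1 < o) (hn : s.nreg 0 = n) (hu : s.nreg regOrigin = u) :
    ((shortest A o).run s).Table A o n u := by
  have hentry {z : ℕ} (hz : z ≠ regVia) : Loc.nreg z ∉ (entry A o).writes := by
    simpa [entry, relax, putEntry, writes, block] using hz
  rw [shortest, run_seq]
  have hfirst := firstLayer_spec (o := o) hn hu
  have hn₁ : ((firstLayer o).run s).nreg 0 = n :=
    (run_nreg (by simp [firstLayer, block, writes]) s).trans hn
  have houter := run_forN_induction (c := forN regVertex (entry A o)) (i := regLayer)
    (fun j t => t.FirstLayer o n u ∧ ∀ k < j, ∀ x < n, t.RelaxedAt A o k x n) hn₁ (by decide)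
    (by simp [writes, hentry]) ⟨hfirst.setN _ _, by simp⟩ ?_
  · exact ⟨houter.1, houter.2⟩
  · rintro j - t ht0 htj ⟨htu, ht⟩
    have hinner := run_forN_induction (c := entry A o) (i := regVertex) (s := t)
      (fun i r => r.FirstLayer o n u ∧ (∀ k < j, ∀ x < n, r.RelaxedAt A o k x n) ∧
        (∀ x < i, r.RelaxedAt A o j x n) ∧ r.nreg regLayer = j) ht0 (by decide)
      (hentry (by decide)) ⟨htu.setN _ _, ht, by simp, by simpa [State.setN] using htj⟩ ?_
    · refine ⟨hinner.1.setN _ _, fun k hk x hx => ?_⟩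
      rcases Nat.lt_succ_iff_lt_or_eq.1 hk with hk | rfl
      · exact hinner.2.1 k hk x hx
      · exact hinner.2.2.1 x hx
    · rintro i hi r hr0 hri ⟨hru, hr, hri', hrj⟩
      obtain ⟨hnew, hoff⟩ := entry_spec hA ho hr0 hrj hri
      replace hoff := hoff.setN regVertex (i + 1)
      refine ⟨hru.of_agreeOff hoff, fun k hk x hx => hoff.relaxedAt hA ho (.inl hk) (hr k hk x hx),
        fun x hx => ?_, by simpa [State.setN, run_nreg (hentry _)] using hrj⟩
      rcases Nat.lt_succ_iff_lt_or_eq.1 hx with hx | rfl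
      · exact hoff.relaxedAt hA ho (.inr ⟨rfl, hx.ne⟩) (hri' x hx)
      · exact hnew

end Cmd

end RealRAM

namespace RealRAM

/-! ### Graphs in the memory -/

open WeightedGraph

variable {n : ℕ}

section Cost

variable {V : Type*} {w : Sym2 V → ℝ≥0} {H K : SimpleGraph V} {u v x : V}

/-- The cost of the edge `e`: its weight and, to break ties, whether it is missing in `H`. -/
noncomputable def edgeCost (w : Sym2 V → ℝ≥0) (H : SimpleGraph V) (e : Sym2 V) : ℝ ×ₗ ℕ :=
  toLex ((w e : ℝ), missing H e)

/-- The cost of a walk, which is the sum of the costs of its edges. -/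
noncomputable def cost (w : Sym2 V → ℝ≥0) (H : SimpleGraph V) (q : K.Walk u v) : ℝ ×ₗ ℕ :=
  toLex ((length w q : ℝ), missCount H q)

theorem cost_nil : cost w H (.nil : K.Walk u u) = 0 := by
  simp [cost, length, missCount]

theorem cost_cons (h : K.Adj u v) (q : K.Walk v x) :
    cost w H (.cons h q) = edgeCost w H s(u, v) + cost w H q := by
  simp [cost, edgeCost, length, missCount, ← toLex_add]

theorem cost_concat (q : K.Walk u v) (h : K.Adj v x) :
    cost w H (q.concat h) = cost w H q + edgeCost w H s(v, x) := by
  simp [cost, edgeCost, length, missCount, ← toLex_add, SimpleGraph.Walk.edges_concat]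

theorem missCount_bypass_le [DecidableEq V] (q : K.Walk u v) :
    missCount H q.bypass ≤ missCount H q := by
  obtain ⟨l, hl, hs⟩ := q.bypass_isPath.edges_nodup.subperm q.edges_bypass_subset_edges
  rw [missCount, ← (hl.map _).sum_eq]
  exact (hs.map _).sum_le_sum fun _ _ => Nat.zero_le _

theorem cost_bypass_le [DecidableEq V] (q : K.Walk u v) : cost w H q.bypass ≤ cost w H q :=
  Prod.Lex.toLex_mono ⟨NNReal.coe_le_coe.2 (length_bypass_le q), missCount_bypass_le q⟩

end Cost

/-- The natural number array `A` is the adjacency matrix of `K`. -/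
def State.Rep (s : State) (A : ℕ) (K : SimpleGraph (Fin n)) : Prop :=
  ∀ i j : Fin n, (K.Adj i j → s.narr A i j = 1) ∧ (¬ K.Adj i j → s.narr A i j = 0)

/-- The real array `0` contains the weights of the edges of `G`. -/
def State.RepWeight (s : State) (G : WeightedGraph n) : Prop :=
  ∀ i j : Fin n, G.graph.Adj i j → s.rarr 0 i j = G.w s(i, j)

namespace State.Rep

variable {A : ℕ} {H K : SimpleGraph (Fin n)} {s t : State}

theorem one_le_iff (h : s.Rep A K) (i j : Fin n) : 1 ≤ s.narr A i j ↔ K.Adj i j := by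
  by_cases hij : K.Adj i j
  · simp [hij, (h i j).1 hij]
  · simp [hij, (h i j).2 hij]

theorem congr (h : s.Rep A K) (hst : t.narr A = s.narr A) : t.Rep A K := by
  simpa only [State.Rep, hst] using h

theorem one_sub_eq_missing (h : s.Rep A H) (i j : Fin n) :
    1 - s.narr A i j = missing H s(i, j) := by
  by_cases hij : H.Adj i j
  · simp [missing, hij, (h i j).1 hij]
  · simp [missing, hij, (h i j).2 hij]

end State.Rep

/-- The table at `o` contains the cheapest walks to `u` in `K`, where the cost of a walk depends on
`H` and the weights of `G`. -/
structure State.WalkTable (s : State) (G : WeightedGraph n) (K H : SimpleGraph (Fin n)) (A o : ℕ)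
    (u : Fin n) : Prop where
  table : s.Table A o n u
  rep : s.Rep A K
  rep_one : s.Rep 1 H
  weight : s.RepWeight G
  le : K ≤ G.graph

namespace State

variable {s : State} {o k x : ℕ}

theorem value_of_one_le (h : 1 ≤ s.narr o k x) :
    s.value o k x = (toLex (s.rarr o k x, s.narr (o + 1) k x) : ℝ ×ₗ ℕ) := if_pos h

theorem value_ne_top_iff : s.value o k x ≠ ⊤ ↔ 1 ≤ s.narr o k x := by
  by_cases h : 1 ≤ s.narr o k x <;> simp [value, h]

end State

namespace State.WalkTable

variable {G : WeightedGraph n} {K H : SimpleGraph (Fin n)} {s : State} {A o k : ℕ} {u x y : Fin n}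

theorem edgeValue_eq (h : s.WalkTable G K H A o u) (hxy : K.Adj x y) :
    s.edgeValue y x = edgeCost G.w H s(x, y) := by
  rw [edgeValue, h.rep_one.one_sub_eq_missing, h.weight y x (h.le hxy.symm), Sym2.eq_swap, edgeCost]

theorem value_le_cost_of_length_le (h : s.WalkTable G K H A o u) (hk : k ≤ n) (q : K.Walk x u)
    (hq : q.length ≤ k) : s.value o k x ≤ cost G.w H q := by
  induction k generalizing x with
  | zero =>
    cases q with
    | nil => rw [h.table.source, cost_nil, WithTop.coe_zero]
    | cons _ _ => simp at hq
  | succ k ih =>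
    have hstep := h.table.step k hk x x.2
    cases q with
    | nil => exact hstep.le_stay.trans (ih (by omega) .nil k.zero_le)
    | @cons _ y _ hxy q =>
      have hmove := hstep.le_move y y.2 ((h.rep.one_le_iff y x).2 hxy.symm)
      rw [h.edgeValue_eq hxy] at hmove
      rw [cost_cons, add_comm (edgeCost _ _ _), WithTop.coe_add]
      exact hmove.trans (add_le_add_left (ih (by omega) q (by simpa using hq)) _)

theorem value_le_cost (h : s.WalkTable G K H A o u) (q : K.Walk x u) :
    s.value o n x ≤ cost G.w H q := by
  have hlt := q.bypass_isPath.length_lt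
  rw [Fintype.card_fin] at hlt
  exact (h.value_le_cost_of_length_le le_rfl q.bypass hlt.le).trans
    (WithTop.coe_le_coe.2 (cost_bypass_le q))

theorem exists_pred (h : s.WalkTable G K H A o u) (hk : k < n) (x : Fin n) :
    ∃ y : Fin n, s.narr (o + 2) (k + 1) x = y ∧
      (y = x ∧ s.value o (k + 1) x = s.value o k x ∨
        K.Adj x y ∧ s.value o (k + 1) x = s.value o k y + edgeCost G.w H s(x, y)) := by
  rcases (h.table.step k hk x x.2).attained with ⟨hp, hstay⟩ | ⟨hp, hadj, hmove⟩
  · exact ⟨x, hp, .inl ⟨rfl, hstay⟩⟩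
  · obtain ⟨y, hy⟩ : ∃ y : Fin n, s.narr (o + 2) (k + 1) x = y := ⟨⟨_, hp⟩, rfl⟩
    rw [hy] at hadj hmove
    have hxy : K.Adj x y := ((h.rep.one_le_iff y x).1 hadj).symm
    exact ⟨y, hy, .inr ⟨hxy, by rw [hmove, h.edgeValue_eq hxy]⟩⟩

theorem eq_of_value_zero_ne_top (h : s.WalkTable G K H A o u) (hx : s.value o 0 x ≠ ⊤) : x = u := by
  by_contra hne
  exact hx (h.table.other x x.2 fun h' => hne (Fin.ext h'))

theorem exists_cost_eq (h : s.WalkTable G K H A o u) (hk : k ≤ n) (hx : s.value o k x ≠ ⊤) :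
    ∃ q : K.Walk x u, s.value o k x = cost G.w H q := by
  induction k generalizing x with
  | zero =>
    obtain rfl := h.eq_of_value_zero_ne_top hx
    exact ⟨.nil, by rw [h.table.source, cost_nil, WithTop.coe_zero]⟩
  | succ k ih =>
    obtain ⟨y, -, ⟨rfl, hval⟩ | ⟨hxy, hval⟩⟩ := h.exists_pred hk x
    · rw [hval] at hx ⊢
      exact ih (by omega) hx
    · rw [hval] at hx ⊢
      obtain ⟨q, hq⟩ := ih (by omega) (WithTop.add_ne_top.1 hx).1
      exact ⟨.cons hxy q, by rw [cost_cons, add_comm, WithTop.coe_add, hq]⟩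

theorem dist_eq_top (h : s.WalkTable G K H A o u) (hx : ¬ 1 ≤ s.narr o n x) :
    dist G.w K x u = ⊤ := by
  have : IsEmpty (K.Walk x u) := ⟨fun q => hx <| value_ne_top_iff.1
    ((h.value_le_cost q).trans_lt (WithTop.coe_lt_top _)).ne⟩
  simp [WeightedGraph.dist]

theorem length_eq_dist (h : s.WalkTable G K H A o u) {r : K.Walk x u}
    (hr : s.value o n x = cost G.w H r) : length G.w r = dist G.w K x u := by
  refine le_antisymm (le_iInf fun q => ?_) (dist_le_length r)
  have hle := h.value_le_cost q
  rw [hr, WithTop.coe_le_coe] at hle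
  exact_mod_cast Prod.Lex.monotone_fst _ _ hle

theorem missCount_le (h : s.WalkTable G K H A o u) {r : K.Walk x u}
    (hr : s.value o n x = cost G.w H r) (q : K.Walk x u) (hq : length G.w q ≤ length G.w r) :
    missCount H r ≤ missCount H q := by
  have hle := h.value_le_cost q
  rw [hr, WithTop.coe_le_coe, cost, cost, Prod.Lex.toLex_le_toLex] at hle
  exact (hle.resolve_left (not_lt.2 (NNReal.coe_le_coe.2 hq))).2

theorem dist_eq (h : s.WalkTable G K H A o u) (hx : 1 ≤ s.narr o n x) :
    dist G.w K x u = ENNReal.ofReal (s.rarr o n x) ∧ 0 ≤ s.rarr o n x := by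
  obtain ⟨q, hq⟩ := h.exists_cost_eq le_rfl (value_ne_top_iff.2 hx)
  have hlen : s.rarr o n x = length G.w q := by
    rw [value_of_one_le hx, WithTop.coe_inj] at hq
    exact congrArg (fun c => (ofLex c).1) hq
  rw [hlen, ENNReal.ofReal_coe_nnreal]
  exact ⟨(h.length_eq_dist hq).symm, NNReal.coe_nonneg _⟩

theorem lt_dist_iff (h : s.WalkTable G K H A o u) {c : ℝ} (hc : 0 ≤ c) :
    ENNReal.ofReal c < dist G.w K x u ↔ s.narr o n x < 1 ∨ c < s.rarr o n x := by
  by_cases hx : 1 ≤ s.narr o n x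
  · rw [(h.dist_eq hx).1, ENNReal.ofReal_lt_ofReal_iff_of_nonneg hc]
    simp only [not_lt.2 hx, false_or]
  · simp only [h.dist_eq_top hx, ENNReal.ofReal_lt_top, not_le.1 hx, true_or]

end State.WalkTable

namespace Cmd

open NExp

/-- Adding the edge between the vertices in the registers `x` and `y` to the graph of array `A`. -/
def addEdge (A x y : ℕ) : Cmd :=
  block [nput A (reg x) (reg y) (lit 1), nput A (reg y) (reg x) (lit 1)]

/-- Moving from the vertex in register `regHere` to its predecessor in the table at `o`, and adding
the edge between them to the graph of array `1`. -/
def stepBack (o : ℕ) : Cmd :=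
  block [
    nset regPred (cell (o + 2) (sub (reg 0) (reg regCount)) (reg regHere)),
    ite (.and (.nle (reg regPred) (reg regHere)) (.nle (reg regHere) (reg regPred))) skip
      (addEdge 1 regPred regHere),
    nset regHere (reg regPred)]

/-- Adding the walk from the vertex in register `regTarget` along the predecessors to the graph of
array `1`. -/
def buyPath (o : ℕ) : Cmd :=
  seq (nset regHere (reg regTarget)) (forN regCount (stepBack o))

variable {A o : ℕ} {s t : State} {H K : SimpleGraph (Fin n)}

theorem addEdge_rep {x y : ℕ} (hK : s.Rep A K) {a b : Fin n} (hab : a ≠ b) (hx : s.nreg x = a)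
    (hy : s.nreg y = b) : ((addEdge A x y).run s).Rep A (K ⊔ SimpleGraph.edge a b) := by
  intro i j
  rw [adj_sup_edge hab, Sym2.eq_iff]
  simp only [addEdge, block, run, NExp.eval, setCell, hx, hy, true_and, ← Fin.ext_iff]
  constructor
  · intro h
    split_ifs with h₁ h₂
    · rfl
    · rfl
    · exact (hK i j).1 (by tauto)
  · intro h
    rw [if_neg (by tauto), if_neg (by tauto)]
    exact (hK i j).2 (by tauto)

theorem stepBack_spec {x y : Fin n} (hH : t.Rep 1 H) (hx : t.nreg regHere = x)
    (hy : t.narr (o + 2) (t.nreg 0 - t.nreg regCount) x = y) :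
    ((stepBack o).run t).nreg regHere = y ∧
      ((stepBack o).run t).Rep 1 (H ⊔ SimpleGraph.edge y x) := by
  simp only [stepBack, block, run_seq]
  set t₁ := (nset regPred _).run t
  have hpred : t₁.nreg regPred = y := by simp [t₁, run, State.setN, NExp.eval, hx, hy]
  have hhere : t₁.nreg regHere = x := by simp [t₁, run, State.setN, hx]
  have htest : (Test.and (.nle (reg regPred) (reg regHere))
      (.nle (reg regHere) (reg regPred))).Holds t₁ ↔ y = x := by
    simp only [Test.Holds, NExp.eval, hpred, hhere, Fin.ext_iff]
    omega
  by_cases hyx : y = x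
  · rw [run_ite_of_holds (htest.2 hyx), hyx, SimpleGraph.edge_self_eq_bot, sup_bot_eq, ← hyx]
    exact ⟨by simp [run, State.setN, NExp.eval, hpred], hH⟩
  · rw [run_ite_of_not_holds (htest.not.2 hyx)]
    refine ⟨?_, addEdge_rep (s := t₁) hH hyx hpred hhere⟩
    simp [run, State.setN, NExp.eval, addEdge, block, hpred]

theorem buyPath_spec {G : WeightedGraph n} {u v : Fin n} (h : s.WalkTable G K H A o u)
    (h0 : s.nreg 0 = n) (htgt : s.nreg regTarget = v) (hv : s.value o n v ≠ ⊤) :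
    ∃ (r : K.Walk v u) (H' : SimpleGraph (Fin n)), s.value o n v = cost G.w H r ∧
      (∀ x y, H'.Adj x y ↔ H.Adj x y ∨ s(x, y) ∈ r.edges) ∧ ((buyPath o).run s).Rep 1 H' := by
  rw [buyPath, run_seq]
  have hloop := run_forN_induction (s := (nset regHere (reg regTarget)).run s) (i := regCount)
    (c := stepBack o) (n := n)
    (fun j t => t.narr (o + 2) = s.narr (o + 2) ∧
      ∃ (y : Fin n) (r : K.Walk v y) (H' : SimpleGraph (Fin n)), t.nreg regHere = y ∧
        s.value o n v = cost G.w H r + s.value o (n - j) y ∧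
        (∀ x y, H'.Adj x y ↔ H.Adj x y ∨ s(x, y) ∈ r.edges) ∧ t.Rep 1 H')
    h0 (by decide) (by simp [writes, stepBack, addEdge, block])
    ⟨rfl, v, .nil, H, by simpa [State.setN, run, NExp.eval] using htgt, by simp [cost_nil],
      by simp, h.rep_one⟩ ?_
  · obtain ⟨-, y, r, H', -, hval, hadj, hrep⟩ := hloop
    rw [Nat.sub_self] at hval
    obtain rfl := h.eq_of_value_zero_ne_top (WithTop.add_ne_top.1 (hval ▸ hv)).2
    exact ⟨r, H', by rw [hval, h.table.source, add_zero], hadj, hrep⟩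
  · rintro j hj t ht0 htj ⟨htable, x, r, H', hx, hval, hadj, hrep⟩
    obtain ⟨k, hk⟩ : ∃ k, n - j = k + 1 := ⟨n - j - 1, by omega⟩
    rw [hk] at hval
    rw [(by omega : n - (j + 1) = k)]
    obtain ⟨y, hy, hcase⟩ := h.exists_pred (k := k) (by omega) x
    obtain ⟨hhere, hrep'⟩ := stepBack_spec hrep hx (by rwa [ht0, htj, hk, htable])
    have htable' : ((stepBack o).run t).narr (o + 2) = s.narr (o + 2) :=
      (run_narr (by simp [stepBack, addEdge, block, writes]) t).trans htable
    refine ⟨htable', y, ?_⟩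
    rcases hcase with ⟨rfl, hstay⟩ | ⟨hxy, hmove⟩
    · rw [SimpleGraph.edge_self_eq_bot, sup_bot_eq] at hrep'
      exact ⟨r, H', by simpa [State.setN] using hhere, by rw [hval, hstay], hadj, hrep'⟩
    · refine ⟨r.concat hxy, _, by simpa [State.setN] using hhere, ?_, fun a b => ?_, hrep'⟩
      · rw [hval, hmove, cost_concat, WithTop.coe_add, add_assoc, add_comm (s.value o k y)]
      · rw [adj_sup_edge hxy.ne', hadj, SimpleGraph.Walk.edges_concat, Sym2.eq_swap (a := y)]
        simp [or_assoc]

end Cmd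

end RealRAM

namespace RealRAM

open WeightedGraph

variable {n : ℕ}

/-! ### Processing one edge -/

namespace Cmd

open NExp

/-- Adding `e` to the real register `x`, as many times as register `k` says. -/
def addTimes (i k x : ℕ) (e : RExp) : Cmd :=
  forN i (ite (.nlt (reg i) (reg k)) (rset x (.add (.reg x) e)) skip)

/-- Testing whether the pair of vertices in the registers `regRow` and `regCol` is an unmarked edge
that is lighter than the selected one. -/
def isLighter : Test :=
  .and (.nle (lit 1) (cell 0 (reg regRow) (reg regCol)))
    (.and (.nlt (cell 2 (reg regRow) (reg regCol)) (lit 1))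
      (.or (.nlt (reg regFound) (lit 1))
        (.rlt (.cell 0 (reg regRow) (reg regCol)) (.reg rregWeight))))

/-- Selecting the pair of vertices in the registers `regRow` and `regCol`. -/
def selectPair : Cmd :=
  block [
    nset regFound (lit 1),
    nset regLeft (reg regRow),
    nset regRight (reg regCol),
    rset rregWeight (.cell 0 (reg regRow) (reg regCol))]

/-- Selecting an unmarked edge of minimal weight. -/
def selectEdge : Cmd :=
  seq (nset regFound (lit 0)) (forN regRow (forN regCol (ite isLighter selectPair skip)))

/-- Computing the degrees of the ends of the selected edge in the spanner. -/
def degrees : Cmd :=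
  block [
    nset regDegLeft (lit 0),
    nset regDegRight (lit 0),
    forN regCount (block [
      nset regDegLeft (add (reg regDegLeft) (cell 1 (reg regLeft) (reg regCount))),
      nset regDegRight (add (reg regDegRight) (cell 1 (reg regRight) (reg regCount)))])]

/-- Computing the stretch that is allowed for the selected edge. -/
def edgeBound : Cmd :=
  block [
    rset rregEdgeBound (.add (.reg rregWeight) (.add (.reg rregWeight) (.reg rregWeight))),
    addTimes regCount regLog rregEdgeBound (.add (.reg rregWeight) (.reg rregWeight))]

/-- Computing the additive stretch that is allowed for paths whose heaviest edge is the selected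
one. -/
def pathBound : Cmd :=
  block [
    rset rregTerm (.add (.reg rregWeight) (.reg rregWeight)),
    rset rregTerm (.add (.reg rregTerm) (.reg rregTerm)),
    rset rregTerm (.add (.reg rregEdgeBound) (.add (.reg rregTerm) (.reg rregTerm))),
    rset rregPathBound (.lit 0),
    addTimes regCount regRadius rregPathBound
      (.add (.reg rregTerm) (.add (.reg rregTerm) (.reg rregTerm)))]

/-- Computing what is needed to decide about the selected edge. -/
def measureSelected : Cmd :=
  block [degrees, edgeBound, nset regOrigin (reg regLeft), shortest 1 20]

/-- Testing whether an end of the selected edge has small degree in the spanner, or its ends are far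
apart there. -/
def needsEdge : Test :=
  .or (.or (.nlt (reg regDegLeft) (reg regDeg)) (.nlt (reg regDegRight) (reg regDeg)))
    (.or (.nlt (cell 20 (reg 0) (reg regRight)) (lit 1))
      (.rlt (.reg rregEdgeBound) (.cell 20 (reg 0) (reg regRight))))

/-- Adding the selected edge to the spanner, if there is need. -/
def insertSelected : Cmd :=
  seq measureSelected (ite needsEdge (addEdge 1 regLeft regRight) skip)

/-- Computing the distances from the vertex in register `regSource` in the input graph, in the
spanner and in the graph of the marked edges. -/
def tables : Cmd :=
  block [nset regOrigin (reg regSource), shortest 0 10, shortest 1 20, shortest 2 30]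

/-- Testing whether the marked edges contain a shortest path between the vertices in the registers
`regSource` and `regTarget` that the spanner stretches too much. -/
def needsPath : Test :=
  .and (.nle (lit 1) (cell 30 (reg 0) (reg regTarget)))
    (.and (.rle (.cell 30 (reg 0) (reg regTarget)) (.cell 10 (reg 0) (reg regTarget)))
      (.or (.nlt (cell 20 (reg 0) (reg regTarget)) (lit 1))
        (.rlt (.add (.cell 30 (reg 0) (reg regTarget)) (.reg rregPathBound))
          (.cell 20 (reg 0) (reg regTarget)))))

/-- Adding such a path to the spanner, if there is need. -/
def servePair : Cmd :=
  seq tables (ite needsPath (buyPath 30) skip)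

/-- Processing the selected edge. -/
def processEdge : Cmd :=
  block [
    insertSelected,
    addEdge 2 regLeft regRight,
    pathBound,
    forN regSource (forN regTarget servePair)]

end Cmd

/-- The locations of the input and of the parameters. -/
def dataLocs : List Loc :=
  [.nreg 0, .nreg regLog, .nreg regDeg, .nreg regRadius, .narr 0, .rarr 0]

/-- The data that the memory holds between the steps of the algorithm: the parameters, the weighted
graph `G`, the graph `M` of the marked edges and the spanner `H`. -/
structure State.Ctx (s : State) (G : WeightedGraph n) (L d r : ℕ) (M H : SimpleGraph (Fin n)) :
    Prop where
  size : s.nreg 0 = n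
  log : s.nreg regLog = L
  deg : s.nreg regDeg = d
  radius : s.nreg regRadius = r
  graph : s.Rep 0 G.graph
  spanner : s.Rep 1 H
  marked : s.Rep 2 M
  weight : s.RepWeight G

/-- The locations on which a table at `o` for the graph of array `A` depends. -/
def tableLocs (A o : ℕ) : List Loc :=
  [.narr o, .narr (o + 1), .narr (o + 2), .narr A, .narr 1, .rarr o, .rarr 0]

variable {G : WeightedGraph n} {L d r : ℕ} {M M' H H' : SimpleGraph (Fin n)} {s t : State}
  {c : Cmd} {a b u v : Fin n}

theorem State.Ctx.of_agreeAt (h : s.Ctx G L d r M H) (ht : ∀ l ∈ dataLocs, t.AgreeAt s l)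
    (hM' : t.Rep 2 M') (hH' : t.Rep 1 H') : t.Ctx G L d r M' H' where
  size := Eq.trans (ht (.nreg 0) (by decide)) h.size
  log := Eq.trans (ht (.nreg regLog) (by decide)) h.log
  deg := Eq.trans (ht (.nreg regDeg) (by decide)) h.deg
  radius := Eq.trans (ht (.nreg regRadius) (by decide)) h.radius
  graph := h.graph.congr (ht (.narr 0) (by decide))
  spanner := hH'
  marked := hM'
  weight i j hij := by
    rw [show t.rarr 0 = s.rarr 0 from ht (.rarr 0) (by decide), h.weight i j hij]

theorem State.Ctx.run (h : s.Ctx G L d r M H)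
    (hc : ∀ l ∈ .narr 1 :: .narr 2 :: dataLocs, l ∉ c.writes) : (c.run s).Ctx G L d r M H :=
  h.of_agreeAt (fun l hl => c.run_agreeAt (hc l (by simp [hl])) s)
    (h.marked.congr (Cmd.run_narr (hc _ (by simp)) s))
    (h.spanner.congr (Cmd.run_narr (hc _ (by simp)) s))

theorem State.Ctx.setN (h : s.Ctx G L d r M H) {x : ℕ} (k : ℕ) (hx : .nreg x ∉ dataLocs) :
    (s.setN x k).Ctx G L d r M H :=
  h.of_agreeAt (fun _ hl => s.agreeAt_setN k fun heq => hx (heq ▸ hl)) h.marked h.spanner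

theorem State.Ctx.run_spanner (h : s.Ctx G L d r M H)
    (hc : ∀ l ∈ .narr 2 :: dataLocs, l ∉ c.writes) (hH' : (c.run s).Rep 1 H') :
    (c.run s).Ctx G L d r M H' :=
  h.of_agreeAt (fun l hl => c.run_agreeAt (hc l (by simp [hl])) s)
    (h.marked.congr (Cmd.run_narr (hc _ (by simp)) s)) hH'

theorem State.Ctx.run_marked (h : s.Ctx G L d r M H)
    (hc : ∀ l ∈ .narr 1 :: dataLocs, l ∉ c.writes) (hM' : (c.run s).Rep 2 M') :
    (c.run s).Ctx G L d r M' H :=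
  h.of_agreeAt (fun l hl => c.run_agreeAt (hc l (by simp [hl])) s) hM'
    (h.spanner.congr (Cmd.run_narr (hc _ (by simp)) s))

theorem State.Table.run {A o u : ℕ} (h : s.Table A o n u) (hc : ∀ l ∈ tableLocs A o, l ∉ c.writes) :
    (c.run s).Table A o n u := by
  have hagree l (hl : l ∈ tableLocs A o) : (c.run s).AgreeAt s l := c.run_agreeAt (hc l hl) s
  simp only [tableLocs, List.forall_mem_cons, State.AgreeAt] at hagree
  obtain ⟨ho, ho₁, ho₂, hA, h1, hr, hr0, -⟩ := hagree
  have hval k : (c.run s).value o k = s.value o k := by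
    funext x
    simp only [State.value, ho, ho₁, hr]
  refine ⟨⟨?_, fun x hx hxu => ?_⟩, fun k hk x hx => ?_⟩
  · rw [hval, h.source]
  · rw [hval, h.other x hx hxu]
  · simpa only [State.RelaxedAt, State.edgeValue, hval, ho₂, hA, h1, hr0] using h.step k hk x hx

/-- The result of selecting among the pairs with the property `P`. -/
def State.Selected (s : State) (G : WeightedGraph n) (M : SimpleGraph (Fin n))
    (P : Fin n → Fin n → Prop) : Prop :=
  (s.nreg regFound = 0 ∧ ∀ i j, P i j → G.graph.Adj i j → M.Adj i j) ∨
  (s.nreg regFound = 1 ∧ ∃ a b : Fin n, s.nreg regLeft = a ∧ s.nreg regRight = b ∧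
    s.rreg rregWeight = G.w s(a, b) ∧ G.graph.Adj a b ∧ ¬ M.Adj a b ∧
    ∀ i j, P i j → G.graph.Adj i j → ¬ M.Adj i j → G.w s(a, b) ≤ G.w s(i, j))

theorem State.Selected.mono {P Q : Fin n → Fin n → Prop} (h : s.Selected G M P)
    (hQ : ∀ i j, Q i j → P i j) : s.Selected G M Q := by
  rcases h with ⟨hfound, hall⟩ | ⟨hfound, a, b, hleft, hright, hweight, hadj, hnot, hmin⟩
  · exact .inl ⟨hfound, fun i j hij => hall i j (hQ i j hij)⟩
  · exact .inr ⟨hfound, a, b, hleft, hright, hweight, hadj, hnot,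
      fun i j hij => hmin i j (hQ i j hij)⟩

theorem State.Selected.setN {P : Fin n → Fin n → Prop} (h : s.Selected G M P) {x : ℕ} (k : ℕ)
    (hx : x ∉ [regFound, regLeft, regRight]) : (s.setN x k).Selected G M P := by
  simp only [List.mem_cons, List.not_mem_nil, or_false, not_or, ne_comm (a := x)] at hx
  simpa [State.Selected, State.setN, hx] using h

namespace Cmd

theorem isLighter_holds (hs : s.Ctx G L d r M H) (hrow : s.nreg regRow = a)
    (hcol : s.nreg regCol = b) : isLighter.Holds s ↔ G.graph.Adj a b ∧ ¬ M.Adj a b ∧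
      (s.nreg regFound = 0 ∨ G.w s(a, b) < s.rreg rregWeight) := by
  simp only [isLighter, Test.Holds, Test.or_holds, Test.nlt_holds, Test.rlt_holds, NExp.eval,
    RExp.eval, hrow, hcol, hs.graph.one_le_iff, Nat.lt_one_iff]
  refine and_congr_right fun hadj => ?_
  rw [hs.weight a b hadj, ← hs.marked.one_le_iff, not_le, Nat.lt_one_iff]

theorem selectPair_spec {P : Fin n → Fin n → Prop} (hs : s.Ctx G L d r M H)
    (hrow : s.nreg regRow = a) (hcol : s.nreg regCol = b) (hsel : s.Selected G M P) :
    ((ite isLighter selectPair skip).run s).Selected G M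
      fun i j => P i j ∨ (i = a ∧ j = b) := by
  have htest := isLighter_holds hs hrow hcol
  by_cases hb : isLighter.Holds s
  · obtain ⟨hadj, hnot, hlt⟩ := htest.1 hb
    rw [run_ite_of_holds hb]
    refine .inr ⟨by simp [selectPair, block, run, State.setN, NExp.eval], a, b, ?_, ?_, ?_, hadj,
      hnot, ?_⟩
    · simp [selectPair, block, run, State.setN, NExp.eval, hrow]
    · simp [selectPair, block, run, State.setN, NExp.eval, hcol]
    · simp [selectPair, block, run, State.setN, NExp.eval, RExp.eval, hrow, hcol,
        hs.weight a b hadj]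
    · rintro i j (hij | ⟨rfl, rfl⟩) hG hM
      · rcases hsel with ⟨-, hall⟩ | ⟨hfound, a', b', -, -, hweight, -, -, hmin⟩
        · exact absurd (hall i j hij hG) hM
        · rw [hfound, hweight, NNReal.coe_lt_coe] at hlt
          exact (hlt.resolve_left one_ne_zero).le.trans (hmin i j hij hG hM)
      · exact le_rfl
  · rw [run_ite_of_not_holds hb]
    rw [htest] at hb
    rcases hsel with ⟨hfound, hall⟩ | ⟨hfound, a', b', hleft, hright, hweight, hadj, hnot, hmin⟩
    · refine .inl ⟨hfound, ?_⟩
      rintro i j (hij | ⟨rfl, rfl⟩) hG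
      · exact hall i j hij hG
      · by_contra hM
        exact hb ⟨hG, hM, .inl hfound⟩
    · refine .inr ⟨hfound, a', b', hleft, hright, hweight, hadj, hnot, ?_⟩
      rintro i j (hij | ⟨rfl, rfl⟩) hG hM
      · exact hmin i j hij hG hM
      · by_contra! hlt
        exact hb ⟨hG, hM, .inr (by rwa [hweight, NNReal.coe_lt_coe])⟩

theorem selectEdge_selected (hs : s.Ctx G L d r M H) :
    (selectEdge.run s).Selected G M fun _ _ => True := by
  rw [selectEdge, run_seq]
  set s₁ := (nset regFound (.lit 0)).run s
  have hs₁ : s₁.Ctx G L d r M H := hs.run (by decide)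
  refine And.right <| run_forN_forN_induction
    (fun P t => t.Ctx G L d r M H ∧ t.Selected G M P) hs₁.size (by decide) (by decide) (by decide)
    (by decide) (by decide) (fun P Q t hPQ h => ⟨h.1, h.2.mono hPQ⟩) (fun P t x k hx h => ?_)
    ⟨hs₁, .inl ⟨by simp [s₁, State.setN, run, NExp.eval], by simp⟩⟩
    fun P t a b hrow hcol h => ⟨h.1.run (by decide), selectPair_spec h.1 hrow hcol h.2⟩
  have hxs : ∀ x ∈ [regRow, regCol], .nreg x ∉ dataLocs ∧ x ∉ [regFound, regLeft, regRight] := by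
    decide
  exact ⟨h.1.setN k (hxs x hx).1, h.2.setN k (hxs x hx).2⟩

theorem selectEdge_spec (hs : s.Ctx G L d r M H) :
    ((selectEdge.run s).nreg regFound = 0 ∧ G.graph ≤ M) ∨
    ((selectEdge.run s).nreg regFound = 1 ∧ ∃ a b : Fin n, (selectEdge.run s).nreg regLeft = a ∧
      (selectEdge.run s).nreg regRight = b ∧ (selectEdge.run s).rreg rregWeight = G.w s(a, b) ∧
      IsLightestNew G.w G.graph M a b) := by
  rcases selectEdge_selected hs with
    ⟨hfound, hall⟩ | ⟨hfound, a, b, hleft, hright, hweight, hadj, hnot, hmin⟩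
  · exact .inl ⟨hfound, fun i j => hall i j trivial⟩
  · refine .inr ⟨hfound, a, b, hleft, hright, hweight, hadj, hnot, fun e he hM => ?_⟩
    induction e with
    | _ i j => exact hmin i j trivial he hM

end Cmd

end RealRAM

namespace RealRAM

open WeightedGraph

variable {n : ℕ} {G : WeightedGraph n} {L d r : ℕ} {M H : SimpleGraph (Fin n)} {s : State}
  {a b u v : Fin n}

theorem State.Rep.sum_eq_ncard {A : ℕ} (h : s.Rep A H) (a : Fin n) :
    ∑ j ∈ Finset.range n, s.narr A a j = (H.neighborSet a).ncard := by
  classical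
  have hcell (j : Fin n) : s.narr A a j = if H.Adj a j then 1 else 0 := by
    split_ifs with hj
    · exact (h a j).1 hj
    · exact (h a j).2 hj
  have hset : H.neighborSet a = ↑(Finset.univ.filter (H.Adj a)) := by
    ext
    simp
  rw [Finset.sum_range, Finset.sum_congr rfl fun j _ => hcell j, hset, Set.ncard_coe_finset,
    Finset.card_filter]

theorem ofReal_natCast_mul_coe (k : ℕ) (x : ℝ≥0) : ENNReal.ofReal (k * x) = k * x := by
  rw [ENNReal.ofReal_mul (by positivity), ENNReal.ofReal_natCast, ENNReal.ofReal_coe_nnreal]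

/-- What is computed in order to decide about the selected edge, whose ends are `a` and `b`. -/
structure State.Measured (s : State) (G : WeightedGraph n) (H : SimpleGraph (Fin n)) (L : ℕ)
    (a b : Fin n) : Prop where
  left : s.nreg regLeft = a
  right : s.nreg regRight = b
  degLeft : s.nreg regDegLeft = (H.neighborSet a).ncard
  degRight : s.nreg regDegRight = (H.neighborSet b).ncard
  weight : s.rreg rregWeight = G.w s(a, b)
  bound : s.rreg rregEdgeBound = (2 * L + 3 : ℕ) * G.w s(a, b)
  table : s.WalkTable G H H 1 20 a

namespace Cmd

theorem addTimes_spec {i k x m : ℕ} {e : RExp} {y : ℝ} (hi : i ≠ 0) (hik : k ≠ i)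
    (hk : s.nreg k = m) (hm : m ≤ s.nreg 0)
    (he : ∀ t : State, (∀ z ≠ x, t.rreg z = s.rreg z) → e.eval t = y) :
    ((addTimes i k x e).run s).rreg x = s.rreg x + m * y := by
  rw [addTimes]
  have hloop := run_forN_induction (s := s) (i := i)
    (c := ite (.nlt (.reg i) (.reg k)) (rset x (.add (.reg x) e)) skip)
    (fun j t => t.nreg k = m ∧ (∀ z ≠ x, t.rreg z = s.rreg z) ∧
      t.rreg x = s.rreg x + (min j m : ℕ) * y) rfl hi (by simp [writes])
    ⟨by simp [State.setN, hik, hk], by simp [State.setN], by simp [State.setN]⟩ ?_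
  · rw [hloop.2.2, min_eq_right hm]
  · rintro j - t - hti ⟨hkt, hoff, hx⟩
    by_cases hjm : j < m
    · rw [run_ite_of_holds (by simpa [Test.nlt_holds, NExp.eval, hkt, hti])]
      rw [min_eq_left hjm.le] at hx
      refine ⟨by simp [State.setN, run, hik, hkt],
        fun z hz => by simp [State.setN, run, hz, hoff], ?_⟩
      simp only [State.setN, run, RExp.eval, Function.update_self, hx, he t hoff,
        min_eq_left (Nat.succ_le_of_lt hjm)]
      push_cast
      ring
    · rw [run_ite_of_not_holds (by simpa [Test.nlt_holds, NExp.eval, hkt, hti] using hjm)]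
      rw [min_eq_right (not_lt.1 hjm)] at hx
      refine ⟨by simp [State.setN, run, hik, hkt], hoff, ?_⟩
      rw [min_eq_right (by omega)]
      exact hx

theorem degrees_spec (hn : s.nreg 0 = n) (hH : s.Rep 1 H) (hleft : s.nreg regLeft = a)
    (hright : s.nreg regRight = b) :
    (degrees.run s).nreg regDegLeft = (H.neighborSet a).ncard ∧
      (degrees.run s).nreg regDegRight = (H.neighborSet b).ncard := by
  simp only [degrees, block, run_seq]
  rw [← hH.sum_eq_ncard a, ← hH.sum_eq_ncard b]
  refine (run_forN_induction (fun j t => (t.nreg regLeft = a ∧ t.nreg regRight = b ∧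
      t.narr = s.narr) ∧ t.nreg regDegLeft = ∑ c ∈ Finset.range j, s.narr 1 a c ∧
      t.nreg regDegRight = ∑ c ∈ Finset.range j, s.narr 1 b c)
    (by simpa [run, State.setN] using hn) (by decide) (by simp [writes])
    ⟨by simp [run, State.setN, hleft, hright], by simp [run, State.setN, NExp.eval]⟩ ?_).2
  rintro j - t - hcount ⟨⟨hleft, hright, harr⟩, hdl, hdr⟩
  exact ⟨by simp [State.setN, run, hleft, hright, harr],
    by simp [State.setN, run, NExp.eval, hleft, hdl, hcount, harr, Finset.sum_range_succ],
    by simp [State.setN, run, NExp.eval, hright, hdr, hcount, harr, Finset.sum_range_succ]⟩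

theorem edgeBound_spec (hs : s.Ctx G L d r M H) (hL : L ≤ n) :
    (edgeBound.run s).rreg rregEdgeBound = (2 * L + 3 : ℕ) * s.rreg rregWeight := by
  simp only [edgeBound, block, run_seq]
  refine (addTimes_spec (m := L) (y := s.rreg rregWeight + s.rreg rregWeight) (by decide)
    (by decide) ?_ ?_ fun t ht => ?_).trans ?_
  · exact hs.log
  · exact hL.trans_eq hs.size.symm
  · simp [RExp.eval, ht, run]
  · simp only [run, RExp.eval, Function.update_self]
    push_cast
    ring

theorem pathBound_spec (hs : s.Ctx G L d r M H) (hr : r ≤ n) :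
    (pathBound.run s).rreg rregPathBound =
      r * (3 * (s.rreg rregEdgeBound + 8 * s.rreg rregWeight)) := by
  simp only [pathBound, block, run_seq]
  refine (addTimes_spec (m := r) (y := 3 * (s.rreg rregEdgeBound + 8 * s.rreg rregWeight))
    (by decide) (by decide) ?_ ?_ fun t ht => ?_).trans ?_
  · exact hs.radius
  · exact hr.trans_eq hs.size.symm
  · simp only [RExp.eval, ht rregTerm (by decide)]
    simp [run, RExp.eval]
    ring
  · simp [run, RExp.eval]

theorem measureSelected_spec (hs : s.Ctx G L d r M H) (hL : L ≤ n) (hHG : H ≤ G.graph)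
    (hleft : s.nreg regLeft = a) (hright : s.nreg regRight = b)
    (hweight : s.rreg rregWeight = G.w s(a, b)) :
    (measureSelected.run s).Measured G H L a b := by
  have hctx : (measureSelected.run s).Ctx G L d r M H := hs.run (by decide)
  have hleft' : (measureSelected.run s).nreg regLeft = a := (run_nreg (by decide) s).trans hleft
  have hright' : (measureSelected.run s).nreg regRight = b := (run_nreg (by decide) s).trans hright
  have hweight' : (measureSelected.run s).rreg rregWeight = G.w s(a, b) :=
    (run_rreg (by decide) s).trans hweight
  revert hctx hleft' hright' hweight'
  simp only [measureSelected, block, run_seq]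
  set s₁ := degrees.run s with hs₁
  set s₂ := edgeBound.run s₁ with hs₂
  set s₃ := (nset regOrigin (.reg regLeft)).run s₂ with hs₃
  intro hctx hleft' hright' hweight'
  have hc₁ : s₁.Ctx G L d r M H := hs.run (by decide)
  have hc₃ : s₃.Ctx G L d r M H := (hc₁.run (c := edgeBound) (by decide)).run (by decide)
  have horigin : s₃.nreg regOrigin = a := by
    have : s₂.nreg regLeft = a := by
      rw [hs₂, run_nreg (by decide), hs₁, run_nreg (by decide), hleft]
    simp [hs₃, run, State.setN, NExp.eval, this]
  obtain ⟨hdl, hdr⟩ := degrees_spec hs.size hs.spanner hleft hright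
  have hbound : s₂.rreg rregEdgeBound = (2 * L + 3 : ℕ) * G.w s(a, b) := by
    rw [hs₂, edgeBound_spec hc₁ hL, hs₁, run_rreg (by decide), hweight]
  refine ⟨hleft', hright', ?_, ?_, hweight', ?_,
    shortest_spec (by decide) (by decide) hc₃.size horigin, hctx.spanner, hctx.spanner,
    hctx.weight, hHG⟩
  · rw [run_nreg (by decide), hs₃, run_nreg (by decide), hs₂, run_nreg (by decide), hdl]
  · rw [run_nreg (by decide), hs₃, run_nreg (by decide), hs₂, run_nreg (by decide), hdr]
  · rw [run_rreg (by decide), hs₃, run_rreg (by decide), hbound]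

theorem needsEdge_holds (hs : s.Ctx G L d r M H) (hm : s.Measured G H L a b) :
    needsEdge.Holds s ↔ ((H.neighborSet a).ncard < d ∨ (H.neighborSet b).ncard < d) ∨
      (2 * L + 3 : ℕ) * G.w s(a, b) < dist G.w H a b := by
  rw [WeightedGraph.dist_comm, ← ofReal_natCast_mul_coe, hm.table.lt_dist_iff (by positivity)]
  simp only [needsEdge, Test.or_holds, Test.nlt_holds, Test.rlt_holds, NExp.eval, RExp.eval,
    hs.size, hs.deg, hm.right, hm.degLeft, hm.degRight, hm.bound]

theorem insertSelected_spec {R : ℕ} (hs : s.Ctx G L d r M H) (hL : L ≤ n)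
    (hI : SpannerInv G.w G.graph d (2 * L + 3) R M H) (hab : IsLightestNew G.w G.graph M a b)
    (hleft : s.nreg regLeft = a) (hright : s.nreg regRight = b)
    (hweight : s.rreg rregWeight = G.w s(a, b)) :
    ∃ H', H ≤ H' ∧ (insertSelected.run s).Ctx G L d r M H' ∧
      SpannerInv G.w G.graph d (2 * L + 3) R (M ⊔ SimpleGraph.edge a b) H' ∧
      (insertSelected.run s).rreg rregEdgeBound = (2 * L + 3 : ℕ) * G.w s(a, b) := by
  rw [insertSelected, run_seq]
  have hm := measureSelected_spec hs hL (hI.le.trans hI.le_graph) hleft hright hweight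
  set t := measureSelected.run s
  have ht : t.Ctx G L d r M H := hs.run (by decide)
  have htest := needsEdge_holds ht hm
  by_cases hneed : needsEdge.Holds t
  · rw [run_ite_of_holds hneed]
    refine ⟨H ⊔ SimpleGraph.edge a b, le_sup_left, ht.run_spanner (by decide)
      (addEdge_rep ht.spanner hab.adj.ne hm.left hm.right), ?_,
      (run_rreg (by decide) t).trans hm.bound⟩
    rcases htest.1 hneed with hdeg | hfar
    · exact hI.add_of_ncard_lt hab (by omega) hdeg
    · exact hI.add_of_lt_dist hab (by omega) hfar
  · rw [run_ite_of_not_holds hneed]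
    rw [htest] at hneed
    push Not at hneed
    exact ⟨H, le_rfl, ht, hI.mark hab hneed.1.1 hneed.1.2 hneed.2, hm.bound⟩

theorem tables_spec (hs : s.Ctx G L d r M H) (hHG : H ≤ G.graph) (hMG : M ≤ G.graph)
    (hu : s.nreg regSource = u) :
    (tables.run s).WalkTable G G.graph H 0 10 u ∧ (tables.run s).WalkTable G H H 1 20 u ∧
      (tables.run s).WalkTable G M H 2 30 u := by
  have hctx : (tables.run s).Ctx G L d r M H := hs.run (by decide)
  suffices h : (tables.run s).Table 0 10 n u ∧ (tables.run s).Table 1 20 n u ∧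
      (tables.run s).Table 2 30 n u from
    ⟨⟨h.1, hctx.graph, hctx.spanner, hctx.weight, le_rfl⟩,
      ⟨h.2.1, hctx.spanner, hctx.spanner, hctx.weight, hHG⟩,
      ⟨h.2.2, hctx.marked, hctx.spanner, hctx.weight, hMG⟩⟩
  clear hctx
  simp only [tables, block, run_seq]
  set s₀ := (nset regOrigin (.reg regSource)).run s with hs₀
  have hn : s₀.nreg 0 = n := (run_nreg (by decide) s).trans hs.size
  have horigin : s₀.nreg regOrigin = u := by simp [hs₀, run, State.setN, NExp.eval, hu]
  have hshortest {A o : ℕ} {t : State} (hA : A < o) (ho : 1 < o) (hn : t.nreg 0 = n)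
      (hu : t.nreg regOrigin = u) : ((shortest A o).run t).Table A o n u :=
    shortest_spec hA ho hn hu
  refine ⟨((hshortest ?_ ?_ ?_ ?_).run ?_).run ?_, (hshortest ?_ ?_ ?_ ?_).run ?_,
    hshortest ?_ ?_ ?_ ?_⟩
  all_goals first
    | decide
    | simpa only [run_nreg (c := shortest 0 10) (x := 0) (by decide),
        run_nreg (c := shortest 0 10) (x := regOrigin) (by decide),
        run_nreg (c := shortest 1 20) (x := 0) (by decide),
        run_nreg (c := shortest 1 20) (x := regOrigin) (by decide)]

theorem needsPath_holds {β : ℝ≥0} (hn : s.nreg 0 = n) (hv : s.nreg regTarget = v)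
    (hβ : s.rreg rregPathBound = β) (hG : s.WalkTable G G.graph H 0 10 u)
    (hH : s.WalkTable G H H 1 20 u) (hM : s.WalkTable G M H 2 30 u) :
    needsPath.Holds s ↔ dist G.w M v u ≤ dist G.w G.graph v u ∧
      dist G.w M v u + β < dist G.w H v u := by
  simp only [needsPath, Test.Holds, Test.or_holds, Test.nlt_holds, Test.rlt_holds, NExp.eval,
    RExp.eval, hn, hv, hβ]
  by_cases hreach : 1 ≤ s.narr 30 n v
  · obtain ⟨hdist, hnonneg⟩ := hM.dist_eq hreach
    have hreach' : 1 ≤ s.narr 10 n v := by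
      by_contra hnot
      have hle := dist_anti (w := G.w) hM.le v u
      rw [hG.dist_eq_top hnot, hdist, top_le_iff] at hle
      exact ENNReal.ofReal_ne_top hle
    obtain ⟨hdist', hnonneg'⟩ := hG.dist_eq hreach'
    rw [and_iff_right hreach, hdist, hdist', ENNReal.ofReal_le_ofReal_iff hnonneg',
      ← ENNReal.ofReal_coe_nnreal, ← ENNReal.ofReal_add hnonneg β.coe_nonneg,
      hH.lt_dist_iff (add_nonneg hnonneg β.coe_nonneg)]
  · simp [hreach, hM.dist_eq_top hreach]

theorem servePair_spec {R κ : ℕ} {ω : ℝ≥0} (hs : s.Ctx G L d r M H) (hR : 4 * n < R * R * d)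
    (hI : SpannerInv G.w G.graph d κ R M H) (hu : s.nreg regSource = u)
    (hv : s.nreg regTarget = v) (hω : ∀ e ∈ M.edgeSet, G.w e ≤ ω)
    (hbound : s.rreg rregPathBound = (R * (8 + κ) : ℕ) * ω) :
    ∃ H', H ≤ H' ∧ (servePair.run s).Ctx G L d r M H' ∧ SpannerInv G.w G.graph d κ R M H' ∧
      (dist G.w M v u ≤ dist G.w G.graph v u →
        dist G.w H' v u ≤ dist G.w G.graph v u + (R * (8 + κ) : ℕ) * ω) := by
  rw [servePair, run_seq]
  obtain ⟨hTG, hTH, hTM⟩ := tables_spec hs (hI.le.trans hI.le_graph) hI.le_graph hu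
  set t := tables.run s
  have ht : t.Ctx G L d r M H := hs.run (by decide)
  have hv' : t.nreg regTarget = v := (run_nreg (by decide) s).trans hv
  have htest := needsPath_holds (β := (R * (8 + κ) : ℕ) * ω) ht.size hv'
    (((run_rreg (by decide) s).trans hbound).trans (by push_cast; rfl)) hTG hTH hTM
  push_cast at htest hbound ⊢
  by_cases hneed : needsPath.Holds t
  · rw [run_ite_of_holds hneed]
    obtain ⟨hshort, hbad⟩ := htest.1 hneed
    have hreach : 1 ≤ t.narr 30 n v := by
      by_contra hnot
      simp [hTM.dist_eq_top hnot] at hbad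
    obtain ⟨p, H', hcost, hH', hrep⟩ :=
      buyPath_spec hTM ht.size hv' (State.value_ne_top_iff.2 hreach)
    have hlen := hTM.length_eq_dist hcost
    refine ⟨H', fun x y h => (hH' x y).2 (.inl h), ht.run_spanner (by decide) hrep,
      hI.buy (by simpa using hR) p (hlen.trans_le hshort) (hTM.missCount_le hcost) hω
        (by push_cast; rwa [hlen]) hH', fun _ => ?_⟩
    have hp : ∀ e ∈ p.edges, e ∈ H'.edgeSet := fun e he => by
      induction e with
      | _ x y => exact (hH' x y).2 (.inr he)
    calc dist G.w H' v u ≤ length G.w (p.transfer H' hp) := dist_le_length _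
      _ = dist G.w M v u := by rw [length, SimpleGraph.Walk.edges_transfer, ← hlen, length]
      _ ≤ dist G.w G.graph v u := hshort
      _ ≤ _ := le_self_add
  · rw [run_ite_of_not_holds hneed]
    refine ⟨H, le_rfl, ht, hI, fun hshort => ?_⟩
    rw [htest, not_and, not_lt] at hneed
    exact (hneed hshort).trans (add_le_add_left hshort _)

end Cmd

end RealRAM

namespace WeightedGraph

variable {V : Type*} {w : Sym2 V → ℝ≥0} {G M H H' : SimpleGraph V} {β : ℝ≥0∞} {a b : V}

/-- `H` stretches the shortest paths of `G` that run inside `M` by at most `β` times the weight of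
their heaviest edge. -/
def Serves (w : Sym2 V → ℝ≥0) (G M H : SimpleGraph V) (β : ℝ≥0∞) : Prop :=
  ∀ (u v : V) (P : G.Walk u v), (∀ e ∈ P.edges, e ∈ M.edgeSet) →
    (length w P : ℝ≥0∞) = dist w G u v → dist w H u v ≤ dist w G u v + β * heaviest w P

theorem Serves.bot : Serves w G ⊥ ⊥ β := by
  rintro u v (_ | ⟨h, P⟩) hP -
  · simp only [dist_self, zero_le]
  · exact absurd (hP _ (List.mem_cons_self ..)) (by simp)

theorem Serves.sup_edge (hS : Serves w G M H β) (hab : a ≠ b) (hH : H ≤ H')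
    (hnew : ∀ u v, dist w (M ⊔ SimpleGraph.edge a b) u v ≤ dist w G u v →
      dist w H' u v ≤ dist w G u v + β * w s(a, b)) :
    Serves w G (M ⊔ SimpleGraph.edge a b) H' β := fun u v P hP hlen => by
  by_cases hmem : s(a, b) ∈ P.edges
  · have hshort : dist w (M ⊔ SimpleGraph.edge a b) u v ≤ dist w G u v := by
      refine (dist_le_length (P.transfer _ hP)).trans_eq ?_
      rw [length, SimpleGraph.Walk.edges_transfer, ← length, hlen]
    refine (hnew u v hshort).trans ?_
    gcongr
    exact le_heaviest P hmem
  · refine (dist_anti hH u v).trans (hS u v P (fun e he => ?_) hlen)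
    exact ((mem_edgeSet_sup_edge hab).1 (hP e he)).resolve_right fun h => hmem (h ▸ he)

theorem Serves.isAdditiveSpanner {n : ℕ} {G : WeightedGraph n} {M H : SimpleGraph (Fin n)} {c : ℝ}
    (hS : Serves G.w G.graph M H β) (hM : G.graph ≤ M) (hH : H ≤ G.graph)
    (hβ : 2 ≤ n → β ≤ ENNReal.ofReal c) : G.IsAdditiveSpanner H c := by
  refine ⟨hH, fun u v P hP => ?_⟩
  rcases eq_or_ne u v with rfl | huv
  · simp only [dist_self, zero_le]
  · have hn : 2 ≤ n := Fin.nontrivial_iff_two_le.1 ⟨u, v, huv⟩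
    have hPM : ∀ e ∈ P.edges, e ∈ M.edgeSet := fun e he =>
      SimpleGraph.edgeSet_mono hM (P.edges_subset_edgeSet he)
    refine (hS u v P hPM hP.2).trans ?_
    gcongr
    exact hβ hn

end WeightedGraph

namespace RealRAM

open WeightedGraph

variable {n : ℕ} {G : WeightedGraph n} {L d r R κ k : ℕ} {M H : SimpleGraph (Fin n)} {ω : ℝ≥0}
  {s : State} {a b : Fin n}

/-! ### The rounds -/

/-- The result of serving the pairs with the property `P`, if `ω` is the greatest weight of a marked
edge and `H` is the spanner at the beginning. -/
def State.ServedPairs (s : State) (G : WeightedGraph n) (L d r R κ : ℕ) (ω : ℝ≥0)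
    (M H : SimpleGraph (Fin n)) (P : Fin n → Fin n → Prop) : Prop :=
  s.rreg rregPathBound = (R * (8 + κ) : ℕ) * ω ∧
    ∃ H', H ≤ H' ∧ s.Ctx G L d r M H' ∧ SpannerInv G.w G.graph d κ R M H' ∧
      ∀ u v, P u v → dist G.w M v u ≤ dist G.w G.graph v u →
        dist G.w H' v u ≤ dist G.w G.graph v u + (R * (8 + κ) : ℕ) * ω

namespace Cmd

theorem servePair_servedPairs {P : Fin n → Fin n → Prop} (hR : 4 * n < R * R * d)
    (hω : ∀ e ∈ M.edgeSet, G.w e ≤ ω) (hu : s.nreg regSource = a) (hv : s.nreg regTarget = b)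
    (hs : s.ServedPairs G L d r R κ ω M H P) :
    (servePair.run s).ServedPairs G L d r R κ ω M H fun u v => P u v ∨ (u = a ∧ v = b) := by
  obtain ⟨hbound, H₁, hle₁, hc₁, hI₁, hserved⟩ := hs
  obtain ⟨H₂, hle₂, hc₂, hI₂, hnew⟩ := servePair_spec hc₁ hR hI₁ hu hv hω hbound
  refine ⟨(run_rreg (by decide) s).trans hbound, H₂, hle₁.trans hle₂, hc₂, hI₂, ?_⟩
  rintro u v (huv | ⟨rfl, rfl⟩) hshort
  · exact (dist_anti hle₂ v u).trans (hserved u v huv hshort)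
  · exact hnew hshort

theorem servePairs_spec (hs : s.Ctx G L d r M H) (hR : 4 * n < R * R * d)
    (hI : SpannerInv G.w G.graph d κ R M H) (hω : ∀ e ∈ M.edgeSet, G.w e ≤ ω)
    (hbound : s.rreg rregPathBound = (R * (8 + κ) : ℕ) * ω) :
    ((forN regSource (forN regTarget servePair)).run s).ServedPairs G L d r R κ ω M H
      fun _ _ => True := by
  refine run_forN_forN_induction (fun P t => t.ServedPairs G L d r R κ ω M H P) hs.size
    (by decide) (by decide) (by decide) (by decide) (by decide) ?_ ?_
    ⟨hbound, H, le_rfl, hs, hI, fun _ _ h => h.elim⟩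
    fun P t a b hu hv h => servePair_servedPairs hR hω hu hv h
  · rintro P Q t hPQ ⟨hbound, H', hle, hc, hI, hserved⟩
    exact ⟨hbound, H', hle, hc, hI, fun u v huv => hserved u v (hPQ u v huv)⟩
  · rintro P t x k hx ⟨hbound, H', hle, hc, hI, hserved⟩
    have hfree : ∀ x ∈ [regSource, regTarget], .nreg x ∉ dataLocs := by decide
    exact ⟨hbound, H', hle, hc.setN k (hfree x hx), hI, hserved⟩

theorem processEdge_spec (hs : s.Ctx G L d r M H) (hL : L ≤ n) (hr : r ≤ n)
    (hR : 4 * n < (3 * r) * (3 * r) * d)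
    (hI : SpannerInv G.w G.graph d (2 * L + 3) (3 * r) M H)
    (hS : Serves G.w G.graph M H (3 * r * (8 + (2 * L + 3)) : ℕ)) (hleft : s.nreg regLeft = a)
    (hright : s.nreg regRight = b) (hweight : s.rreg rregWeight = G.w s(a, b))
    (hab : IsLightestNew G.w G.graph M a b) :
    ∃ H', (processEdge.run s).Ctx G L d r (M ⊔ SimpleGraph.edge a b) H' ∧
      SpannerInv G.w G.graph d (2 * L + 3) (3 * r) (M ⊔ SimpleGraph.edge a b) H' ∧
      Serves G.w G.graph (M ⊔ SimpleGraph.edge a b) H' (3 * r * (8 + (2 * L + 3)) : ℕ) := by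
  simp only [processEdge, block, run_seq]
  obtain ⟨H₁, hle₁, hc₁, hI₁, hedgeBound⟩ := insertSelected_spec hs hL hI hab hleft hright hweight
  set s₁ := insertSelected.run s
  set s₂ := (addEdge 2 regLeft regRight).run s₁
  set s₃ := pathBound.run s₂ with hs₃
  have hleft₁ : s₁.nreg regLeft = a := (run_nreg (by decide) s).trans hleft
  have hright₁ : s₁.nreg regRight = b := (run_nreg (by decide) s).trans hright
  have hc₂ : s₂.Ctx G L d r (M ⊔ SimpleGraph.edge a b) H₁ :=
    hc₁.run_marked (by decide) (addEdge_rep hc₁.marked hab.adj.ne hleft₁ hright₁)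
  have hc₃ : s₃.Ctx G L d r (M ⊔ SimpleGraph.edge a b) H₁ := hc₂.run (by decide)
  have hbound : s₃.rreg rregPathBound = (3 * r * (8 + (2 * L + 3)) : ℕ) * (G.w s(a, b) : ℝ) := by
    have hedgeBound₂ : s₂.rreg rregEdgeBound = s₁.rreg rregEdgeBound := run_rreg (by decide) s₁
    have hweight₂ : s₂.rreg rregWeight = s₁.rreg rregWeight := run_rreg (by decide) s₁
    have hweight₁ : s₁.rreg rregWeight = G.w s(a, b) := (run_rreg (by decide) s).trans hweight
    rw [hs₃, pathBound_spec hc₂ hr, hedgeBound₂, hweight₂, hedgeBound, hweight₁]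
    push_cast
    ring
  obtain ⟨-, H', hle', hc', hI', hserved⟩ := servePairs_spec hc₃ hR hI₁ (hI.le_weight hab) hbound
  exact ⟨H', hc', hI', hS.sup_edge hab.adj.ne (hle₁.trans hle') fun u v => hserved v u trivial⟩

/-- One round of the greedy algorithm. -/
def round : Cmd :=
  seq selectEdge (ite (.nle (.lit 1) (.reg regFound)) processEdge skip)

/-- As many rounds as there are pairs of vertices, after which all the edges are marked. -/
def rounds : Cmd := forN regOuter (forN regInner round)

end Cmd

/-- The invariant of the rounds: after `k` of them, at most `n * n - k` edges are unmarked. -/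
def State.RoundInv (s : State) (G : WeightedGraph n) (L d r k : ℕ) : Prop :=
  ∃ M H, s.Ctx G L d r M H ∧ SpannerInv G.w G.graph d (2 * L + 3) (3 * r) M H ∧
    Serves G.w G.graph M H (3 * r * (8 + (2 * L + 3)) : ℕ) ∧
    (G.graph \ M).edgeSet.ncard ≤ n * n - k

theorem State.RoundInv.zero (hs : s.Ctx G L d r ⊥ ⊥) : s.RoundInv G L d r 0 := by
  refine ⟨⊥, ⊥, hs, .bot, .bot, ?_⟩
  calc (G.graph \ ⊥).edgeSet.ncard ≤ Nat.card (Sym2 (Fin n)) := Set.ncard_le_card _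
    _ ≤ Nat.card (Fin n × Fin n) := Nat.card_le_card_of_surjective _ Sym2.mk_surjective
    _ = n * n := by simp

theorem State.RoundInv.setN (h : s.RoundInv G L d r k) {x : ℕ} (m : ℕ) (hx : .nreg x ∉ dataLocs) :
    (s.setN x m).RoundInv G L d r k := by
  obtain ⟨M, H, hc, h⟩ := h
  exact ⟨M, H, hc.setN m hx, h⟩

namespace Cmd

theorem round_spec (hL : L ≤ n) (hr : r ≤ n) (hR : 4 * n < (3 * r) * (3 * r) * d)
    (hs : s.RoundInv G L d r k) : (round.run s).RoundInv G L d r (k + 1) := by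
  obtain ⟨M, H, hc, hI, hS, hcard⟩ := hs
  have hc₁ : (selectEdge.run s).Ctx G L d r M H := hc.run (by decide)
  rw [round, run_seq]
  rcases selectEdge_spec hc with ⟨hfound, hall⟩ | ⟨hfound, a, b, hleft, hright, hweight, hab⟩
  · rw [run_ite_of_not_holds (by simp [Test.Holds, NExp.eval, hfound])]
    exact ⟨M, H, hc₁, hI, hS, by simp [sdiff_eq_bot_iff.2 hall]⟩
  · rw [run_ite_of_holds (by simp [Test.Holds, NExp.eval, hfound])]
    obtain ⟨H', hc', hI', hS'⟩ := processEdge_spec hc₁ hL hr hR hI hS hleft hright hweight hab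
    refine ⟨_, H', hc', hI', hS', ?_⟩
    have hlt : (G.graph \ (M ⊔ SimpleGraph.edge a b)).edgeSet.ncard <
        (G.graph \ M).edgeSet.ncard := by
      refine Set.ncard_lt_ncard (SimpleGraph.edgeSet_ssubset_edgeSet.2
        (lt_of_le_not_ge (sdiff_le_sdiff_left le_sup_left) fun hge => ?_)) (Set.toFinite _)
      exact (hge (show (G.graph \ M).Adj a b from ⟨hab.adj, hab.not_adj⟩)).2
        ((adj_sup_edge hab.adj.ne).2 (.inr rfl))
    omega

theorem rounds_spec (hL : L ≤ n) (hr : r ≤ n) (hR : 4 * n < (3 * r) * (3 * r) * d)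
    (hs : s.Ctx G L d r ⊥ ⊥) : (rounds.run s).RoundInv G L d r (n * n) := by
  have hzero : s.RoundInv G L d r (0 * n) := (Nat.zero_mul n).symm ▸ .zero hs
  refine run_forN_induction (fun j t => t.RoundInv G L d r (j * n)) hs.size (by decide) (by decide)
    (hzero.setN 0 (by decide)) fun j _ t hn _ ht => ?_
  rw [Nat.succ_mul]
  refine State.RoundInv.setN ?_ _ (by decide)
  exact run_forN_induction (fun l t => t.RoundInv G L d r (j * n + l)) hn (by decide) (by decide)
    (ht.setN 0 (by decide)) fun l _ t _ _ ht => (round_spec hL hr hR ht).setN _ (by decide)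

end Cmd

end RealRAM

/-! ### The parameters -/

namespace SpannerParam

/-- The binary logarithm of the degree threshold of the algorithm. -/
noncomputable def degExponent (n : ℕ) (ε : ℝ) : ℕ := ⌊ε * Nat.clog 2 n⌋₊

/-- The number of purchases charged to a vertex, about `√(n / n ^ ε)`. -/
noncomputable def radius (n : ℕ) (ε : ℝ) : ℕ := ⌈√(n / 2 ^ degExponent n ε)⌉₊

variable {n : ℕ} {ε : ℝ}

theorem clog_two_le (n : ℕ) : Nat.clog 2 n ≤ n :=
  (Nat.clog_le_iff_le_pow one_lt_two).2 Nat.lt_two_pow_self.le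

theorem two_pow_clog_le (hn : 1 ≤ n) : (2 : ℝ) ^ Nat.clog 2 n ≤ 2 * n := by
  rcases hn.eq_or_lt with rfl | hn
  · norm_num
  · have hlt := Nat.pow_pred_clog_lt_self one_lt_two hn
    have hpos : 0 < Nat.clog 2 n := Nat.clog_pos one_lt_two hn
    rw [← Nat.succ_pred_eq_of_pos hpos, pow_succ']
    gcongr
    exact_mod_cast hlt.le

theorem degExponent_le (hε : ε ≤ 1) : degExponent n ε ≤ n := by
  refine (Nat.floor_le_of_le ?_).trans (clog_two_le n)
  exact mul_le_of_le_one_left (Nat.cast_nonneg _) hε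

theorem two_pow_degExponent_le (hn : 1 ≤ n) (h0 : 0 ≤ ε) (h1 : ε ≤ 1) :
    (2 : ℝ) ^ degExponent n ε ≤ 2 * (n : ℝ) ^ ε := by
  have hfloor : (degExponent n ε : ℝ) ≤ Nat.clog 2 n * ε :=
    (Nat.floor_le (by positivity)).trans_eq (mul_comm _ _)
  calc (2 : ℝ) ^ degExponent n ε = (2 : ℝ) ^ (degExponent n ε : ℝ) := (Real.rpow_natCast _ _).symm
    _ ≤ (2 : ℝ) ^ (Nat.clog 2 n * ε) := Real.rpow_le_rpow_of_exponent_le one_le_two hfloor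
    _ = ((2 : ℝ) ^ Nat.clog 2 n) ^ ε := Real.rpow_natCast_mul zero_le_two _ _
    _ ≤ (2 * n) ^ ε := Real.rpow_le_rpow (by positivity) (two_pow_clog_le hn) h0
    _ = 2 ^ ε * (n : ℝ) ^ ε := Real.mul_rpow zero_le_two (by positivity)
    _ ≤ 2 * (n : ℝ) ^ ε := by
      gcongr
      exact Real.rpow_le_self_of_one_le one_le_two h1

theorem rpow_le_two_pow_degExponent (n : ℕ) (h0 : 0 ≤ ε) :
    (n : ℝ) ^ ε ≤ 2 * 2 ^ degExponent n ε := by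
  have hn : (n : ℝ) ≤ 2 ^ Nat.clog 2 n := mod_cast Nat.le_pow_clog one_lt_two n
  have hfloor : Nat.clog 2 n * ε ≤ (degExponent n ε + 1 : ℕ) := by
    rw [mul_comm]
    exact_mod_cast (Nat.lt_floor_add_one _).le
  calc (n : ℝ) ^ ε ≤ ((2 : ℝ) ^ Nat.clog 2 n) ^ ε := Real.rpow_le_rpow (by positivity) hn h0
    _ = (2 : ℝ) ^ (Nat.clog 2 n * ε) := (Real.rpow_natCast_mul zero_le_two _ _).symm
    _ ≤ (2 : ℝ) ^ ((degExponent n ε + 1 : ℕ) : ℝ) :=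
      Real.rpow_le_rpow_of_exponent_le one_le_two hfloor
    _ = 2 * 2 ^ degExponent n ε := by rw [Real.rpow_natCast, pow_succ']

theorem radius_le (n : ℕ) (ε : ℝ) : radius n ε ≤ n := by
  refine Nat.ceil_le.2 (Real.sqrt_le_iff.2 ⟨Nat.cast_nonneg n, ?_⟩)
  calc (n : ℝ) / 2 ^ degExponent n ε ≤ n := div_le_self (by positivity) (one_le_pow₀ one_le_two)
    _ ≤ (n : ℝ) ^ 2 := mod_cast Nat.le_self_pow two_ne_zero n

theorem le_radius_sq_mul (n : ℕ) (ε : ℝ) : n ≤ radius n ε ^ 2 * 2 ^ degExponent n ε := by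
  have hceil := (Real.sqrt_le_left (Nat.cast_nonneg _)).1
    (Nat.le_ceil √(n / 2 ^ degExponent n ε : ℝ))
  rw [div_le_iff₀ (by positivity)] at hceil
  rw [radius]
  exact_mod_cast hceil

theorem radius_le_rpow (hn : 1 ≤ n) (h0 : 0 ≤ ε) (h1 : ε ≤ 1) :
    (radius n ε : ℝ) ≤ 3 * (n : ℝ) ^ ((1 - ε) / 2) := by
  have hn' : (1 : ℝ) ≤ n := mod_cast hn
  set x := (n : ℝ) ^ ((1 - ε) / 2) with hx
  have hx1 : 1 ≤ x := Real.one_le_rpow hn' (by linarith)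
  have hx2 : x ^ 2 * (n : ℝ) ^ ε = n := by
    rw [hx, ← Real.rpow_mul_natCast (by positivity), ← Real.rpow_add (by positivity)]
    norm_num
  have hsqrt : √(n / 2 ^ degExponent n ε : ℝ) ≤ 2 * x := by
    refine Real.sqrt_le_iff.2 ⟨by positivity, ?_⟩
    rw [div_le_iff₀ (by positivity)]
    calc (n : ℝ) = x ^ 2 * (n : ℝ) ^ ε := hx2.symm
      _ ≤ x ^ 2 * (2 * 2 ^ degExponent n ε) := by
        gcongr
        exact rpow_le_two_pow_degExponent n h0
      _ ≤ (2 * x) ^ 2 * 2 ^ degExponent n ε := by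
        have : 0 ≤ x ^ 2 * 2 ^ degExponent n ε := by positivity
        linarith
  calc (radius n ε : ℝ) ≤ √(n / 2 ^ degExponent n ε : ℝ) + 1 :=
        (Nat.ceil_lt_add_one (Real.sqrt_nonneg _)).le
    _ ≤ 3 * x := by linarith

theorem clog_le_log (hn : 2 ≤ n) : (2 * Nat.clog 2 n + 11 : ℝ) ≤ 22 * Real.log n := by
  have hn' : (2 : ℝ) ≤ n := mod_cast hn
  have hclog : Nat.clog 2 n * Real.log 2 ≤ Real.log 2 + Real.log n := by
    rw [← Real.log_pow, ← Real.log_mul two_ne_zero (by positivity)]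
    exact Real.log_le_log (by positivity) (two_pow_clog_le (by omega))
  have hmono : Real.log 2 ≤ Real.log n := Real.log_le_log zero_lt_two hn'
  have hlog_two := Real.log_two_gt_d9
  nlinarith [(Nat.cast_nonneg (Nat.clog 2 n) : (0 : ℝ) ≤ Nat.clog 2 n)]

theorem size_le_rpow (hn : 1 ≤ n) (h0 : 0 ≤ ε) (h1 : ε ≤ 1) :
    ((n * (2 ^ degExponent n ε + 3) + (3 * radius n ε) ^ 2 : ℕ) : ℝ) ≤
      200 * (n : ℝ) ^ (1 + ε) := by
  have hn' : (1 : ℝ) ≤ n := mod_cast hn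
  have hradius : (radius n ε : ℝ) ^ 2 ≤ 9 * (n : ℝ) ^ (1 + ε) := by
    calc (radius n ε : ℝ) ^ 2 ≤ (3 * (n : ℝ) ^ ((1 - ε) / 2)) ^ 2 := by
          gcongr
          exact radius_le_rpow hn h0 h1
      _ = 9 * (n : ℝ) ^ (1 - ε) := by
        rw [mul_pow, ← Real.rpow_mul_natCast (by positivity)]
        norm_num
      _ ≤ 9 * (n : ℝ) ^ (1 + ε) := by
        gcongr
        linarith
  have hmul : (n : ℝ) * (n : ℝ) ^ ε = (n : ℝ) ^ (1 + ε) :=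
    (Real.rpow_one_add' (by positivity) (by positivity)).symm
  have hself : (n : ℝ) ≤ (n : ℝ) ^ (1 + ε) := Real.self_le_rpow_of_one_le hn' (by linarith)
  have hdeg : (n : ℝ) * 2 ^ degExponent n ε ≤ n * (2 * (n : ℝ) ^ ε) := by
    gcongr
    exact two_pow_degExponent_le hn h0 h1
  push_cast
  linarith

theorem stretch_le_rpow_mul_log (hn : 2 ≤ n) (h0 : 0 ≤ ε) (h1 : ε ≤ 1) :
    ((3 * radius n ε * (8 + (2 * Nat.clog 2 n + 3)) : ℕ) : ℝ) ≤
      200 * (n : ℝ) ^ ((1 - ε) / 2) * Real.log n := by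
  calc ((3 * radius n ε * (8 + (2 * Nat.clog 2 n + 3)) : ℕ) : ℝ)
      = 3 * radius n ε * (2 * Nat.clog 2 n + 11) := by push_cast; ring
    _ ≤ 3 * (3 * (n : ℝ) ^ ((1 - ε) / 2)) * (22 * Real.log n) := by
      gcongr
      · exact radius_le_rpow (by omega) h0 h1
      · exact clog_le_log hn
    _ = 198 * (n : ℝ) ^ ((1 - ε) / 2) * Real.log n := by ring
    _ ≤ 200 * (n : ℝ) ^ ((1 - ε) / 2) * Real.log n := by
      gcongr
      norm_num

end SpannerParam

namespace RealRAM

open WeightedGraph SpannerParam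

variable {n m i : ℕ} {b : Test} {c : Cmd} {s : State} {ε : ℝ}

theorem input_nreg_zero (G : WeightedGraph n) (ε : ℝ) : (input G ε).nreg 0 = n := by
  simp [input]

namespace Cmd

open NExp

/-- Repeating `c` as long as `b` holds, but at most as often as register `0` says. -/
def boundedWhile (i : ℕ) (b : Test) (c : Cmd) : Cmd := forN i (ite b c skip)

/-- Computing `Nat.clog 2` of the content of register `0`. -/
def computeLog : Cmd :=
  block [
    nset regPower (lit 1),
    nset regLog (lit 0),
    boundedWhile regIndex (.nlt (reg regPower) (reg 0))
      (block [
        nset regPower (add (reg regPower) (reg regPower)),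
        nset regLog (add (reg regLog) (lit 1))])]

/-- Computing `2 ^ degExponent n ε`. -/
def computeDeg : Cmd :=
  block [
    rset rregExponent (.lit 0),
    addTimes regIndex regLog rregExponent (.reg rregParam),
    nset regDeg (lit 1),
    rset rregNext (.lit 1),
    boundedWhile regIndex (.rle (.reg rregNext) (.reg rregExponent))
      (block [
        nset regDeg (add (reg regDeg) (reg regDeg)),
        rset rregNext (.add (.reg rregNext) (.lit 1))])]

/-- Computing `radius n ε`. There is no multiplication, so the products of the degree threshold
with the square of the radius and with the gap to the next square are kept in registers. -/
def computeRadius : Cmd :=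
  block [
    nset regRadius (lit 0),
    nset regSquare (lit 0),
    nset regGap (reg regDeg),
    boundedWhile regIndex (.nlt (reg regSquare) (reg 0))
      (block [
        nset regSquare (add (reg regSquare) (reg regGap)),
        nset regGap (add (reg regGap) (add (reg regDeg) (reg regDeg))),
        nset regRadius (add (reg regRadius) (lit 1))])]

/-- Computing all the parameters. -/
def parameters : Cmd := block [computeLog, computeDeg, computeRadius]

/-- The algorithm. -/
def spanner : Cmd := seq parameters rounds

theorem run_boundedWhile_induction (Inv : ℕ → State → Prop) (hn : s.nreg 0 = n) (hm : m ≤ n)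
    (hi0 : i ≠ 0) (h0 : .nreg 0 ∉ c.writes) (hset : ∀ k t x, Inv k t → Inv k (t.setN i x))
    (hinit : Inv 0 s) (htest : ∀ k t, t.nreg 0 = n → Inv k t → (b.Holds t ↔ k < m))
    (hstep : ∀ k t, Inv k t → Inv (k + 1) (c.run t)) :
    Inv m ((boundedWhile i b c).run s) := by
  have hloop := run_forN_induction (s := s) (i := i) (c := ite b c skip)
    (fun j t => Inv (min j m) t) hn hi0 (by simpa [writes] using h0)
    (hset _ _ _ (by simpa using hinit)) fun j _ t ht _ hInv => hset _ _ _ ?_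
  · rw [min_eq_right hm] at hloop
    exact hloop
  · by_cases hjm : j < m
    · rw [min_eq_left hjm.le] at hInv
      rw [run_ite_of_holds ((htest j t ht hInv).2 hjm), min_eq_left hjm]
      exact hstep j t hInv
    · rw [min_eq_right (not_lt.1 hjm)] at hInv
      rw [run_ite_of_not_holds (by simp [htest m t ht hInv]), min_eq_right (by omega)]
      exact hInv

theorem computeLog_spec (hn : s.nreg 0 = n) : (computeLog.run s).nreg regLog = Nat.clog 2 n := by
  simp only [computeLog, block, run_seq]
  refine (run_boundedWhile_induction (fun k t => t.nreg regPower = 2 ^ k ∧ t.nreg regLog = k)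
    (by simpa [run, State.setN] using hn) (clog_two_le n) (by decide) (by decide)
    (fun k t x h => ?_) (by simp [run, State.setN, NExp.eval])
    (fun k t ht h => ?_) fun k t h => ?_).2
  · simpa [State.setN] using h
  · rw [Test.nlt_holds, ← not_le, ← not_le, Nat.clog_le_iff_le_pow one_lt_two]
    simp [NExp.eval, ht, h.1]
  · simp [run, State.setN, NExp.eval, h.1, h.2, pow_succ, mul_two]

theorem computeDeg_spec (hn : s.nreg 0 = n) (hlog : s.nreg regLog = Nat.clog 2 n)
    (hε : s.rreg rregParam = ε) (h0 : 0 ≤ ε) (h1 : ε ≤ 1) :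
    (computeDeg.run s).nreg regDeg = 2 ^ degExponent n ε := by
  simp only [computeDeg, block, run_seq]
  set s₁ := (addTimes regIndex regLog rregExponent (.reg rregParam)).run
    ((rset rregExponent (.lit 0)).run s)
  have hexponent : s₁.rreg rregExponent = ε * Nat.clog 2 n := by
    refine (addTimes_spec (i := regIndex) (k := regLog) (x := rregExponent) (y := ε)
      (s := (rset rregExponent (.lit 0)).run s) (by decide) (by decide) hlog
      ((clog_two_le n).trans_eq hn.symm) fun t ht => ?_).trans ?_
    · simp [RExp.eval, ht, run, hε]
    · simp [run, RExp.eval, mul_comm]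
  have hn₁ : s₁.nreg 0 = n := (run_nreg (by decide) _).trans hn
  refine (run_boundedWhile_induction (fun k t => t.nreg regDeg = 2 ^ k ∧
      t.rreg rregNext = k + 1 ∧ t.rreg rregExponent = ε * Nat.clog 2 n)
    (by simpa [run, State.setN] using hn₁) (degExponent_le h1) (by decide) (by decide)
    (fun k t x h => ?_) (by simp [run, State.setN, NExp.eval, RExp.eval, hexponent])
    (fun k t _ h => ?_) fun k t h => ?_).1
  · simpa [State.setN] using h
  · rw [degExponent, ← Nat.succ_le_iff, Nat.le_floor_iff (by positivity)]
    simp [Test.Holds, RExp.eval, h.2]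
  · simp [run, State.setN, NExp.eval, RExp.eval, h, pow_succ, mul_two]

theorem computeRadius_spec (hn : s.nreg 0 = n) (hdeg : s.nreg regDeg = 2 ^ degExponent n ε) :
    (computeRadius.run s).nreg regRadius = radius n ε := by
  simp only [computeRadius, block, run_seq]
  set d := 2 ^ degExponent n ε with hd
  refine (run_boundedWhile_induction (fun k t => t.nreg regRadius = k ∧ t.nreg regDeg = d ∧
      t.nreg regSquare = k ^ 2 * d ∧ t.nreg regGap = (2 * k + 1) * d)
    (by simpa [run, State.setN] using hn) (radius_le n ε) (by decide) (by decide)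
    (fun k t x h => ?_) (by simp [run, State.setN, NExp.eval, hdeg])
    (fun k t ht h => ?_) fun k t h => ?_).1
  · simpa [State.setN] using h
  · rw [Test.nlt_holds, radius, Nat.lt_ceil, Real.lt_sqrt k.cast_nonneg,
      lt_div_iff₀ (by positivity)]
    simp only [NExp.eval, ht, h.2.2.1, hd]
    norm_cast
  · obtain ⟨hradius, hdeg, hsquare, hgap⟩ := h
    refine ⟨by simp [run, State.setN, NExp.eval, hradius], by simp [run, State.setN, hdeg],
      ?_, ?_⟩
    · simp [run, State.setN, NExp.eval, hsquare, hgap]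
      ring
    · simp [run, State.setN, NExp.eval, hdeg, hgap]
      ring

theorem parameters_spec (G : WeightedGraph n) (h0 : 0 ≤ ε) (h1 : ε ≤ 1) :
    (parameters.run (input G ε)).Ctx G (Nat.clog 2 n) (2 ^ degExponent n ε) (radius n ε) ⊥ ⊥ := by
  have hn : (input G ε).nreg 0 = n := input_nreg_zero G ε
  have harr A : (parameters.run (input G ε)).narr A = (input G ε).narr A :=
    run_narr (by simp [parameters, computeLog, computeDeg, computeRadius, boundedWhile, addTimes,
      block, writes]) _
  have hrarr : (parameters.run (input G ε)).rarr 0 = (input G ε).rarr 0 := run_rarr (by decide) _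
  have hn' : (parameters.run (input G ε)).nreg 0 = n := (run_nreg (by decide) _).trans hn
  revert harr hrarr hn'
  simp only [parameters, block, run_seq]
  set s₁ := computeLog.run (input G ε)
  set s₂ := computeDeg.run s₁
  intro harr hrarr hn'
  have hn₁ : s₁.nreg 0 = n := (run_nreg (by decide) _).trans hn
  have hlog₁ : s₁.nreg regLog = Nat.clog 2 n := computeLog_spec hn
  have hε₁ : s₁.rreg rregParam = ε := (run_rreg (by decide) _).trans (by simp [input])
  have hn₂ : s₂.nreg 0 = n := (run_nreg (by decide) _).trans hn₁
  have hlog₂ : s₂.nreg regLog = Nat.clog 2 n := (run_nreg (by decide) _).trans hlog₁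
  have hdeg₂ : s₂.nreg regDeg = 2 ^ degExponent n ε := computeDeg_spec hn₁ hlog₁ hε₁ h0 h1
  refine ⟨hn', (run_nreg (by decide) _).trans hlog₂, (run_nreg (by decide) _).trans hdeg₂,
    computeRadius_spec hn₂ hdeg₂, fun i j => ?_, fun i j => ?_, fun i j => ?_, fun i j hij => ?_⟩
  · rw [harr]
    simp +contextual [input]
  · rw [harr]
    simp [input]
  · rw [harr]
    simp [input]
  · rw [hrarr]
    simp [input, hij]

theorem wellFormed_spanner : spanner.WellFormed := by
  decide

theorem spanner_spec (hn : 1 ≤ n) (G : WeightedGraph n) (h0 : 0 ≤ ε) (h1 : ε ≤ 1) :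
    ∃ H : SimpleGraph (Fin n), Outputs (spanner.run (input G ε)) H ∧
      G.IsAdditiveSpanner H (200 * (n : ℝ) ^ ((1 - ε) / 2) * Real.log n) ∧
      (H.edgeSet.ncard : ℝ) ≤ 200 * (n : ℝ) ^ (1 + ε) := by
  have hR : 4 * n < (3 * radius n ε) * (3 * radius n ε) * 2 ^ degExponent n ε := by
    have := le_radius_sq_mul n ε
    nlinarith
  obtain ⟨M, H, hc, hI, hS, hcard⟩ :=
    rounds_spec (clog_two_le n) (radius_le n ε) hR (parameters_spec G h0 h1)
  have hM : G.graph ≤ M := by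
    rwa [Nat.sub_self, Nat.le_zero, Set.ncard_eq_zero, SimpleGraph.edgeSet_eq_empty,
      sdiff_eq_bot_iff] at hcard
  refine ⟨H, hc.spanner, hS.isAdditiveSpanner hM (hI.le.trans hI.le_graph) fun hn2 => ?_, ?_⟩
  · rw [← ENNReal.ofReal_natCast]
    exact ENNReal.ofReal_le_ofReal (stretch_le_rpow_mul_log hn2 h0 h1)
  · refine le_trans ?_ (size_le_rpow hn h0 h1)
    have hlt : n < 2 ^ (Nat.clog 2 n + 1) :=
      (Nat.le_pow_clog one_lt_two n).trans_lt (Nat.pow_lt_pow_right one_lt_two (Nat.lt_succ_self _))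
    have hsize := hI.ncard_edgeSet_le (by simpa using hR) (by simpa using hlt) (by omega)
    rw [Fintype.card_fin] at hsize
    exact_mod_cast hsize

end Cmd

end RealRAM

/-- There are one program `A` (which gets the weighted graph and `ε`), one polynomial `T` and one
constant `C`, such that for every weighted graph on `n` vertices and every `0 ≤ ε ≤ 1` the program
halts after at most `T(n)` steps with a `+(C n^((1-ε)/2) log n)·W` spanner that has at most
`C n^(1+ε)` edges. -/
theorem mainTheorem2 :
    ∃ (A : RealRAM.Program) (T : Polynomial ℕ) (C : ℝ), 0 < C ∧
      ∀ (n : ℕ) (G : WeightedGraph n) (ε : ℝ), 0 ≤ ε → ε ≤ 1 →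
        ∃ (k : ℕ) (t : RealRAM.State) (H : SimpleGraph (Fin n)),
          RealRAM.Exec A (RealRAM.input G ε) k t ∧ k ≤ T.eval n ∧ RealRAM.Outputs t H ∧
          G.IsAdditiveSpanner H (C * (n : ℝ) ^ ((1 - ε) / 2) * Real.log n) ∧
          (H.edgeSet.ncard : ℝ) ≤ C * (n : ℝ) ^ (1 + ε) := by
  refine ⟨RealRAM.Cmd.spanner.compile, RealRAM.Cmd.spanner.costPoly, 200, by norm_num,
    fun n G ε h0 h1 => ?_⟩
  obtain ⟨k, hk, hexec⟩ := RealRAM.Cmd.exec_compile RealRAM.Cmd.spanner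
    RealRAM.Cmd.wellFormed_spanner (by decide) (RealRAM.input G ε)
  rw [RealRAM.input_nreg_zero] at hk
  rcases n.eq_zero_or_pos with rfl | hn
  · refine ⟨k, _, ⊥, hexec, hk, fun i => i.elim0, ⟨bot_le, fun u => u.elim0⟩, ?_⟩
    rw [SimpleGraph.edgeSet_bot, Set.ncard_empty, Nat.cast_zero]
    positivity
  · obtain ⟨H, hout, hstretch, hsize⟩ := RealRAM.Cmd.spanner_spec hn G h0 h1
    exact ⟨k, _, H, hexec, hk, hout, hstretch, hsize⟩
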